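/- \textbf{Unitary case.} Let $E/F$ be a CM extension of a totally real field, $u_0\colon E\to\mathbb C$ an embedding above the real place $v_0$ of $F$, and $V$ a hermitian space over $E$ of signature $(1,1)$ at $v_0$ and $(2,0)$ at all other real places. Choose an orthonormal basis $e_{v,1},e_{v,2}$ of each $V_v$ (with $(e_{v_0,1},e_{v_0,1})=1$, $(e_{v_0,2},e_{v_0,2})=-1$), and let $e^u_j\in V_u=V\otimes_{E,u}\mathbb C$ and $z^u_j$ be the induced bases and coordinates on $V_\infty=V\otimes_{\mathbb Q}\mathbb R$, for $u\in\mathrm{Hom}(E,\mathbb C)$. For $b=(b_u)_u\in\mathbb N^{\mathrm{Hom}(E,\mathbb C)}$ put $T_b=\bigotimes_u V_u^{\otimes b_u}$. Let $\mathfrak D$ be the set of negative lines in $V_{u_0}$ (a unit disc, $\tau\leftrightarrow\mathbb C(\tau e_1+e_2)$) with base point $\mathbb Ce_2$, let $\xi=d\tau$ at the base point and $\Omega=\frac{i}{2\pi}\xi\wedge\bar\xi$. Put $$\nu_0=e^{-\pi\sum_{v,j}|z_{v,j}|^2},\qquad \varphi_0=(2\pi|z^{u_0}_1|^2-1)\,\nu_0\,\Omega,\qquad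 E_u=\tfrac12\sum_j\Big(z^u_j-\tfrac1\pi\tfrac{\partial}{\partial z^{\bar u}_j}\Big)\otimes L(e^u_j),$$ where $L$ is left multiplication in the tensor algebra and $j$ runs over $\{1,2\}$, but only over $\{1\}$ if $u$ lies above $v_0$. Put $\nu_b=(\prod_uE_u^{b_u})\nu_0$ and $\varphi_b=(\prod_uE_u^{b_u})\varphi_0$; by translation under $U(V_\infty)$ regard them as an invariant $T_b$-valued function, respectively $(1,1)$-form, on $\mathfrak D$, depending on $x\in V_\infty$. Give $T_b$ over $\mathfrak D$ the tensor product complex Hodge structure in which, at $\tau$, the tautological line in $V_{u_0}$ has type $(1,-1)$ and its orthogonal complement type $(0,0)$, $V_{\bar u_0}$ carries the conjugate structure (types $(-1,1)$ and $(0,0)$), and all other $V_u$ have type $(0,0)$. Split $D=d\otimes1$ into $\partial'$, $\bar\partial'$ (form type $(1,0)$, $(0,1)$, preserving Hodge type), $\nabla'$ (form type $(1,0)$, Hodge type $(p,q)\to(p-1,q+1)$) and $\bar\nabla'$ (form type $(0,1)$, $(p,q)\to(p+1,q-1)$), and put $D^c=(4\pi i)^{-1}(\partial'+\bar\nabla'-\bar\partial'-\nabla')$.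 Let $A^u_{ij}\colon T_{b-1_u-1_{\bar u}}\to T_b$ be the insertion of the tensor in $V_u\otimes V_{\bar u}$ dual to the hermitian form, in the $i$-th spot of $V_u^{\otimes b_u}$ and the $j$-th spot of $V_{\bar u}^{\otimes b_{\bar u}}$; let $[\,\cdot\,]\colon T_b\to T_{[b]}$ be the projection onto the common kernel of all contractions of $V_u$ against $V_{\bar u}$ along the span of the images of all $A^u_{ij}$; and put $\nu_\lambda=[\nu_b]$ and $\varphi_\lambda=\pi_{\lambda^+}([\varphi_b])$, where $\pi_{\lambda^+}$ symmetrizes each $V_u^{\otimes b_u}$ ($\lambda_u=(b_u,-b_{\bar u})$). Let $\omega(L_{v_0})$ be the action of $L=\frac12\begin{pmatrix}1&-i\\-i&-1\end{pmatrix}\in\mathfrak{sl}_2(\mathbb C)$ at $v_0$ through the Weil representation on functions of $x\in V_\infty$, normalized by $\omega(n(t))\phi(x)=e^{\pi it(x,x)}\phi(x)$. Then, as $T_b$-valued two-forms on $\mathfrak D$ for every $x\in V_\infty$, $$\omega(L_{v_0})\varphi_b=-DD^c\nu_b+\frac1{4\pi}\Big(\sum_{i=1}^{b_{u_0}}\sum_{j=1}^{b_{\bar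 u_0}}A^{u_0}_{ij}\varphi_{b-1_{u_0}-1_{\bar u_0}}+\sum_{i=1}^{b_{\bar u_0}}\sum_{j=1}^{b_{u_0}}A^{\bar u_0}_{ij}\varphi_{b-1_{u_0}-1_{\bar u_0}}\Big),\qquad \omega(L_{v_0})\varphi_\lambda=-DD^c\nu_\lambda .$$ \textbf{Orthogonal case.} Let $F$ be totally real, $v_0$ a real place, and $V$ a quadratic space over $F$ of signature $(1,2)$ at $v_0$ and $(3,0)$ at all other real places, with orthonormal bases $e_{v,1},e_{v,2},e_{v,3}$ of the $V_v$ ($e_{v_0,1}$ positive, $e_{v_0,2},e_{v_0,3}$ negative) and coordinates $x_{v,j}$. For $b=(b_v)_v$ put $T_b=\bigotimes_vV_v^{\otimes b_v}$ (complexified). Let $\mathfrak D$ be the set of oriented negative planes in $V_{v_0}$, with base point the plane of $(e_2,e_3)$, and $\Omega=\frac1{2\pi}\omega_{12}\wedge\omega_{13}$, where $\omega_{12},\omega_{13}$ is the basis of the cotangent space at the base point dual to the directions $X_{12},X_{13}$ of $\mathfrak p$ that move $e_2$, respectively $e_3$, towards $e_1$. Put $\nu_0=e^{-\pi\sum x_{v,j}^2}$,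 $\varphi_0=(4\pi x_{v_0,1}^2-1)\nu_0\Omega$, $E_v=\frac12\sum_j(x_{v,j}-\frac1{2\pi}\frac{\partial}{\partial x_{v,j}})\otimes L(e_{v,j})$ (only $j=1$ if $v=v_0$), $\nu_b=(\prod_vE_v^{b_v})\nu_0$, $\varphi_b=(\prod_vE_v^{b_v})\varphi_0$, again translated by $SO(V_\infty)$ to $\mathfrak D$. Let $V_{v_0}$ over $\mathfrak D$ have the Hodge structure in which the complement of the plane has type $(0,0)$ and, for an oriented orthonormal basis $w_1,w_2$ of the plane, $w_1\pm iw_2$ have types $(1,-1)$ and $(-1,1)$; the complex structure of $\mathfrak D$ is the one for which the line of type $(1,-1)$ is holomorphic; the other $V_v$ have type $(0,0)$. Define $D$, $D^c$ and $\omega(L_{v_0})$ as above. For $1\le j\le b_v$, $1\le k\le b_v-1$ let $A^v_{jk}\colon T_{b-2_v}\to T_b$ be the insertion of the tensor dual to the quadratic form in the spots $(j,k+1)$ if $j\le k$ and $(k,j)$ if $k<j$; let $[\,\cdot\,]$ be the projection onto the common kernel of all contractions of two spots of the same $V_v^{\otimes b_v}$ along the span of the images of all $A^v_{jk}$, and $\nu_\lambda=[\nu_b]$,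 $\varphi_\lambda=\pi_{\lambda^+}([\varphi_b])$ with $\pi_{\lambda^+}$ the symmetrization of each $V_v^{\otimes b_v}$. Then for every $x\in V_\infty$ $$\omega(L_{v_0})\varphi_b=-DD^c\nu_b+\frac1{8\pi}\sum_{j=1}^{b_{v_0}}\sum_{k=1}^{b_{v_0}-1}A^{v_0}_{jk}\varphi_{b-2_{v_0}},\qquad \omega(L_{v_0})\varphi_\lambda=-DD^c\nu_\lambda .$$ -/

import Mathlib

noncomputable section

namespace FunkeMillson

/-! ### Tensors, in components

`U` is a finite set of labels; to each label belongs an `n`-dimensional complex vector space with a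
fixed basis.  For `b : U → ℕ`, an element of `⨂_u T^{b u}` is given by its components, indexed by
all choices of a basis vector in each of the `b u` spots of each label `u`. -/

/-- Multi-indices: a basis vector for every spot. -/
abbrev Idx (n : ℕ) {U : Type*} (b : U → ℕ) : Type _ := ∀ u, Fin (b u) → Fin n

/-- The tensor space `T_b = ⨂_u T^{b u}(ℂ^n)`. -/
abbrev Tens (n : ℕ) {U : Type*} (b : U → ℕ) : Type _ := Idx n b → ℂ

/-- The endomorphism `⨂_{u, k} M u k` of `T_b`. -/
def tensorMap {n : ℕ} {U : Type*} [Fintype U] [DecidableEq U] (b : U → ℕ)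
    (M : ∀ u, Fin (b u) → Matrix (Fin n) (Fin n) ℂ) : Tens n b →ₗ[ℂ] Tens n b :=
  Matrix.toLin' (Matrix.of fun m m' : Idx n b => ∏ u, ∏ k, M u k (m u k) (m' u k))

/-- A complex linear map between finite coordinate spaces, as a continuous real linear map. -/
def realCLM {X Y : Type*} [Fintype X] [Fintype Y] (f : (X → ℂ) →ₗ[ℂ] (Y → ℂ)) :
    (X → ℂ) →L[ℝ] (Y → ℂ) :=
  (LinearMap.toContinuousLinearMap f).restrictScalars ℝ

/-- The projector `π_{λ⁺}` for one-row weights: the average over all permutations of the spots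
of each label. -/
def symmetrizer (n : ℕ) {U : Type*} [Fintype U] [DecidableEq U] (b : U → ℕ) :
    Tens n b →ₗ[ℂ] Tens n b :=
  ((∏ u, (Nat.factorial (b u) : ℂ))⁻¹) •
    ∑ σ : ∀ u, Equiv.Perm (Fin (b u)),
      LinearMap.funLeft ℂ ℂ (fun (m : Idx n b) u k => m u (σ u k))

/-- The position in which spot `k` ends up when a new spot is inserted at position `i`. -/
def skip (i k : ℕ) : ℕ := if k < i then k else k + 1

/-! Insertion of a fixed tensor with components `g` in some spots, and contraction against it:
`drop m` is the multi-index that remains when the entries of `m` in these spots are deleted. -/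

/-- Expansion operator: insert `g`. -/
def expand {X Y : Type*} (drop : X → Y) (g : X → ℝ) : (Y → ℂ) →ₗ[ℂ] (X → ℂ) where
  toFun t m := (g m : ℂ) * t (drop m)
  map_add' s t := by ext m; simp [mul_add]
  map_smul' c t := by ext m; simp [mul_left_comm]

/-- Contraction operator: pair with `g`. -/
def contract {X Y : Type*} [Fintype X] [DecidableEq Y] (drop : X → Y) (g : X → ℝ) :
    (X → ℂ) →ₗ[ℂ] (Y → ℂ) where
  toFun t m' := ∑ m, if drop m = m' then (g m : ℂ) * t m else 0
  map_add' s t := by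
    ext m'
    simp only [Pi.add_apply, ← Finset.sum_add_distrib]
    refine Finset.sum_congr rfl fun m _ => ?_
    split_ifs <;> simp [mul_add]
  map_smul' c t := by
    ext m'
    simp only [Pi.smul_apply, smul_eq_mul, RingHom.id_apply, Finset.mul_sum]
    refine Finset.sum_congr rfl fun m _ => ?_
    split_ifs <;> simp [mul_left_comm]

/-- The space `T_[b]`: the common kernel of all contraction operators. -/
def harmonicSpace {X ι : Type*} [Fintype X] {Y : ι → Type*} [∀ i, DecidableEq (Y i)]
    (drop : ∀ i, X → Y i) (g : ι → X → ℝ) : Submodule ℂ (X → ℂ) :=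
  ⨅ i, LinearMap.ker (contract (drop i) (g i))

/-- The span of the images of all expansion operators, the canonical complement of `T_[b]`. -/
def expansionSpace {X ι : Type*} {Y : ι → Type*}
    (drop : ∀ i, X → Y i) (g : ι → X → ℝ) : Submodule ℂ (X → ℂ) :=
  ⨆ i, LinearMap.range (expand (drop i) (g i))

/-- `contract` is adjoint to `expand`. -/
theorem contract_adjoint {X Y : Type*} [Fintype X] [Fintype Y] [DecidableEq Y] (drop : X → Y)
    (g : X → ℝ) (t : X → ℂ) (s : Y → ℂ) :
    ∑ m, t m * star (expand drop g s m) = ∑ m', contract drop g t m' * star (s m') := by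
  simp only [expand, contract, LinearMap.coe_mk, AddHom.coe_mk, Finset.sum_mul]
  rw [Finset.sum_comm]
  refine Finset.sum_congr rfl fun m _ => ?_
  rw [Finset.sum_eq_single (drop m)]
  · simp; ring
  · intro y _ hy
    simp [Ne.symm hy]
  · simp

/-- `T_b` is the direct sum of `T_[b]` and the span of the images of the expansion operators. -/
theorem isCompl_harmonic {X ι : Type*} [Fintype X] {Y : ι → Type*} [∀ i, DecidableEq (Y i)]
    [∀ i, Fintype (Y i)] (drop : ∀ i, X → Y i) (g : ι → X → ℝ) :
    IsCompl (harmonicSpace drop g) (expansionSpace drop g) := by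
  classical
  let e : EuclideanSpace ℂ X ≃ₗ[ℂ] (X → ℂ) := WithLp.linearEquiv 2 ℂ (X → ℂ)
  let K := (expansionSpace drop g).comap (e : EuclideanSpace ℂ X →ₗ[ℂ] (X → ℂ))
  have hK : Kᗮ = (harmonicSpace drop g).comap (e : EuclideanSpace ℂ X →ₗ[ℂ] (X → ℂ)) := by
    ext t
    rw [Submodule.mem_orthogonal]
    have key : ∀ i (s : Y i → ℂ), inner ℂ (e.symm (expand (drop i) (g i) s)) t
        = ∑ m', contract (drop i) (g i) (e t) m' * star (s m') := by
      intro i s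
      rw [← contract_adjoint, PiLp.inner_apply]
      rfl
    constructor
    · intro h
      simp only [harmonicSpace, Submodule.mem_comap, Submodule.mem_iInf, LinearMap.mem_ker]
      intro i
      have h1 := key i (contract (drop i) (g i) (e t))
      rw [h] at h1
      · have h2 : ∀ m', contract (drop i) (g i) (e t) m' = 0 := by
          have h3 : ∑ m', (‖contract (drop i) (g i) (e t) m'‖ ^ 2 : ℝ) = 0 := by
            have : ((∑ m', (‖contract (drop i) (g i) (e t) m'‖ ^ 2 : ℝ) : ℝ) : ℂ) = 0 := by
              rw [h1]
              push_cast
              refine Finset.sum_congr rfl fun m' _ => ?_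
              exact (Complex.mul_conj' _).symm
            exact_mod_cast this
          intro m'
          have h4 := (Finset.sum_eq_zero_iff_of_nonneg (fun _ _ => by positivity)).1 h3 m'
            (Finset.mem_univ _)
          simpa using h4
        exact funext h2
      · show e (e.symm _) ∈ expansionSpace drop g
        rw [e.apply_symm_apply]
        exact Submodule.mem_iSup_of_mem i (LinearMap.mem_range_self _ _)
    · intro h u hu
      have h' : ∀ i, contract (drop i) (g i) (e t) = 0 := by
        simp only [harmonicSpace, Submodule.mem_comap, Submodule.mem_iInf, LinearMap.mem_ker] at h
        exact h
      have hu' : e u ∈ expansionSpace drop g := hu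
      have : ∀ w ∈ expansionSpace drop g, inner ℂ (e.symm w) t = 0 := by
        intro w hw
        refine Submodule.iSup_induction _ (motive := fun w => inner ℂ (e.symm w) t = 0) hw
          ?_ ?_ ?_
        · rintro i _ ⟨s, rfl⟩
          rw [key, h' i]
          simp
        · simp
        · intro x y hx hy
          rw [map_add, inner_add_left, hx, hy, add_zero]
      simpa using this _ hu'
  have h := (Submodule.isCompl_orthogonal (K := K)).symm
  rw [hK] at h
  exact (OrderIso.isCompl_iff (Submodule.orderIsoMapComap e).symm).2 h

/-- The harmonic projection `[ ] : T_b → T_[b] ⊆ T_b`. -/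
def harmonicProj {X ι : Type*} [Fintype X] {Y : ι → Type*} [∀ i, DecidableEq (Y i)]
    [∀ i, Fintype (Y i)] (drop : ∀ i, X → Y i) (g : ι → X → ℝ) : (X → ℂ) →ₗ[ℂ] (X → ℂ) :=
  (harmonicSpace drop g).projection (expansionSpace drop g) (isCompl_harmonic drop g)

/-! ### Operators on functions with values in the full tensor space

Functions on `X` with values in `T = ⨁_c T_c`; the component at `m : U → List (Fin n)` belongs to
the basis tensor `⨂_u e_{m u}`, of weight `c u = length (m u)`. -/

/-- The operator `∑_j R u j ⊗ L(e^u_j)`, where `L` is left multiplication, i.e. `e^u_j` is put in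
front of the spots of label `u`. -/
def create {n : ℕ} {U X : Type*} [DecidableEq U] (R : U → Fin n → (X → ℂ) → (X → ℂ)) (u : U)
    (f : X → (U → List (Fin n)) → ℂ) : X → (U → List (Fin n)) → ℂ :=
  fun x m => match m u with
    | [] => 0
    | j :: l => R u j (fun y => f y (Function.update m u l)) x

/-- The function `(∏_u (∑_j R u j ⊗ L(e^u_j))^{b u}) (f ⊗ 1)`, which takes values in `T_b`. -/
def weighted {n : ℕ} {U X : Type*} [Fintype U] [DecidableEq U]
    (R : U → Fin n → (X → ℂ) → (X → ℂ)) (b : U → ℕ) (f : X → ℂ) : X → Tens n b :=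
  fun x m => (Finset.univ.toList.foldr (fun u F => (create R u)^[b u] F)
    (fun y l => if l = (fun _ => []) then f y else 0)) x (fun u => List.ofFn (m u))

/-! ### The infinitesimal Weil representation -/

/-- The action of `sl₂(ℂ)` on smooth functions on a real vector space `X` through the derived Weil
representation (for `ψ(t) = exp (2πit)`) of the metaplectic group attached to a quadratic subspace
of `X` with orthogonal basis `d`, coordinates `c` and `(d i, d i) = ε i = ±1`.  It is the derivative
of `ω(n(t))φ(x) = exp (πit (x, x)) φ(x)`, of `ω(m(a))φ(x) = a^{dim/2} φ(ax)`, and of the conjugate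
of the former by the Fourier transform:
`e ↦ πi (x, x)`, `h ↦ dim/2 + ∑ x_i ∂_i`, `f ↦ i/(4π) ∑ ε_i ∂_i²`. -/
def weilAction {X W ι : Type*} [NormedAddCommGroup X] [NormedSpace ℝ X] [NormedAddCommGroup W]
    [NormedSpace ℝ W] [NormedSpace ℂ W] [Fintype ι] (ε : ι → ℝ) (d : ι → X) (c : ι → X → ℝ)
    (g : LieAlgebra.SpecialLinear.sl (Fin 2) ℂ) (φ : X → W) (x : X) : W :=
  (g.1 0 0) • (((Fintype.card ι : ℂ) / 2) • φ x + ∑ i, (c i x : ℂ) • fderiv ℝ φ x (d i))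
  + (g.1 0 1) • ((Real.pi * Complex.I * ∑ i, (ε i : ℂ) * (c i x : ℂ) ^ 2) • φ x)
  + (g.1 1 0) • ((Complex.I / (4 * Real.pi)) •
      ∑ i, (ε i : ℂ) • iteratedFDeriv ℝ 2 φ x ![d i, d i])

/-- The lowering operator `½ (1, -i; -i, -1)` in `sl₂(ℂ)`. -/
def lowering : LieAlgebra.SpecialLinear.sl (Fin 2) ℂ :=
  ⟨!![1 / 2, -Complex.I / 2; -Complex.I / 2, -(1 / 2)],
    LinearMap.mem_ker.2 (by simp [Matrix.trace_fin_two])⟩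

/-! ### Differential forms with coefficients on the unit disc -/

/-- The wedge product of two scalar one-forms at a point. -/
def wedge (α β : ℂ →L[ℝ] ℂ) : ℂ [⋀^Fin 2]→L[ℝ] ℂ :=
  ContinuousMultilinearMap.alternatization
    ((ContinuousMultilinearMap.mkPiAlgebra ℝ (Fin 2) ℂ).compContinuousLinearMap ![α, β])

/-- `ω ⊗ t`, for a scalar form `ω` and a vector `t`. -/
def formTensor {T : Type*} [NormedAddCommGroup T] [NormedSpace ℝ T] [NormedSpace ℂ T]
    [IsScalarTower ℝ ℂ T] (ω : ℂ [⋀^Fin 2]→L[ℝ] ℂ) (t : T) : ℂ [⋀^Fin 2]→L[ℝ] T :=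
  ((ContinuousLinearMap.id ℝ ℂ).smulRight t).compContinuousAlternatingMap ω

/-- The `(1,0)`-part of a one-form at a point. -/
def part10 {T : Type*} [NormedAddCommGroup T] [NormedSpace ℝ T] [NormedSpace ℂ T]
    [SMulCommClass ℝ ℂ T] (α : ℂ →L[ℝ] T) : ℂ →L[ℝ] T :=
  (1 / 2 : ℂ) • (α - Complex.I • α.comp (ContinuousLinearMap.mul ℝ ℂ Complex.I))

/-- The `(0,1)`-part of a one-form at a point. -/
def part01 {T : Type*} [NormedAddCommGroup T] [NormedSpace ℝ T] [NormedSpace ℂ T]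
    [SMulCommClass ℝ ℂ T] (α : ℂ →L[ℝ] T) : ℂ →L[ℝ] T :=
  (1 / 2 : ℂ) • (α + Complex.I • α.comp (ContinuousLinearMap.mul ℝ ℂ Complex.I))

/-- The Hodge projection of `T_b` onto `𝒱_b^{(p,-p)}` at the point `τ`, for the tensor product of
the weight zero Hodge structures on the spaces of label `u` in which the `j`-th column of
`frame u τ` spans a line of type `(wt u j, -wt u j)`. -/
def hodgeProj {n : ℕ} {U : Type*} [Fintype U] [DecidableEq U] (b : U → ℕ)
    (frame : U → ℂ → Matrix (Fin n) (Fin n) ℂ) (wt : U → Fin n → ℤ) (p : ℤ) (τ : ℂ) :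
    Tens n b →ₗ[ℂ] Tens n b :=
  ∑ ε : Idx n b, if ∑ u, ∑ k, wt u (ε u k) = p then
    tensorMap b (fun u k => frame u τ * Matrix.single (ε u k) (ε u k) 1 * (frame u τ)⁻¹) else 0

/-- The operator `D^c = (4πi)⁻¹ (D' - D'')` on sections `s` of `T_b`. Here `D = d ⊗ 1` has the
components `∂'`, `∂̄'` (of form type `(1,0)`, `(0,1)`, preserving the Hodge type), `∇'` (of form type
`(1,0)`, from `(p,-p)` to `(p-1,1-p)`) and `∇̄'` (of form type `(0,1)`, from `(p,-p)` to
`(p+1,-p-1)`), and `D' = ∂' + ∇̄'`, `D'' = ∂̄' + ∇'`. All types that occur satisfy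
`|p| ≤ ∑ u, b u`. -/
def dc {n : ℕ} {U : Type*} [Fintype U] [DecidableEq U] (b : U → ℕ)
    (frame : U → ℂ → Matrix (Fin n) (Fin n) ℂ) (wt : U → Fin n → ℤ) (s : ℂ → Tens n b) (τ : ℂ) :
    ℂ →L[ℝ] Tens n b :=
  let π (p : ℤ) (σ : ℂ) := realCLM (hodgeProj b frame wt p σ)
  let ds (p : ℤ) := fderiv ℝ (fun σ => π p σ (s σ)) τ
  let N : ℤ := ∑ u, (b u : ℤ)
  (4 * Real.pi * Complex.I : ℂ)⁻¹ •
    ((∑ p ∈ Finset.Icc (-N) N,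
        ((π p τ).comp (part10 (ds p)) + (π (p + 1) τ).comp (part01 (ds p))))
    - (∑ p ∈ Finset.Icc (-N) N,
        ((π p τ).comp (part01 (ds p)) + (π (p - 1) τ).comp (part10 (ds p)))))

/-- `D D^c` on sections of `T_b`, where `D = d ⊗ 1`. -/
def ddc {n : ℕ} {U : Type*} [Fintype U] [DecidableEq U] (b : U → ℕ)
    (frame : U → ℂ → Matrix (Fin n) (Fin n) ℂ) (wt : U → Fin n → ℤ) (s : ℂ → Tens n b) (τ : ℂ) :
    ℂ [⋀^Fin 2]→L[ℝ] Tens n b :=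
  extDeriv (fun σ => ContinuousAlternatingMap.ofSubsingleton ℝ ℂ (Tens n b) (0 : Fin 1)
    (dc b frame wt s σ)) τ

/-! ### The unitary case

`S` is the set of real places of `F`, and `v₀ : S` the distinguished one. After the choice of one
embedding of `E` above each place (the distinguished `u₀` above `v₀`), the set of complex embeddings
of `E` is `S × Bool`: `(v, false)` is the chosen embedding above `v` and `(v, true)` its conjugate.
An orthonormal basis `e_{v,1}, e_{v,2}` of each `V_v` identifies `V_∞` with `S → ℂ²`, with hermitian
form `z₁ w̄₁ - z₂ w̄₂` at `v₀` and `z₁ w̄₁ + z₂ w̄₂` elsewhere; `V_u` is `ℂ²` with basis `e^u_j`. -/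

namespace Unitary

/-- The space `V_∞`. -/
abbrev Space (S : Type*) : Type _ := S → Fin 2 → ℂ

/-- The norm `(e_{v,j}, e_{v,j})`. -/
def sign {S : Type*} [DecidableEq S] (v₀ v : S) (j : Fin 2) : ℝ := if v = v₀ ∧ j = 1 then -1 else 1

/-- The complex conjugate `ū` of the embedding `u`. -/
def bar {S : Type*} (u : S × Bool) : S × Bool := (u.1, !u.2)

/-- `z ↦ z` for the chosen embeddings, `z ↦ z̄` for their conjugates. -/
def emb (s : Bool) (z : ℂ) : ℂ := if s then (starRingEnd ℂ) z else z

/-- The coordinate `z^u_j` on `V_∞`. -/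
def coord {S : Type*} (u : S × Bool) (j : Fin 2) (x : Space S) : ℂ := emb u.2 (x u.1 j)

/-- The Wirtinger derivative `∂/∂z^u_j`. -/
def dz {S : Type*} [Fintype S] [DecidableEq S] (u : S × Bool) (j : Fin 2) (f : Space S → ℂ)
    (x : Space S) : ℂ :=
  1 / 2 * (fderiv ℝ f x (Pi.single u.1 (Pi.single j 1))
    - emb u.2 Complex.I * fderiv ℝ f x (Pi.single u.1 (Pi.single j Complex.I)))

/-- The operator `½ (z^u_j - π⁻¹ ∂/∂z^ū_j)`. -/
def raise {S : Type*} [Fintype S] [DecidableEq S] (u : S × Bool) (j : Fin 2) (f : Space S → ℂ) :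
    Space S → ℂ :=
  fun x => 1 / 2 * (coord u j x * f x - (Real.pi : ℂ)⁻¹ * dz (bar u) j f x)

/-- The coefficients of the operators `E_u`: at `v₀` only `e^u_1` occurs. -/
def raiseE {S : Type*} [Fintype S] [DecidableEq S] (v₀ : S) (u : S × Bool) (j : Fin 2)
    (f : Space S → ℂ) : Space S → ℂ :=
  if u.1 = v₀ ∧ j = 1 then 0 else raise u j f

/-- The Gaussian `ν_0`. -/
def gaussian {S : Type*} [Fintype S] (x : Space S) : ℂ :=
  ∏ v, ∏ j, Complex.exp (-Real.pi * (coord (v, false) j x * coord (v, true) j x))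

/-- The function `ν_b = (∏_u E_u^{b_u}) ν_0` at the base point. -/
def nuBase {S : Type*} [Fintype S] [DecidableEq S] (v₀ : S) (b : S × Bool → ℕ) :
    Space S → Tens 2 b :=
  weighted (raiseE v₀) b gaussian

/-- The Funke–Millson form `φ_b = (∏_u E_u^{b_u}) φ_0` at the base point, where
`φ_0 = i h h̄ ν_0` is the Kudla–Millson form, for the Howe operators
`h = ½ (z̄_1 - π⁻¹ ∂/∂z_1) ⊗ ξ` and `h̄ = ½ (z_1 - π⁻¹ ∂/∂z̄_1) ⊗ ξ̄` at `v₀`. Under the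
identification of the tangent space of the disc at `0` with `𝔭`, `ξ = dτ`. -/
def phiBase {S : Type*} [Fintype S] [DecidableEq S] (v₀ : S) (b : S × Bool → ℕ) (x : Space S) :
    ℂ [⋀^Fin 2]→L[ℝ] Tens 2 b :=
  formTensor (wedge (ContinuousLinearMap.id ℝ ℂ) Complex.conjCLE)
    (weighted (raiseE v₀) b
      (fun y => Complex.I * raise (v₀, true) 0 (raise (v₀, false) 0 gaussian) y) x)

/-! The symmetric domain is the set of negative lines in `V_{u₀}`; every such line is spanned by a
unique vector `(τ, 1)` with `|τ| < 1`, which identifies it with the unit disc. -/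

/-- An element of `U(1,1)` that maps the base point `ℂ(0, 1)` to the line `ℂ(τ, 1)`. -/
def boost (τ : ℂ) : Matrix (Fin 2) (Fin 2) ℂ :=
  ((Real.sqrt (1 - ‖τ‖ ^ 2))⁻¹ : ℂ) • !![1, τ; (starRingEnd ℂ) τ, 1]

/-- The action of `2 × 2`-matrices on the set of lines `ℂ(τ, 1)`. -/
def moebius (g : Matrix (Fin 2) (Fin 2) ℂ) (τ : ℂ) : ℂ :=
  (g.mulVec ![τ, 1] 0) / (g.mulVec ![τ, 1] 1)

/-- The action of `boost τ`, as an element of `U(V_{v₀})`, on `V_u`. -/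
def boostAt {S : Type*} [DecidableEq S] (v₀ : S) (u : S × Bool) (τ : ℂ) :
    Matrix (Fin 2) (Fin 2) ℂ :=
  if u = (v₀, false) then boost τ
  else if u = (v₀, true) then (boost τ).map (starRingEnd ℂ) else 1

/-- The action of `(boost τ)⁻¹` on `V_∞`. -/
def backSpace {S : Type*} [DecidableEq S] (v₀ : S) (τ : ℂ) (x : Space S) : Space S :=
  Function.update x v₀ ((boost τ)⁻¹.mulVec (x v₀))

/-- `ν_b` as a family of sections over the disc: the translate of its value at the base point. -/
def nu {S : Type*} [Fintype S] [DecidableEq S] (v₀ : S) (b : S × Bool → ℕ) (x : Space S) (τ : ℂ) :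
    Tens 2 b :=
  tensorMap b (fun u _ => boostAt v₀ u τ) (nuBase v₀ b (backSpace v₀ τ x))

/-- `φ_b` as a family of two-forms on the disc: the translate of its value at the base point. -/
def phi {S : Type*} [Fintype S] [DecidableEq S] (v₀ : S) (b : S × Bool → ℕ) (x : Space S) (τ : ℂ) :
    ℂ [⋀^Fin 2]→L[ℝ] Tens 2 b :=
  (realCLM (tensorMap b (fun u _ => boostAt v₀ u τ))).compContinuousAlternatingMap
    ((phiBase v₀ b (backSpace v₀ τ x)).compContinuousLinearMap
      (fderiv ℝ (moebius (boost τ)⁻¹) τ))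

/-- Hodge types: in `V_{u₀}`, the tautological negative line (spanned by the second column of
`boost τ`) has type `(1,-1)` and its orthogonal complement type `(0,0)`; `V_ū₀` carries the complex
conjugate of this structure; the other `V_u` are of type `(0,0)`. -/
def wt {S : Type*} [DecidableEq S] (v₀ : S) (u : S × Bool) (j : Fin 2) : ℤ :=
  if u = (v₀, false) ∧ j = 1 then 1 else if u = (v₀, true) ∧ j = 1 then -1 else 0

/-- The tuple `b - 1_u - 1_ū` for the two embeddings above `v`. -/
def lower {S : Type*} [DecidableEq S] (b : S × Bool → ℕ) (v : S) (w : S × Bool) : ℕ :=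
  if w.1 = v then b w - 1 else b w

/-- Deletes the `i`-th spot of label `u` and the `j`-th spot of label `ū`. -/
def drop {S : Type*} [DecidableEq S] (b : S × Bool → ℕ) (u : S × Bool) (i : Fin (b u))
    (j : Fin (b (bar u))) (m : Idx 2 b) : Idx 2 (lower b u.1) :=
  fun w k => m w ⟨if w = u then skip i k else if w = bar u then skip j k else k, by
    have hk : k.1 < if w.1 = u.1 then b w - 1 else b w := k.2
    generalize k.1 = k' at hk ⊢
    unfold skip
    by_cases h : w.1 = u.1
    · rw [if_pos h] at hk
      split_ifs <;> omega
    · have h1 : w ≠ u := fun e => h (by rw [e])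
      have h2 : w ≠ bar u := fun e => h (by rw [e]; rfl)
      rw [if_neg h] at hk
      rw [if_neg h1, if_neg h2]
      exact hk⟩

/-- The components `(e_k, e_l)_v` of the hermitian form and of its dual tensor `∑ ± e^u_k ⊗ e^ū_k`,
in the `i`-th spot of label `u` and the `j`-th spot of label `ū`. -/
def pairing {S : Type*} [DecidableEq S] (v₀ : S) (b : S × Bool → ℕ) (u : S × Bool) (i : Fin (b u))
    (j : Fin (b (bar u))) (m : Idx 2 b) : ℝ :=
  if m u i = m (bar u) j then sign v₀ u.1 (m u i) else 0

/-- The operator `A^u_{ij} : T_{b - 1_u - 1_ū} → T_b`: insertion of the dual of the hermitian form in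
the `i`-th spot of label `u` and the `j`-th spot of label `ū`. -/
def insertion {S : Type*} [DecidableEq S] (v₀ : S) (b : S × Bool → ℕ) (u : S × Bool)
    (i : Fin (b u)) (j : Fin (b (bar u))) : Tens 2 (lower b u.1) →ₗ[ℂ] Tens 2 b :=
  expand (drop b u i j) (pairing v₀ b u i j)

/-- The harmonic projection `[ ] : T_b → T_[b]`. -/
def harm {S : Type*} [Fintype S] [DecidableEq S] (v₀ : S) (b : S × Bool → ℕ) :
    Tens 2 b →ₗ[ℂ] Tens 2 b :=
  harmonicProj (ι := Σ v : S, Fin (b (v, false)) × Fin (b (v, true)))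
    (fun I => drop b (I.1, false) I.2.1 I.2.2) (fun I => pairing v₀ b (I.1, false) I.2.1 I.2.2)

/-- `ν_λ = [ν_b]`. -/
def nuHarm {S : Type*} [Fintype S] [DecidableEq S] (v₀ : S) (b : S × Bool → ℕ) (x : Space S)
    (τ : ℂ) : Tens 2 b :=
  harm v₀ b (nu v₀ b x τ)

/-- `φ_λ = π_{λ⁺} [φ_b]`. -/
def phiHarm {S : Type*} [Fintype S] [DecidableEq S] (v₀ : S) (b : S × Bool → ℕ) (x : Space S)
    (τ : ℂ) : ℂ [⋀^Fin 2]→L[ℝ] Tens 2 b :=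
  (realCLM (symmetrizer 2 b ∘ₗ harm v₀ b)).compContinuousAlternatingMap (phi v₀ b x τ)

/-- `ω(L_{v₀})`: the lowering operator in the Weil representation of the four-dimensional real
quadratic space underlying `V_{v₀}`. -/
def weilL {S : Type*} [Fintype S] [DecidableEq S] (v₀ : S) {W : Type*} [NormedAddCommGroup W]
    [NormedSpace ℝ W] [NormedSpace ℂ W] (φ : Space S → W) : Space S → W :=
  weilAction (ι := Fin 2 × Bool) (fun k => sign v₀ v₀ k.1)
    (fun k => Pi.single v₀ (Pi.single k.1 (if k.2 then Complex.I else 1)))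
    (fun k x => if k.2 then (x v₀ k.1).im else (x v₀ k.1).re) lowering φ

/-- The operator `D D^c`. -/
def DDc {S : Type*} [Fintype S] [DecidableEq S] (v₀ : S) (b : S × Bool → ℕ) (s : ℂ → Tens 2 b) :
    ℂ → ℂ [⋀^Fin 2]→L[ℝ] Tens 2 b :=
  ddc b (boostAt v₀) (wt v₀) s

end Unitary

/-! ### The orthogonal case

`S` is the set of real places of `F`, and `v₀ : S` the distinguished one. An orthonormal basis
`e_{v,1}, e_{v,2}, e_{v,3}` of each `V_v` identifies `V_∞` with `S → ℝ³`, with quadratic form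
`x₁² - x₂² - x₃²` at `v₀` and `x₁² + x₂² + x₃²` elsewhere. All tensors are complexified. -/

namespace Orthogonal

/-- The space `V_∞`. -/
abbrev Space (S : Type*) : Type _ := S → Fin 3 → ℝ

/-- The norm `(e_{v,j}, e_{v,j})`. -/
def sign {S : Type*} [DecidableEq S] (v₀ v : S) (j : Fin 3) : ℝ := if v = v₀ ∧ j ≠ 0 then -1 else 1

/-- The operator `½ (x_{v,j} - (2π)⁻¹ ∂/∂x_{v,j})`. -/
def raise {S : Type*} [Fintype S] [DecidableEq S] (v : S) (j : Fin 3) (f : Space S → ℂ) :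
    Space S → ℂ :=
  fun x => 1 / 2 * ((x v j : ℂ) * f x
    - (2 * Real.pi : ℂ)⁻¹ * fderiv ℝ f x (Pi.single v (Pi.single j 1)))

/-- The coefficients of the operators `E_v`: at `v₀` only `e_{v₀,1}` occurs. -/
def raiseE {S : Type*} [Fintype S] [DecidableEq S] (v₀ v : S) (j : Fin 3) (f : Space S → ℂ) :
    Space S → ℂ :=
  if v = v₀ ∧ j ≠ 0 then 0 else raise v j f

/-- The Gaussian `ν_0`. -/
def gaussian {S : Type*} [Fintype S] (x : Space S) : ℂ :=
  ∏ v, Complex.exp (-Real.pi * ((x v 0 : ℂ) ^ 2 + (x v 1 : ℂ) ^ 2 + (x v 2 : ℂ) ^ 2))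

/-- The function `ν_b = (∏_v E_v^{b_v}) ν_0` at the base point. -/
def nuBase {S : Type*} [Fintype S] [DecidableEq S] (v₀ : S) (b : S → ℕ) : Space S → Tens 3 b :=
  weighted (raiseE v₀) b gaussian

/-! The symmetric domain is the set of oriented negative planes in `V_{v₀}`, with the complex
structure for which the line of type `(1,-1)` of an oriented plane, spanned by `w₁ + i w₂` for any
oriented orthonormal basis `w₁, w₂`, varies holomorphically. It has two components, the orbits of
the base point (the plane of `e_2, e_3` with this orientation) and of its image under
`flip = diag (-1, 1, -1)`. Each is identified with the unit disc: the point `τ` with `|τ| < 1`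
corresponds to the isotropic line spanned by `line τ` in the first component and by its image under
`flip` in the second. -/

/-- The vector `(2τ, 1 + τ², i (1 - τ²))`. -/
def line (τ : ℂ) : Fin 3 → ℂ := ![2 * τ, 1 + τ ^ 2, Complex.I * (1 - τ ^ 2)]

/-- An element of `SO(1,2)` that maps the base point to the point `τ` of the same component; its
last two columns are proportional to the real and imaginary parts of `line τ`. -/
def boost (τ : ℂ) : Matrix (Fin 3) (Fin 3) ℝ :=
  (1 - ‖τ‖ ^ 2)⁻¹ • !![1 + ‖τ‖ ^ 2, 2 * τ.re, 2 * τ.im;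
    2 * τ.re, (line τ 1).re, (line τ 1).im; 2 * τ.im, (line τ 2).re, (line τ 2).im]

/-- An element of `SO(1,2)` that exchanges the two components (for `s = true`), or the identity. -/
def flip (s : Bool) : Matrix (Fin 3) (Fin 3) ℝ :=
  if s then !![-1, 0, 0; 0, 1, 0; 0, 0, -1] else 1

/-- An element of `SO(1,2)` that maps the base point to the point `τ` of the component `s`. -/
def move (s : Bool) (τ : ℂ) : Matrix (Fin 3) (Fin 3) ℝ := flip s * boost τ

/-- The point of the unit disc that corresponds to the isotropic line spanned by `w`, in the first
component. -/
def disc (w : Fin 3 → ℂ) : ℂ := w 0 / (w 1 - Complex.I * w 2)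

/-- The map from the component `s` to the first component induced by `g`. -/
def moebius (s : Bool) (g : Matrix (Fin 3) (Fin 3) ℝ) (τ : ℂ) : ℂ :=
  disc (((g * flip s).map Complex.ofReal).mulVec (line τ))

/-- The Funke–Millson form `φ_b = (∏_v E_v^{b_v}) φ_0` at the base point, where
`φ_0 = (4π x_{v₀,1}² - 1) ν_0 ⊗ Ω` is the Kudla–Millson form and `Ω = (2π)⁻¹ ω_{12} ∧ ω_{13}`.
The basis `X_{12}, X_{13}` of `𝔭` moves the isotropic line of the base point in the directions
`e_1` and `i e_1`, so `ω_{12} = 2 Re dτ` and `ω_{13} = 2 Im dτ`. -/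
def phiBase {S : Type*} [Fintype S] [DecidableEq S] (v₀ : S) (b : S → ℕ) (x : Space S) :
    ℂ [⋀^Fin 2]→L[ℝ] Tens 3 b :=
  formTensor ((2 * Real.pi : ℂ)⁻¹ • wedge ((2 : ℝ) • Complex.ofRealCLM.comp Complex.reCLM)
      ((2 : ℝ) • Complex.ofRealCLM.comp Complex.imCLM))
    (weighted (raiseE v₀) b
      (fun y => (4 * Real.pi * (y v₀ 0 : ℂ) ^ 2 - 1) * gaussian y) x)

/-- The action of `move s τ`, as an element of `SO(V_{v₀})`, on `V_v`. -/
def moveAt {S : Type*} [DecidableEq S] (v₀ : S) (s : Bool) (v : S) (τ : ℂ) :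
    Matrix (Fin 3) (Fin 3) ℂ :=
  if v = v₀ then (move s τ).map Complex.ofReal else 1

/-- The action of `(move s τ)⁻¹` on `V_∞`. -/
def backSpace {S : Type*} [DecidableEq S] (v₀ : S) (s : Bool) (τ : ℂ) (x : Space S) : Space S :=
  Function.update x v₀ ((move s τ)⁻¹.mulVec (x v₀))

/-- `ν_b` as a family of sections over the component `s`: the translate of its value at the base
point. -/
def nu {S : Type*} [Fintype S] [DecidableEq S] (v₀ : S) (b : S → ℕ) (s : Bool) (x : Space S)
    (τ : ℂ) : Tens 3 b :=
  tensorMap b (fun v _ => moveAt v₀ s v τ) (nuBase v₀ b (backSpace v₀ s τ x))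

/-- `φ_b` as a family of two-forms on the component `s`: the translate of its value at the base
point. -/
def phi {S : Type*} [Fintype S] [DecidableEq S] (v₀ : S) (b : S → ℕ) (s : Bool) (x : Space S)
    (τ : ℂ) : ℂ [⋀^Fin 2]→L[ℝ] Tens 3 b :=
  (realCLM (tensorMap b (fun v _ => moveAt v₀ s v τ))).compContinuousAlternatingMap
    ((phiBase v₀ b (backSpace v₀ s τ x)).compContinuousLinearMap
      (fderiv ℝ (moebius s (move s τ)⁻¹) τ))

/-- Translates of `e_1`, `e_2 + i e_3`, `e_2 - i e_3`, as columns; away from `v₀` the basis is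
irrelevant. -/
def frame {S : Type*} [DecidableEq S] (v₀ : S) (s : Bool) (v : S) (τ : ℂ) :
    Matrix (Fin 3) (Fin 3) ℂ :=
  moveAt v₀ s v τ * !![1, 0, 0; 0, 1, 1; 0, Complex.I, -Complex.I]

/-- Hodge types: at `v₀`, the orthogonal complement of the negative plane has type `(0,0)`, and the
lines spanned by `w₁ + i w₂` and `w₁ - i w₂`, for an oriented orthonormal basis `w₁, w₂` of the
plane, have types `(1,-1)` and `(-1,1)`; the other `V_v` are of type `(0,0)`. -/
def wt {S : Type*} [DecidableEq S] (v₀ v : S) (j : Fin 3) : ℤ :=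
  if v = v₀ then ![0, 1, -1] j else 0

/-- The tuple `b - 2_v`. -/
def lower {S : Type*} [DecidableEq S] (b : S → ℕ) (v w : S) : ℕ :=
  if w = v then b w - 2 else b w

/-- The second spot affected by the operator `A_{jk}`: the spots are `(j, k + 1)` if `j ≤ k` and
`(k, j)` if `k < j`. -/
def other {N : ℕ} (j : Fin N) (k : Fin (N - 1)) : Fin N :=
  ⟨skip j k, by have := j.2; have := k.2; unfold skip; split_ifs <;> omega⟩

/-- Deletes the two spots of label `v` given by `(j, k)`. -/
def drop {S : Type*} [DecidableEq S] (b : S → ℕ) (v : S) (j : Fin (b v)) (k : Fin (b v - 1))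
    (m : Idx 3 b) : Idx 3 (lower b v) :=
  fun w l => m w ⟨if w = v then
      skip (max j.1 (other j k).1) (skip (min j.1 (other j k).1) l) else l, by
    have hl : l.1 < if w = v then b w - 2 else b w := l.2
    generalize l.1 = l' at hl ⊢
    by_cases h : w = v
    · subst h
      rw [if_pos rfl] at hl
      rw [if_pos rfl]
      unfold skip
      split_ifs <;> omega
    · rw [if_neg h] at hl
      rw [if_neg h]
      exact hl⟩

/-- The components of the quadratic form and of its dual tensor `∑ ± e_{v,j} ⊗ e_{v,j}`, in the two
spots of label `v` given by `(j, k)`. -/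
def pairing {S : Type*} [DecidableEq S] (v₀ : S) (b : S → ℕ) (v : S) (j : Fin (b v))
    (k : Fin (b v - 1)) (m : Idx 3 b) : ℝ :=
  if m v j = m v (other j k) then sign v₀ v (m v j) else 0

/-- The operator `A^v_{jk} : T_{b - 2_v} → T_b`: insertion of the dual of the quadratic form in the
spots `(j, k + 1)` (if `j ≤ k`) or `(k, j)` (if `k < j`). -/
def insertion {S : Type*} [DecidableEq S] (v₀ : S) (b : S → ℕ) (v : S) (j : Fin (b v))
    (k : Fin (b v - 1)) : Tens 3 (lower b v) →ₗ[ℂ] Tens 3 b :=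
  expand (drop b v j k) (pairing v₀ b v j k)

/-- The harmonic projection `[ ] : T_b → T_[b]` (every pair of spots of the same label is given by
two pairs `(j, k)`). -/
def harm {S : Type*} [Fintype S] [DecidableEq S] (v₀ : S) (b : S → ℕ) : Tens 3 b →ₗ[ℂ] Tens 3 b :=
  harmonicProj (ι := Σ v : S, Fin (b v) × Fin (b v - 1))
    (fun I => drop b I.1 I.2.1 I.2.2) (fun I => pairing v₀ b I.1 I.2.1 I.2.2)

/-- `ν_λ = [ν_b]`. -/
def nuHarm {S : Type*} [Fintype S] [DecidableEq S] (v₀ : S) (b : S → ℕ) (s : Bool) (x : Space S)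
    (τ : ℂ) : Tens 3 b :=
  harm v₀ b (nu v₀ b s x τ)

/-- `φ_λ = π_{λ⁺} [φ_b]`. -/
def phiHarm {S : Type*} [Fintype S] [DecidableEq S] (v₀ : S) (b : S → ℕ) (s : Bool) (x : Space S)
    (τ : ℂ) : ℂ [⋀^Fin 2]→L[ℝ] Tens 3 b :=
  (realCLM (symmetrizer 3 b ∘ₗ harm v₀ b)).compContinuousAlternatingMap (phi v₀ b s x τ)

/-- `ω(L_{v₀})`: the lowering operator in the Weil representation of `V_{v₀}`. -/
def weilL {S : Type*} [Fintype S] [DecidableEq S] (v₀ : S) {W : Type*} [NormedAddCommGroup W]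
    [NormedSpace ℝ W] [NormedSpace ℂ W] (φ : Space S → W) : Space S → W :=
  weilAction (ι := Fin 3) (fun k => sign v₀ v₀ k) (fun k => Pi.single v₀ (Pi.single k 1))
    (fun k x => x v₀ k) lowering φ

/-- The operator `D D^c`. -/
def DDc {S : Type*} [Fintype S] [DecidableEq S] (v₀ : S) (b : S → ℕ) (s : Bool)
    (f : ℂ → Tens 3 b) : ℂ → ℂ [⋀^Fin 2]→L[ℝ] Tens 3 b :=
  ddc b (frame v₀ s) (wt v₀) f

end Orthogonal

end FunkeMillson

end

/-! Both cases are the same computation, with two ingredients: a scalar function of the component of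
`x` at `v₀`, and a tensor of Hodge type `(0,0)` that moves with `τ` like the translate of `e_1`.

Scalar part. The operators `E_u` are creation operators of a harmonic oscillator, so the components
of `ν_b` are products of Hermite functions (`hermC` in a complex coordinate, `hermR` in a real one).
At `v₀` only `e_1` occurs; hence all nonzero components share one factor at `v₀`, and `ν_b` is
`radial` times `sect` (`nu_eq`), where `sect` is a sum of pure tensors whose factors at `v₀` are
translates of `e_1`. The Kudla–Millson function raises the exponents of the positive coordinate by
`(1,1)`, respectively by `2`, so `φ_b` is the invariant area form times the same `sect` and a
`radial` with raised exponents (`phi_eq`). The operator `ω(L_{v₀})` acts on `radial` alone. It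
commutes with isometries and can therefore be evaluated in coordinates adapted to `τ`
(`weil_radial`): it multiplies by `1 - 2π |negative coordinate|²` and adds a term in which the
raised exponents are lowered again.

Tensor part. The translate of `e_1` has derivatives along the negative space, of type `(1,-1)` in
the direction `dτ̄` and `(-1,1)` in the direction `dτ`. This is recorded as a `MovingFrame`. The
signs in `D^c` are such that all terms of type `(±1,∓1)` cancel in `DD^c` (`MovingFrame.ddc_eq`);
there remain scalar multiples of the section and twice a mixed term, in which two factors are
replaced by negative vectors. In any adapted basis the tensor dual to the form is "positive ⊗
positive minus negative ⊗ negative", so a double replacement is the original tensor minus an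
insertion (`sectMixed_eq`). The insertions give the correction terms of the theorem. With `p`, `q`
the exponents at `v₀`, the multiples of `sect` match those produced by `L` because `2(p + q + 1) +
2pq = 2(p + 1)(q + 1)` in the unitary and `8p + 4 + 2p(p - 1) = 2(p + 1)(p + 2)` in the orthogonal
case.

Harmonic part. The torus that defines the Hodge structure preserves the form, so the harmonic
projection commutes with the Hodge projections (`hodgeProj_comp_harm`) and the same computation
applies after projection; insertions are killed. The symmetrizer has no effect, since `sect` is
invariant under permutations and these commute with the harmonic projection. -/

noncomputable section

namespace FunkeMillson

/-! ### Pure tensors -/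

/-- The spots of `T_b`. -/
abbrev Spot {U : Type*} (b : U → ℕ) : Type _ := Σ u, Fin (b u)

/-- The pure tensor with factor `c s` in the spot `s`, as a multilinear function of the factors. -/
def pureTensor (n : ℕ) {U : Type*} [Fintype U] (b : U → ℕ) :
    ContinuousMultilinearMap ℂ (fun _ : Spot b => Fin n → ℂ) (Tens n b) :=
  ContinuousMultilinearMap.pi fun m =>
    (ContinuousMultilinearMap.mkPiAlgebra ℂ (Spot b) ℂ).compContinuousLinearMap
      fun s => ContinuousLinearMap.proj (m s.1 s.2)

section Pure

variable {n : ℕ} {U : Type*} [Fintype U] {b : U → ℕ}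

theorem pureTensor_apply (c : Spot b → Fin n → ℂ) (m : Idx n b) :
    pureTensor n b c m = ∏ s, c s (m s.1 s.2) := by
  simp [pureTensor]

/-- Sums over multi-indices are sums over functions of the spots. -/
theorem sum_idx [DecidableEq U] {M : Type*} [AddCommMonoid M] (f : Idx n b → M) :
    ∑ m, f m = ∑ r : Spot b → Fin n, f fun u k => r ⟨u, k⟩ :=
  (Fintype.sum_equiv (Equiv.piCurry fun u (_ : Fin (b u)) => Fin n) _ _ fun _ => rfl).symm

variable [DecidableEq U]

theorem tensorMap_apply (M : ∀ u, Fin (b u) → Matrix (Fin n) (Fin n) ℂ) (t : Tens n b)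
    (m : Idx n b) :
    tensorMap b M t m = ∑ μ : Idx n b, (∏ s : Spot b, M s.1 s.2 (m s.1 s.2) (μ s.1 s.2)) * t μ := by
  simp only [tensorMap, Matrix.toLin'_apply, Matrix.mulVec, dotProduct, Matrix.of_apply,
    Fintype.prod_sigma]

theorem tensorMap_eq_sum (M : ∀ u, Fin (b u) → Matrix (Fin n) (Fin n) ℂ) (t : Tens n b) :
    tensorMap b M t
      = ∑ μ : Idx n b, t μ • pureTensor n b fun s i => M s.1 s.2 i (μ s.1 s.2) := by
  ext m
  simp only [tensorMap_apply, Finset.sum_apply, Pi.smul_apply, pureTensor_apply, smul_eq_mul,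
    mul_comm]

theorem eq_sum_pureTensor (t : Tens n b) :
    t = ∑ μ : Idx n b, t μ • pureTensor n b fun s => Pi.single (μ s.1 s.2) 1 := by
  ext m
  simp only [Finset.sum_apply, Pi.smul_apply, pureTensor_apply, smul_eq_mul]
  rw [Finset.sum_eq_single m]
  · simp
  · intro μ _ h
    obtain ⟨u, hu⟩ := Function.ne_iff.1 h
    obtain ⟨k, hk⟩ := Function.ne_iff.1 hu
    rw [Finset.prod_eq_zero (Finset.mem_univ (⟨u, k⟩ : Spot b)), mul_zero]
    exact Pi.single_eq_of_ne (Ne.symm hk) _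
  · simp

/-- The pure tensors of basis vectors already span. -/
theorem linearMap_ext_pure {V : Type*} [AddCommMonoid V] [Module ℂ V] {f g : Tens n b →ₗ[ℂ] V}
    (h : ∀ c, f (pureTensor n b c) = g (pureTensor n b c)) : f = g := by
  refine LinearMap.ext fun t => ?_
  rw [eq_sum_pureTensor t]
  simp [h]

theorem tensorMap_pureTensor (M : ∀ u, Fin (b u) → Matrix (Fin n) (Fin n) ℂ)
    (c : Spot b → Fin n → ℂ) :
    tensorMap b M (pureTensor n b c) = pureTensor n b fun s => (M s.1 s.2).mulVec (c s) := by
  ext m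
  simp only [tensorMap_apply, pureTensor_apply, Matrix.mulVec, dotProduct,
    Finset.prod_univ_sum, sum_idx, ← Finset.prod_mul_distrib, Fintype.piFinset_univ]

theorem tensorMap_comp (M N : ∀ u, Fin (b u) → Matrix (Fin n) (Fin n) ℂ) :
    tensorMap b M ∘ₗ tensorMap b N = tensorMap b fun u k => M u k * N u k :=
  linearMap_ext_pure fun c => by simp [tensorMap_pureTensor]

/-- The adjoint is taken for the bilinear pairing of components, not for the hermitian one; this is
the form of adjointness that `harmonicProj_comm` asks for. -/
theorem tensorMap_transpose (M : ∀ u, Fin (b u) → Matrix (Fin n) (Fin n) ℂ) (t s : Tens n b) :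
    ∑ m, tensorMap b M t m * s m
      = ∑ m, t m * tensorMap b (fun u k => (M u k).transpose) s m := by
  simp only [tensorMap_apply, Finset.sum_mul, Finset.mul_sum, Matrix.transpose_apply]
  rw [Finset.sum_comm]
  exact Finset.sum_congr rfl fun _ _ => Finset.sum_congr rfl fun _ _ => by ring

end Pure

/-! ### Removing two spots -/

/-- `ι` identifies `Y` with the complement of the two elements `a`, `a'` of `X`. -/
structure Removes {X Y : Type*} (ι : Y → X) (a a' : X) : Prop where
  injective : Function.Injective ι
  ne : a ≠ a'
  range : ∀ x, (∃ y, ι y = x) ↔ x ≠ a ∧ x ≠ a'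

theorem Removes.prod {X Y M : Type*} [Fintype X] [Fintype Y] [DecidableEq X] [CommMonoid M]
    {ι : Y → X} {a a' : X} (h : Removes ι a a') (f : X → M) :
    ∏ x, f x = f a * f a' * ∏ y, f (ι y) := by
  have h1 : (Finset.univ : Finset X) = insert a (insert a' (Finset.univ.image ι)) := by
    ext x
    have := h.range x
    simp only [Finset.mem_univ, Finset.mem_insert, Finset.mem_image, true_and, true_iff]
    tauto
  have ha' : a' ∉ Finset.univ.image ι := fun hm => by
    obtain ⟨y, -, hy⟩ := Finset.mem_image.1 hm
    exact ((h.range a').1 ⟨y, hy⟩).2 rfl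
  have ha : a ∉ insert a' (Finset.univ.image ι) := fun hm => by
    rcases Finset.mem_insert.1 hm with e | hm
    · exact h.ne e
    · obtain ⟨y, -, hy⟩ := Finset.mem_image.1 hm
      exact ((h.range a).1 ⟨y, hy⟩).1 rfl
  rw [h1, Finset.prod_insert ha, Finset.prod_insert ha', Finset.prod_image h.injective.injOn,
    mul_assoc]

theorem Removes.sum {X Y M : Type*} [Fintype X] [Fintype Y] [DecidableEq X] [AddCommMonoid M]
    {ι : Y → X} {a a' : X} (h : Removes ι a a') (f : X → M) :
    ∑ x, f x = f a + f a' + ∑ y, f (ι y) :=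
  h.prod (M := Multiplicative M) f

section Expand

variable {n : ℕ} {U : Type*} {b b' : U → ℕ}

/-- Restriction of a multi-index along a map between the spots. -/
def restrictIdx (ι : Spot b' → Spot b) (m : Idx n b) : Idx n b' :=
  fun w k => m (ι ⟨w, k⟩).1 (ι ⟨w, k⟩).2

/-- The components of a two-tensor in the spots `a`, `a'`. -/
def twoSpots (q : Fin n → Fin n → ℝ) (a a' : Spot b) (m : Idx n b) : ℝ :=
  q (m a.1 a.2) (m a'.1 a'.2)

/-- Any decomposition of the two-tensor into rank one terms may be used, in particular one in a
basis adapted to a point of the disc. The factors of `c` in the spots `a`, `a'` are overwritten and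
do not matter, so a pure tensor on the remaining spots can be given by data on all spots. -/
theorem expand_pureTensor [Fintype U] [DecidableEq U] {ι : Spot b' → Spot b} {a a' : Spot b}
    (h : Removes ι a a') {q : Fin n → Fin n → ℝ} {L : Type*} [Fintype L] {σ : L → ℂ}
    {A B : L → Fin n → ℂ} (hq : ∀ i j, (q i j : ℂ) = ∑ l, σ l * A l i * B l j)
    (c : Spot b → Fin n → ℂ) :
    expand (restrictIdx ι) (twoSpots q a a') (pureTensor n b' fun s => c (ι s))
      = ∑ l, σ l • pureTensor n b (Function.update (Function.update c a (A l)) a' (B l)) := by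
  ext m
  simp only [expand, LinearMap.coe_mk, AddHom.coe_mk, twoSpots, hq, Finset.sum_apply,
    Pi.smul_apply, smul_eq_mul, Finset.sum_mul, pureTensor_apply]
  refine Finset.sum_congr rfl fun l _ => ?_
  rw [h.prod]
  have h1 : ∀ y, Function.update (Function.update c a (A l)) a' (B l) (ι y) = c (ι y) := by
    intro y
    have := (h.range (ι y)).1 ⟨y, rfl⟩
    rw [Function.update_of_ne this.2, Function.update_of_ne this.1]
  simp only [h1, Function.update_self, Function.update_of_ne h.ne, restrictIdx]
  ring

/-- Hypothesis `hM` says that the two matrices fix the inserted two-tensor. Decomposing it in the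
standard basis and in the transformed basis yields the two sides. -/
theorem tensorMap_expand [Fintype U] [DecidableEq U] {ι : Spot b' → Spot b} {a a' : Spot b}
    (h : Removes ι a a') {q : Fin n → Fin n → ℝ} (M : U → Matrix (Fin n) (Fin n) ℂ)
    (hι : ∀ s, (ι s).1 = s.1)
    (hM : M a.1 * (Matrix.of q).map Complex.ofReal * (M a'.1).transpose
      = (Matrix.of q).map Complex.ofReal) :
    tensorMap b (fun u _ => M u) ∘ₗ expand (restrictIdx ι) (twoSpots q a a')
      = expand (restrictIdx ι) (twoSpots q a a') ∘ₗ tensorMap b' fun u _ => M u := by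
  refine linearMap_ext_pure fun c' => ?_
  -- Every pure tensor on the remaining spots comes from a family on all spots; the value `0` at `a`
  -- and `a'` is arbitrary.
  obtain ⟨c, rfl⟩ : ∃ c : Spot b → Fin n → ℂ, (fun s => c (ι s)) = c' :=
    ⟨Function.extend ι c' 0, by ext1 s; simp [h.injective.extend_apply]⟩
  have h1 : ∀ i j, (q i j : ℂ) = ∑ l : Fin n × Fin n, (q l.1 l.2 : ℂ)
      * (Pi.single l.1 1 : Fin n → ℂ) i * (Pi.single l.2 1 : Fin n → ℂ) j := by
    intro i j
    rw [Fintype.sum_prod_type, Finset.sum_eq_single i, Finset.sum_eq_single j]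
    · simp
    · intro j' _ hj; simp [hj.symm]
    · simp
    · intro i' _ hi; simp [hi.symm]
    · simp
  have h2 : ∀ i j, (q i j : ℂ) = ∑ l : Fin n × Fin n, (q l.1 l.2 : ℂ)
      * ((M a.1).mulVec (Pi.single l.1 1)) i * ((M a'.1).mulVec (Pi.single l.2 1)) j := by
    intro i j
    have := congrFun (congrFun hM i) j
    simp only [Matrix.mul_apply, Matrix.map_apply, Matrix.of_apply, Matrix.transpose_apply,
      Finset.sum_mul] at this
    rw [← this, Fintype.sum_prod_type, Finset.sum_comm]
    refine Finset.sum_congr rfl fun _ _ => Finset.sum_congr rfl fun _ _ => ?_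
    simp only [Matrix.mulVec_single_one, Matrix.col_apply]
    ring
  simp only [LinearMap.comp_apply, tensorMap_pureTensor]
  rw [expand_pureTensor h h1, map_sum]
  have h3 := expand_pureTensor h h2 fun s => (M s.1).mulVec (c s)
  simp only [hι] at h3
  rw [h3]
  refine Finset.sum_congr rfl fun l _ => ?_
  rw [map_smul, tensorMap_pureTensor]
  congr 2
  ext1 s
  by_cases hs : s = a'
  · subst hs; simp
  · rw [Function.update_of_ne hs, Function.update_of_ne hs]
    by_cases hs' : s = a
    · subst hs'; simp
    · rw [Function.update_of_ne hs', Function.update_of_ne hs']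

/-- A tensor of the form `g · G`, where `G` does not depend on the two removed spots, lies in the
image of an expansion operator. -/
theorem mem_range_expand {ι : Spot b' → Spot b} {a a' : Spot b} (h : Removes ι a a')
    (g : Idx n b → ℝ) (G : Idx n b → ℂ)
    (hG : ∀ m m' : Idx n b, (∀ s : Spot b, s ≠ a → s ≠ a' → m s.1 s.2 = m' s.1 s.2) → G m = G m') :
    (fun m => (g m : ℂ) * G m) ∈ LinearMap.range (expand (restrictIdx ι) g) := by
  have hf : Function.FactorsThrough G (restrictIdx (n := n) ι) := by
    intro m m' hm
    refine hG m m' fun s h1 h2 => ?_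
    obtain ⟨y, rfl⟩ := (h.range s).2 ⟨h1, h2⟩
    exact congrFun (congrFun hm y.1) y.2
  refine ⟨Function.extend (restrictIdx ι) G 0, ?_⟩
  ext m
  simp [expand, hf.extend_apply]

end Expand

/-! ### The harmonic projection -/

section Harmonic

variable {X J : Type*} [Fintype X] {Y : J → Type*} [∀ i, DecidableEq (Y i)]
  [∀ i, Fintype (Y i)] {drop : ∀ i, X → Y i} {g : J → X → ℝ}

/-- The components `g` are real, so the hermitian adjunction `contract_adjoint`, applied to `star
s`, turns into one for the bilinear pairing. -/
theorem mem_harmonicSpace_iff (t : X → ℂ) :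
    t ∈ harmonicSpace drop g ↔ ∀ e ∈ expansionSpace drop g, ∑ m, t m * e m = 0 := by
  have key : ∀ i (s : Y i → ℂ), ∑ m, t m * expand (drop i) (g i) s m
      = ∑ m', contract (drop i) (g i) t m' * s m' := by
    intro i s
    have h := contract_adjoint (drop i) (g i) t (star s)
    simpa [expand] using h
  simp only [harmonicSpace, Submodule.mem_iInf, LinearMap.mem_ker]
  constructor
  · intro h e he
    refine Submodule.iSup_induction _ (motive := fun e => ∑ m, t m * e m = 0) he ?_ ?_ ?_
    · rintro i _ ⟨s, rfl⟩
      rw [key, h i]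
      simp
    · simp
    · intro x y hx hy
      simp only [Pi.add_apply, mul_add, Finset.sum_add_distrib, hx, hy, add_zero]
  · intro h i
    ext y
    have := key i (Pi.single y 1)
    rw [h _ (Submodule.mem_iSup_of_mem i (LinearMap.mem_range_self _ _))] at this
    simpa [Pi.single_apply] using this.symm

theorem harmonicProj_eq_zero {t : X → ℂ} (h : t ∈ expansionSpace drop g) :
    harmonicProj drop g t = 0 :=
  Submodule.projection_apply_of_mem_right _ h

theorem harmonicProj_expand (i : J) (t : Y i → ℂ) :
    harmonicProj drop g (expand (drop i) (g i) t) = 0 :=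
  harmonicProj_eq_zero (Submodule.mem_iSup_of_mem i (LinearMap.mem_range_self _ _))

/-- Stability of the expansion space under `T'` makes `T` preserve its orthogonal complement, the
harmonic space; with stability under `T` itself, `T` respects the direct sum. -/
theorem harmonicProj_comm {T T' : (X → ℂ) →ₗ[ℂ] (X → ℂ)}
    (hT : ∀ t s : X → ℂ, ∑ m, T t m * s m = ∑ m, t m * T' s m)
    (h : ∀ i s, T (expand (drop i) (g i) s) ∈ expansionSpace drop g)
    (h' : ∀ i s, T' (expand (drop i) (g i) s) ∈ expansionSpace drop g) :
    harmonicProj drop g ∘ₗ T = T ∘ₗ harmonicProj drop g := by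
  have hstable : ∀ {T : (X → ℂ) →ₗ[ℂ] (X → ℂ)},
      (∀ i s, T (expand (drop i) (g i) s) ∈ expansionSpace drop g) →
      ∀ e ∈ expansionSpace drop g, T e ∈ expansionSpace drop g := by
    intro T h e he
    refine Submodule.iSup_induction _ (motive := fun e => T e ∈ expansionSpace drop g) he ?_ ?_ ?_
    · rintro i _ ⟨s, rfl⟩
      exact h i s
    · simp
    · intro x y hx hy
      rw [map_add]
      exact add_mem hx hy
  refine LinearMap.ext fun t => ?_
  have hc := isCompl_harmonic drop g
  have hd := Submodule.projection_add_projection_eq_self hc t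
  set x := (harmonicSpace drop g).projection _ hc t with hx
  set y := (expansionSpace drop g).projection _ hc.symm t
  have hxm : x ∈ harmonicSpace drop g := Submodule.projection_apply_mem _ _
  have hym : y ∈ expansionSpace drop g := Submodule.projection_apply_mem _ _
  have h1 : T x ∈ harmonicSpace drop g := by
    rw [mem_harmonicSpace_iff] at hxm ⊢
    intro e he
    rw [hT]
    exact hxm _ (hstable h' e he)
  have h2 : T y ∈ expansionSpace drop g := hstable h y hym
  show (harmonicSpace drop g).projection _ hc (T t) = T x
  rw [← hd, map_add, map_add, Submodule.projection_apply_of_mem_left _ h1,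
    Submodule.projection_apply_of_mem_right _ h2, add_zero]

end Harmonic

/-! ### Permutations of the spots -/

section Permutations

variable {n : ℕ} {U : Type*} {b : U → ℕ}

/-- The action of a permutation of the spots of each label. -/
def permute (n : ℕ) {b : U → ℕ} (σ : ∀ u, Equiv.Perm (Fin (b u))) : Tens n b →ₗ[ℂ] Tens n b :=
  LinearMap.funLeft ℂ ℂ fun (m : Idx n b) u k => m u (σ u k)

theorem permute_apply (σ : ∀ u, Equiv.Perm (Fin (b u))) (t : Tens n b) (m : Idx n b) :
    permute n σ t m = t fun u k => m u (σ u k) := rfl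

variable [Fintype U] [DecidableEq U]

theorem permute_transpose (σ : ∀ u, Equiv.Perm (Fin (b u))) (t s : Tens n b) :
    ∑ m, permute n σ t m * s m = ∑ m, t m * permute n (fun u => (σ u).symm) s m := by
  refine Fintype.sum_equiv (Equiv.piCongrRight fun u => (σ u).symm.arrowCongr (Equiv.refl (Fin n)))
    _ _ fun m => ?_
  simp only [permute_apply]
  congr 1
  congr 1
  ext1 u
  ext1 k
  simp

theorem symmetrizer_eq_self {t : Tens n b} (h : ∀ σ, permute n σ t = t) :
    symmetrizer n b t = t := by
  have h1 : symmetrizer n b t = (∏ u, (Nat.factorial (b u) : ℂ))⁻¹ •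
      ∑ σ : ∀ u, Equiv.Perm (Fin (b u)), permute n σ t := by
    simp [symmetrizer, permute]
  have h2 : (∏ u, (Nat.factorial (b u) : ℂ)) ≠ 0 :=
    Finset.prod_ne_zero_iff.2 fun u _ => Nat.cast_ne_zero.2 (Nat.factorial_ne_zero _)
  rw [h1, Finset.sum_congr rfl fun σ _ => h σ, Finset.sum_const, Finset.card_univ,
    Fintype.card_pi]
  simp only [Fintype.card_perm, Fintype.card_fin]
  rw [← Nat.cast_smul_eq_nsmul ℂ, smul_smul, Nat.cast_prod, inv_mul_cancel₀ h2, one_smul]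

theorem permute_tensorMap {M : U → Matrix (Fin n) (Fin n) ℂ} (σ : ∀ u, Equiv.Perm (Fin (b u)))
    (t : Tens n b) :
    permute n σ (tensorMap b (fun u _ => M u) t) = tensorMap b (fun u _ => M u) (permute n σ t) := by
  ext m
  simp only [permute_apply, tensorMap_apply]
  refine Fintype.sum_equiv (Equiv.piCongrRight fun u => (σ u).arrowCongr (Equiv.refl (Fin n)))
    _ _ fun μ => ?_
  congr 1
  · simp only [Fintype.prod_sigma]
    refine Finset.prod_congr rfl fun u _ => ?_
    refine Fintype.prod_equiv (σ u) _ _ fun k => ?_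
    simp
  · congr 1
    ext1 u
    ext1 k
    simp

end Permutations

end FunkeMillson
end

noncomputable section

namespace FunkeMillson

/-! ### Hodge types -/

section Hodge

variable {n : ℕ} {U : Type*} [Fintype U] [DecidableEq U] {b : U → ℕ}
  {F : U → ℂ → Matrix (Fin n) (Fin n) ℂ} {wt : U → Fin n → ℤ} {τ : ℂ}

theorem tensorMap_smul (a : Spot b → ℂ) (M : ∀ u, Fin (b u) → Matrix (Fin n) (Fin n) ℂ) :
    tensorMap b (fun u k => a ⟨u, k⟩ • M u k) = (∏ s, a s) • tensorMap b M := by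
  refine linearMap_ext_pure fun c => ?_
  simp only [tensorMap_pureTensor, LinearMap.smul_apply, Matrix.smul_mulVec]
  exact (pureTensor n b).map_smul_univ a _

/-- The projector onto the line spanned by the member `ε` of the basis given by the frame. -/
def frameProj (b : U → ℕ) (F : U → ℂ → Matrix (Fin n) (Fin n) ℂ) (τ : ℂ) (ε : Idx n b) :
    Tens n b →ₗ[ℂ] Tens n b :=
  tensorMap b fun u k => F u τ * Matrix.single (ε u k) (ε u k) 1 * (F u τ)⁻¹

theorem frameProj_pureTensor (ε : Idx n b) (c : Spot b → Fin n → ℂ) :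
    frameProj b F τ ε (pureTensor n b c) = pureTensor n b fun s =>
      ((F s.1 τ)⁻¹.mulVec (c s) (ε s.1 s.2)) • (F s.1 τ).mulVec (Pi.single (ε s.1 s.2) 1) := by
  rw [frameProj, tensorMap_pureTensor]
  congr 1
  ext1 s
  rw [Matrix.mul_assoc, ← Matrix.mulVec_mulVec, ← Matrix.mulVec_mulVec, ← Matrix.mulVec_smul]
  congr 1
  ext j
  rw [Matrix.single_mulVec]
  simp [Pi.single_apply, Function.update_apply]

/-- Each factor is expanded in the basis given by the frame, and the product is multiplied out. -/
theorem sum_frameProj (hF : ∀ u, F u τ * (F u τ)⁻¹ = 1) :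
    ∑ ε, frameProj b F τ ε = LinearMap.id := by
  refine linearMap_ext_pure fun c => ?_
  rw [LinearMap.sum_apply, sum_idx]
  simp only [frameProj_pureTensor]
  have h := (pureTensor n b).toMultilinearMap.map_sum
    (g := fun (s : Spot b) (j : Fin n) =>
      ((F s.1 τ)⁻¹.mulVec (c s) j) • (F s.1 τ).mulVec (Pi.single j 1))
  refine (h.symm.trans ?_)
  show pureTensor n b _ = pureTensor n b c
  congr 1
  ext1 s
  simp only [← Matrix.mulVec_smul, ← Matrix.mulVec_sum]
  have h1 : ∑ i, (F s.1 τ)⁻¹.mulVec (c s) i • (Pi.single i (1 : ℂ) : Fin n → ℂ)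
      = (F s.1 τ)⁻¹.mulVec (c s) := by
    ext j
    simp [Pi.single_apply]
  rw [h1, Matrix.mulVec_mulVec, hF, Matrix.one_mulVec]

theorem hodgeProj_eq_sum (p : ℤ) : hodgeProj b F wt p τ
    = ∑ ε : Idx n b, if ∑ u, ∑ k, wt u (ε u k) = p then frameProj b F τ ε else 0 := rfl

/-- The real number `2`, as an element of the torus that defines the Hodge structure. -/
def hodgeTorus (F : U → ℂ → Matrix (Fin n) (Fin n) ℂ) (wt : U → Fin n → ℤ) (τ : ℂ) (u : U) :
    Matrix (Fin n) (Fin n) ℂ :=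
  F u τ * Matrix.diagonal (fun j => (2 : ℂ) ^ wt u j) * (F u τ)⁻¹

theorem prod_two_zpow {X : Type*} (s : Finset X) (f : X → ℤ) :
    ∏ x ∈ s, (2 : ℂ) ^ f x = 2 ^ ∑ x ∈ s, f x := by
  classical
  induction s using Finset.induction_on with
  | empty => simp
  | insert a s ha ih => rw [Finset.prod_insert ha, Finset.sum_insert ha, ih, zpow_add₀ two_ne_zero]

/-- On a frame line of type `(p, -p)` the torus element acts by `2 ^ p`, so different Hodge types
are separated by its eigenvalues. -/
theorem hodgeTorus_comp_frameProj (hF : ∀ u, F u τ * (F u τ)⁻¹ = 1) (ε : Idx n b) :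
    tensorMap b (fun u _ => hodgeTorus F wt τ u) ∘ₗ frameProj b F τ ε
      = (2 : ℂ) ^ (∑ u, ∑ k, wt u (ε u k)) • frameProj b F τ ε := by
  rw [frameProj, tensorMap_comp, ← Fintype.sum_sigma', ← prod_two_zpow, ← tensorMap_smul]
  congr 1
  ext1 u
  ext1 k
  have h : (F u τ)⁻¹ * F u τ = 1 := mul_eq_one_comm.1 (hF u)
  have h1 : Matrix.diagonal (fun j => (2 : ℂ) ^ wt u j) * Matrix.single (ε u k) (ε u k) 1
      = (2 : ℂ) ^ wt u (ε u k) • Matrix.single (ε u k) (ε u k) 1 := by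
    ext i j
    rw [Matrix.diagonal_mul, Matrix.smul_apply, Matrix.single_apply]
    split_ifs with hij
    · rw [hij.1]; simp
    · simp
  calc _ = F u τ * (Matrix.diagonal (fun j => (2 : ℂ) ^ wt u j) * (((F u τ)⁻¹ * F u τ)
            * Matrix.single (ε u k) (ε u k) 1)) * (F u τ)⁻¹ := by
        simp only [hodgeTorus, Matrix.mul_assoc]
    _ = _ := by
        rw [h, Matrix.one_mul, h1, Matrix.mul_smul, Matrix.smul_mul]

theorem frameProj_comp_hodgeTorus (hF : ∀ u, F u τ * (F u τ)⁻¹ = 1) (ε : Idx n b) :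
    frameProj b F τ ε ∘ₗ tensorMap b (fun u _ => hodgeTorus F wt τ u)
      = (2 : ℂ) ^ (∑ u, ∑ k, wt u (ε u k)) • frameProj b F τ ε := by
  rw [frameProj, tensorMap_comp, ← Fintype.sum_sigma', ← prod_two_zpow, ← tensorMap_smul]
  congr 1
  ext1 u
  ext1 k
  have h : (F u τ)⁻¹ * F u τ = 1 := mul_eq_one_comm.1 (hF u)
  have h1 : Matrix.single (ε u k) (ε u k) 1 * Matrix.diagonal (fun j => (2 : ℂ) ^ wt u j)
      = (2 : ℂ) ^ wt u (ε u k) • Matrix.single (ε u k) (ε u k) 1 := by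
    ext i j
    rw [Matrix.mul_diagonal, Matrix.smul_apply, Matrix.single_apply]
    split_ifs with hij
    · rw [hij.2]; simp
    · simp
  calc _ = F u τ * ((Matrix.single (ε u k) (ε u k) 1 * ((F u τ)⁻¹ * F u τ))
            * Matrix.diagonal (fun j => (2 : ℂ) ^ wt u j)) * (F u τ)⁻¹ := by
        simp only [hodgeTorus, Matrix.mul_assoc]
    _ = _ := by
        rw [h, Matrix.mul_one, h1, Matrix.mul_smul, Matrix.smul_mul]

/-- What commutes with the torus preserves the Hodge decomposition. -/
theorem hodgeProj_comm (hF : ∀ u, F u τ * (F u τ)⁻¹ = 1) {T : Tens n b →ₗ[ℂ] Tens n b}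
    (hT : T ∘ₗ tensorMap b (fun u _ => hodgeTorus F wt τ u)
      = tensorMap b (fun u _ => hodgeTorus F wt τ u) ∘ₗ T) (p : ℤ) :
    hodgeProj b F wt p τ ∘ₗ T = T ∘ₗ hodgeProj b F wt p τ := by
  -- The block of `T` between two frame lines is scaled by `2 ^ p` from one side and by `2 ^ p'`
  -- from the other, so it vanishes when the types differ.
  have key : ∀ ε ε' : Idx n b, ∑ u, ∑ k, wt u (ε u k) ≠ ∑ u, ∑ k, wt u (ε' u k) → ∀ t,
      frameProj b F τ ε (T (frameProj b F τ ε' t)) = 0 := by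
    intro ε ε' h t
    have e1 := LinearMap.congr_fun (frameProj_comp_hodgeTorus (wt := wt) hF ε)
      (T (frameProj b F τ ε' t))
    have e2 := LinearMap.congr_fun hT (frameProj b F τ ε' t)
    have e3 := LinearMap.congr_fun (hodgeTorus_comp_frameProj (wt := wt) hF ε') t
    simp only [LinearMap.comp_apply, LinearMap.smul_apply] at e1 e2 e3
    rw [← e2, e3, map_smul, map_smul] at e1
    have h2 : (2 : ℂ) ^ (∑ u, ∑ k, wt u (ε' u k)) - (2 : ℂ) ^ (∑ u, ∑ k, wt u (ε u k)) ≠ 0 := by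
      intro e
      -- The powers are compared over `ℝ`, where `p ↦ 2 ^ p` is strictly monotone.
      have e' : (2 : ℝ) ^ (∑ u, ∑ k, wt u (ε u k)) = (2 : ℝ) ^ (∑ u, ∑ k, wt u (ε' u k)) :=
        Complex.ofReal_injective (by push_cast; exact (sub_eq_zero.1 e).symm)
      exact h (zpow_right_injective₀ two_pos (by norm_num) e')
    have h3 := sub_eq_zero.2 e1
    rw [← sub_smul] at h3
    exact (smul_eq_zero.1 h3).resolve_left h2
  have hid : ∀ t, ∑ ε : Idx n b, frameProj b F τ ε t = t := fun t => by
    rw [← LinearMap.sum_apply, sum_frameProj hF, LinearMap.id_apply]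
  refine LinearMap.ext fun t => ?_
  rw [LinearMap.comp_apply, LinearMap.comp_apply, ← hid (T (hodgeProj b F wt p τ t))]
  conv_lhs => rw [← hid t]
  simp only [hodgeProj_eq_sum, LinearMap.sum_apply, map_sum]
  rw [Finset.sum_comm]
  refine Finset.sum_congr rfl fun ε _ => Finset.sum_congr rfl fun ε' _ => ?_
  by_cases h : ∑ u, ∑ k, wt u (ε u k) = ∑ u, ∑ k, wt u (ε' u k)
  · rw [h]
    split_ifs <;> simp
  · have := key ε ε' h t
    split_ifs <;> simp [this]

/-- `t` is of Hodge type `(p, -p)` at `τ`. -/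
def HasType (b : U → ℕ) (F : U → ℂ → Matrix (Fin n) (Fin n) ℂ) (wt : U → Fin n → ℤ) (τ : ℂ)
    (p : ℤ) (t : Tens n b) : Prop :=
  ∀ q, hodgeProj b F wt q τ t = if p = q then t else 0

theorem HasType.zero {p : ℤ} : HasType b F wt τ p 0 := fun q => by simp

theorem HasType.smul {p : ℤ} {t : Tens n b} (h : HasType b F wt τ p t) (a : ℂ) :
    HasType b F wt τ p (a • t) := fun q => by
  rw [map_smul, h q]; split_ifs <;> simp

theorem HasType.sum {p : ℤ} {J : Type*} (s : Finset J) {t : J → Tens n b}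
    (h : ∀ i ∈ s, HasType b F wt τ p (t i)) : HasType b F wt τ p (∑ i ∈ s, t i) := fun q => by
  rw [map_sum, Finset.sum_congr rfl fun i hi => h i hi q]
  split_ifs <;> simp

theorem HasType.map {p : ℤ} {t : Tens n b} (h : HasType b F wt τ p t)
    {T : Tens n b →ₗ[ℂ] Tens n b}
    (hT : ∀ q, hodgeProj b F wt q τ ∘ₗ T = T ∘ₗ hodgeProj b F wt q τ) :
    HasType b F wt τ p (T t) := fun q => by
  rw [← LinearMap.comp_apply, hT, LinearMap.comp_apply, h q]
  split_ifs <;> simp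

/-- `v` is a vector of type `(w, -w)` in the space of label `u`. -/
def VecType (F : U → ℂ → Matrix (Fin n) (Fin n) ℂ) (wt : U → Fin n → ℤ) (τ : ℂ) (u : U) (w : ℤ)
    (v : Fin n → ℂ) : Prop :=
  ∀ j, wt u j ≠ w → (F u τ)⁻¹.mulVec v j = 0

omit [Fintype U] [DecidableEq U] in
theorem VecType.zero {u : U} {w : ℤ} : VecType F wt τ u w 0 := fun j _ => by simp

omit [Fintype U] [DecidableEq U] in
theorem VecType.smul {u : U} {w : ℤ} {v : Fin n → ℂ} (h : VecType F wt τ u w v) (a : ℂ) :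
    VecType F wt τ u w (a • v) := fun j hj => by simp [Matrix.mulVec_smul, h j hj]

omit [Fintype U] [DecidableEq U] in
theorem VecType.of_mulVec {u : U} {w : ℤ} {v : Fin n → ℂ} (hF : F u τ * (F u τ)⁻¹ = 1)
    (x : Fin n → ℂ) (hv : (F u τ).mulVec x = v) (hx : ∀ j, wt u j ≠ w → x j = 0) :
    VecType F wt τ u w v := fun j hj => by
  rw [← hv, Matrix.mulVec_mulVec, mul_eq_one_comm.1 hF, Matrix.one_mulVec, hx j hj]

/-- Types add under tensor products. The type may vary with the spot, as is needed once a factor has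
been replaced by a vector of type `(±1,∓1)`. -/
theorem HasType.pureTensor (hF : ∀ u, F u τ * (F u τ)⁻¹ = 1) {c : Spot b → Fin n → ℂ}
    {w : Spot b → ℤ} (hc : ∀ s, VecType F wt τ s.1 (w s) (c s)) {p : ℤ} (hp : ∑ s, w s = p) :
    HasType b F wt τ p (pureTensor n b c) := by
  intro q
  -- A frame line of another total type has the wrong type in at least one spot, where the
  -- coordinate of the factor vanishes.
  have h1 : ∀ ε : Idx n b, ∑ u, ∑ k, wt u (ε u k) ≠ p →
      frameProj b F τ ε (FunkeMillson.pureTensor n b c) = 0 := by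
    intro ε h
    rw [frameProj_pureTensor]
    rw [← Fintype.sum_sigma', ← hp] at h
    obtain ⟨s, hs⟩ : ∃ s : Spot b, wt s.1 (ε s.1 s.2) ≠ w s := by
      by_contra! h'
      exact h (Finset.sum_congr rfl fun s _ => h' s)
    refine (FunkeMillson.pureTensor n b).map_coord_zero s ?_
    rw [hc s _ hs, zero_smul]
  have h2 : hodgeProj b F wt q τ (FunkeMillson.pureTensor n b c)
      = ∑ ε, if p = q then frameProj b F τ ε (FunkeMillson.pureTensor n b c) else 0 := by
    rw [hodgeProj_eq_sum, LinearMap.sum_apply]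
    refine Finset.sum_congr rfl fun ε _ => ?_
    by_cases h : ∑ u, ∑ k, wt u (ε u k) = p
    · rw [h]; split_ifs <;> rfl
    · have := h1 ε h
      split_ifs <;> simp [this]
  rw [h2]
  split_ifs
  · rw [← LinearMap.sum_apply, sum_frameProj hF, LinearMap.id_apply]
  · simp

end Hodge

end FunkeMillson
end

noncomputable section

namespace FunkeMillson

/-! ### Wirtinger calculus -/

section Wirtinger

open scoped ComplexConjugate

variable {T : Type*} [NormedAddCommGroup T] [NormedSpace ℝ T] [NormedSpace ℂ T]
  [IsScalarTower ℝ ℂ T]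

/-- The one-form `a dτ + a' dτ̄`. -/
def wirt (a a' : T) : ℂ →L[ℝ] T :=
  (ContinuousLinearMap.id ℝ ℂ).smulRight a + (Complex.conjCLE : ℂ →L[ℝ] ℂ).smulRight a'

theorem wirt_apply (a a' : T) (h : ℂ) : wirt a a' h = h • a + conj h • a' := by
  simp [wirt]

/-- `f` is differentiable at `τ` with Wirtinger derivatives `a`, `a'`. -/
def HasWirt (f : ℂ → T) (a a' : T) (τ : ℂ) : Prop := HasFDerivAt f (wirt a a') τ

variable {f g : ℂ → T} {a a' d d' : T} {τ : ℂ}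

theorem HasWirt.congr (h : HasWirt f a a' τ) (h1 : a = d) (h2 : a' = d') : HasWirt f d d' τ :=
  h1 ▸ h2 ▸ h

theorem hasWirt_of_hasFDerivAt {L : ℂ →L[ℝ] T} (h : HasFDerivAt f L τ)
    (hL : ∀ v, L v = v • a + conj v • a') : HasWirt f a a' τ := by
  have : L = wirt a a' := by ext1 v; rw [hL, wirt_apply]
  rwa [HasWirt, ← this]

theorem hasWirt_const (t : T) : HasWirt (fun _ => t) 0 0 τ :=
  hasWirt_of_hasFDerivAt (hasFDerivAt_const t τ) fun v => by simp

theorem hasWirt_id : HasWirt (fun σ => σ) 1 0 τ :=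
  hasWirt_of_hasFDerivAt (hasFDerivAt_id τ) fun v => by simp

theorem hasWirt_conj : HasWirt (fun σ => conj σ) 0 1 τ :=
  hasWirt_of_hasFDerivAt (Complex.conjCLE : ℂ →L[ℝ] ℂ).hasFDerivAt fun v => by simp

theorem HasWirt.add (hf : HasWirt f a a' τ) (hg : HasWirt g d d' τ) :
    HasWirt (fun σ => f σ + g σ) (a + d) (a' + d') τ :=
  hasWirt_of_hasFDerivAt (HasFDerivAt.add hf hg) fun v => by simp [wirt_apply]; abel

theorem HasWirt.sub (hf : HasWirt f a a' τ) (hg : HasWirt g d d' τ) :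
    HasWirt (fun σ => f σ - g σ) (a - d) (a' - d') τ :=
  hasWirt_of_hasFDerivAt (HasFDerivAt.sub hf hg) fun v => by simp [wirt_apply, smul_sub]; abel

theorem HasWirt.sum {J : Type*} (s : Finset J) {f : J → ℂ → T} {a a' : J → T}
    (h : ∀ i ∈ s, HasWirt (f i) (a i) (a' i) τ) :
    HasWirt (fun σ => ∑ i ∈ s, f i σ) (∑ i ∈ s, a i) (∑ i ∈ s, a' i) τ :=
  hasWirt_of_hasFDerivAt (HasFDerivAt.fun_sum h) fun v => by
    simp [wirt_apply, Finset.sum_add_distrib, Finset.smul_sum]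

theorem HasWirt.smul {f : ℂ → ℂ} {a a' : ℂ} (hf : HasWirt f a a' τ) (hg : HasWirt g d d' τ) :
    HasWirt (fun σ => f σ • g σ) (f τ • d + a • g τ) (f τ • d' + a' • g τ) τ :=
  hasWirt_of_hasFDerivAt (HasFDerivAt.smul hf hg) fun v => by
    simp only [add_apply, smul_apply,
      ContinuousLinearMap.smulRight_apply, wirt_apply, smul_eq_mul]
    module

theorem HasWirt.mul {f g : ℂ → ℂ} {a a' d d' : ℂ} (hf : HasWirt f a a' τ)
    (hg : HasWirt g d d' τ) :
    HasWirt (fun σ => f σ * g σ) (f τ * d + a * g τ) (f τ * d' + a' * g τ) τ :=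
  hf.smul hg

theorem HasWirt.const_smul (c : ℂ) (hf : HasWirt f a a' τ) :
    HasWirt (fun σ => c • f σ) (c • a) (c • a') τ :=
  ((hasWirt_const c).smul hf).congr (by simp) (by simp)

theorem HasWirt.const_mul {f : ℂ → ℂ} {a a' : ℂ} (c : ℂ) (hf : HasWirt f a a' τ) :
    HasWirt (fun σ => c * f σ) (c * a) (c * a') τ :=
  hf.const_smul c

theorem HasWirt.star {f : ℂ → ℂ} {a a' : ℂ} (hf : HasWirt f a a' τ) :
    HasWirt (fun σ => conj (f σ)) (conj a') (conj a) τ :=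
  hasWirt_of_hasFDerivAt ((Complex.conjCLE : ℂ →L[ℝ] ℂ).hasFDerivAt.comp τ hf) fun v => by
    simp [wirt_apply]; ring

theorem HasWirt.comp {g : ℂ → T} {f : ℂ → ℂ} {a a' : ℂ} (hg : HasWirt g d d' (f τ))
    (hf : HasWirt f a a' τ) :
    HasWirt (fun σ => g (f σ)) (a • d + conj a' • d') (a' • d + conj a • d') τ :=
  hasWirt_of_hasFDerivAt (HasFDerivAt.comp τ hg hf) fun v => by
    simp only [ContinuousLinearMap.comp_apply, wirt_apply, smul_eq_mul, map_add, map_mul,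
      Complex.conj_conj]
    module

theorem hasWirt_of_hasDerivAt {f : ℂ → ℂ} {a : ℂ} (hf : HasDerivAt f a τ) : HasWirt f a 0 τ :=
  hasWirt_of_hasFDerivAt (hf.hasFDerivAt.restrictScalars ℝ) fun v => by simp

theorem hasWirt_pi {ι : Type*} [Fintype ι] {f : ℂ → ι → ℂ} {a a' : ι → ℂ}
    (h : ∀ i, HasWirt (fun σ => f σ i) (a i) (a' i) τ) : HasWirt f a a' τ :=
  hasWirt_of_hasFDerivAt (hasFDerivAt_pi.2 h) fun v => by ext i; simp [wirt_apply]

theorem HasWirt.map {X Y : Type*} [Fintype X] [Fintype Y] {f : ℂ → X → ℂ} {a a' : X → ℂ}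
    (hf : HasWirt f a a' τ) (L : (X → ℂ) →ₗ[ℂ] (Y → ℂ)) :
    HasWirt (fun σ => L (f σ)) (L a) (L a') τ :=
  hasWirt_of_hasFDerivAt ((realCLM L).hasFDerivAt.comp τ hf) fun v => by
    show L (wirt a a' v) = _
    simp [wirt_apply]

theorem HasWirt.pureTensor {n : ℕ} {U : Type*} [Fintype U] [DecidableEq U] {b : U → ℕ}
    {c : ℂ → Spot b → Fin n → ℂ} {a a' : Spot b → Fin n → ℂ}
    (h : ∀ s, HasWirt (fun σ => c σ s) (a s) (a' s) τ) :
    HasWirt (fun σ => pureTensor n b (c σ))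
      (∑ s, pureTensor n b (Function.update (c τ) s (a s)))
      (∑ s, pureTensor n b (Function.update (c τ) s (a' s))) τ := by
  have := HasFDerivAt.multilinear_comp
    (f := (FunkeMillson.pureTensor n b).restrictScalars ℝ) h
  refine hasWirt_of_hasFDerivAt this fun v => ?_
  simp only [sum_apply, ContinuousLinearMap.comp_apply, wirt_apply,
    Finset.smul_sum, ← Finset.sum_add_distrib]
  refine Finset.sum_congr rfl fun s _ => ?_
  show FunkeMillson.pureTensor n b (Function.update (c τ) s _) = _
  rw [ContinuousMultilinearMap.map_update_add, ContinuousMultilinearMap.map_update_smul,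
    ContinuousMultilinearMap.map_update_smul]

end Wirtinger

/-! ### The operators `D^c` and `DD^c` in Wirtinger calculus -/

section Operators

open scoped ComplexConjugate

theorem wedge_apply (α β : ℂ →L[ℝ] ℂ) (v : Fin 2 → ℂ) :
    wedge α β v = α (v 0) * β (v 1) - α (v 1) * β (v 0) := by
  simp [wedge, ContinuousMultilinearMap.alternatization_apply_apply, Fin.prod_univ_two,
    show (Finset.univ : Finset (Equiv.Perm (Fin 2))) = {1, Equiv.swap 0 1} by decide,
    Finset.sum_pair (show (1 : Equiv.Perm (Fin 2)) ≠ Equiv.swap 0 1 by decide), sub_eq_add_neg]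

/-- The form `dτ ∧ dτ̄ ⊗ t`. -/
def areaForm {T : Type*} [NormedAddCommGroup T] [NormedSpace ℝ T] [NormedSpace ℂ T]
    [IsScalarTower ℝ ℂ T] (t : T) : ℂ [⋀^Fin 2]→L[ℝ] T :=
  formTensor (wedge (ContinuousLinearMap.id ℝ ℂ) Complex.conjCLE) t

theorem areaForm_apply {T : Type*} [NormedAddCommGroup T] [NormedSpace ℝ T] [NormedSpace ℂ T]
    [IsScalarTower ℝ ℂ T] (t : T) (v : Fin 2 → ℂ) :
    areaForm t v = (v 0 * conj (v 1) - v 1 * conj (v 0)) • t := by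
  simp [areaForm, formTensor, wedge_apply]

/-- Only the mixed derivatives `∂β/∂τ` and `∂α/∂τ̄` survive alternation, since `dτ ∧ dτ` and `dτ̄ ∧
dτ̄` vanish. -/
theorem extDeriv_wirt {T : Type*} [NormedAddCommGroup T] [NormedSpace ℝ T] [NormedSpace ℂ T]
    [IsScalarTower ℝ ℂ T] {α β : ℂ → T} {a a' d d' : T} {τ : ℂ}
    (hα : HasWirt α a a' τ) (hβ : HasWirt β d d' τ) :
    extDeriv (fun σ => ContinuousAlternatingMap.ofSubsingleton ℝ ℂ T (0 : Fin 1)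
      (wirt (α σ) (β σ))) τ = areaForm (d - a') := by
  have hw : DifferentiableAt ℝ (fun σ => wirt (α σ) (β σ)) τ := by
    have h1 : DifferentiableAt ℝ α τ := HasFDerivAt.differentiableAt hα
    have h2 : DifferentiableAt ℝ β τ := HasFDerivAt.differentiableAt hβ
    -- Differentiability in `σ` is visible once the form is written linearly in its two
    -- coefficients.
    have h3 : (fun σ => wirt (α σ) (β σ)) = fun σ =>
        (ContinuousLinearMap.lsmul ℝ ℂ : ℂ →L[ℝ] T →L[ℝ] T).flip (α σ)
        + ((ContinuousLinearMap.lsmul ℝ ℂ : ℂ →L[ℝ] T →L[ℝ] T).flip (β σ)).comp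
          (Complex.conjCLE : ℂ →L[ℝ] ℂ) := by
      ext σ
      simp [wirt_apply]
    rw [h3]
    fun_prop
  have hd : DifferentiableAt ℝ (fun σ => ContinuousAlternatingMap.ofSubsingleton ℝ ℂ T (0 : Fin 1)
      (wirt (α σ) (β σ))) τ :=
    (ContinuousAlternatingMap.ofSubsingletonLIE (𝕜 := ℝ) (E := ℂ) (F := T)
      (0 : Fin 1)).differentiable.differentiableAt.comp τ hw
  ext v
  rw [extDeriv_apply hd, Fin.sum_univ_two, areaForm_apply]
  have key : ∀ w : ℂ, ∀ h : ℂ, fderiv ℝ (fun σ => wirt (α σ) (β σ) w) τ h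
      = w • (h • a + conj h • a') + conj w • (h • d + conj h • d') := by
    intro w h
    have h3 := ((hα.const_smul w).add (hβ.const_smul (conj w)))
    have h4 : (fun σ => wirt (α σ) (β σ) w) = fun σ => w • α σ + conj w • β σ :=
      funext fun σ => wirt_apply _ _ _
    rw [h4, HasFDerivAt.fderiv h3, wirt_apply]
    module
  have e0 : ∀ σ, (ContinuousAlternatingMap.ofSubsingleton ℝ ℂ T (0 : Fin 1) (wirt (α σ) (β σ)))
      (Fin.removeNth 0 v) = wirt (α σ) (β σ) (v 1) := fun σ => rfl
  have e1 : ∀ σ, (ContinuousAlternatingMap.ofSubsingleton ℝ ℂ T (0 : Fin 1) (wirt (α σ) (β σ)))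
      (Fin.removeNth 1 v) = wirt (α σ) (β σ) (v 0) := fun σ => rfl
  simp only [e0, e1, key]
  simp
  module

variable {n : ℕ} {U : Type*} [Fintype U] [DecidableEq U] {b : U → ℕ}
  {F : U → ℂ → Matrix (Fin n) (Fin n) ℂ} {wt : U → Fin n → ℤ} {τ : ℂ}

theorem part10_wirt (a a' : Tens n b) : part10 (wirt a a') = wirt a 0 := by
  ext1 h
  simp only [part10, smul_apply, sub_apply,
    ContinuousLinearMap.comp_apply, wirt_apply, ContinuousLinearMap.mul_apply', map_mul,
    Complex.conj_I, smul_zero, add_zero]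
  match_scalars
  · linear_combination (-h / 2) * Complex.I_sq
  · linear_combination (conj h / 2) * Complex.I_sq

theorem part01_wirt (a a' : Tens n b) : part01 (wirt a a') = wirt 0 a' := by
  ext1 h
  simp only [part01, smul_apply, add_apply,
    ContinuousLinearMap.comp_apply, wirt_apply, ContinuousLinearMap.mul_apply', map_mul,
    Complex.conj_I, smul_zero, zero_add]
  match_scalars
  · linear_combination (h / 2) * Complex.I_sq
  · linear_combination (-conj h / 2) * Complex.I_sq

/-- Near `τ` the Hodge component of `s` is `s` itself for `p = 0` and zero otherwise, so only `p =
0` contributes. The derivative is given sorted by form type and Hodge type, with `a₁` the part of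
`∇'` and `b₁` the part of `∇̄'`; the signs in `D^c` flip `a₁` and `b₀`. -/
theorem dc_eq {s : ℂ → Tens n b} {a₀ a₁ b₀ b₁ : Tens n b}
    (hs : ∀ᶠ σ in nhds τ, HasType b F wt σ 0 (s σ))
    (hd : HasWirt s (a₀ + a₁) (b₀ + b₁) τ)
    (ha₀ : HasType b F wt τ 0 a₀) (ha₁ : HasType b F wt τ (-1) a₁)
    (hb₀ : HasType b F wt τ 0 b₀) (hb₁ : HasType b F wt τ 1 b₁) :
    dc b F wt s τ = (4 * Real.pi * Complex.I : ℂ)⁻¹ • wirt (a₀ - a₁) (b₁ - b₀) := by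
  have hds : ∀ p : ℤ, fderiv ℝ (fun σ => realCLM (hodgeProj b F wt p σ) (s σ)) τ
      = if p = 0 then wirt (a₀ + a₁) (b₀ + b₁) else 0 := by
    intro p
    have h1 : (fun σ => realCLM (hodgeProj b F wt p σ) (s σ))
        =ᶠ[nhds τ] if p = 0 then s else fun _ => 0 := by
      filter_upwards [hs] with σ hσ
      show hodgeProj b F wt p σ (s σ) = _
      rw [hσ p]
      by_cases h : p = 0
      · simp [h]
      · simp [h, Ne.symm h]
    rw [h1.fderiv_eq]
    split_ifs
    · exact HasFDerivAt.fderiv hd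
    · simp
  have hN : (0 : ℤ) ∈ Finset.Icc (-∑ u, (b u : ℤ)) (∑ u, (b u : ℤ)) := by
    have : (0 : ℤ) ≤ ∑ u, (b u : ℤ) := Finset.sum_nonneg fun _ _ => Int.natCast_nonneg _
    simp [this]
  have hz10 : part10 (0 : ℂ →L[ℝ] Tens n b) = 0 := by simp [part10]
  have hz01 : part01 (0 : ℂ →L[ℝ] Tens n b) = 0 := by simp [part01]
  unfold dc
  simp only [hds]
  congr 1
  rw [Finset.sum_eq_single_of_mem 0 hN, Finset.sum_eq_single_of_mem 0 hN]
  · simp only [if_true, part10_wirt, part01_wirt]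
    ext1 h
    have hr : ∀ (p : ℤ) (t : Tens n b), realCLM (hodgeProj b F wt p τ) t = hodgeProj b F wt p τ t :=
      fun _ _ => rfl
    simp only [sub_apply, add_apply,
      ContinuousLinearMap.comp_apply, wirt_apply, hr, map_add, map_smul, ha₀ _, ha₁ _, hb₀ _,
      hb₁ _, map_zero, smul_zero]
    norm_num
    module
  · intro p _ hp
    simp [hp, hz10, hz01]
  · intro p _ hp
    simp [hp, hz10, hz01]

/-- A section of type `(0,0)` on the unit disc together with the components of its derivative,
sorted by form type and Hodge type. -/
structure TypedSection (b : U → ℕ) (F : U → ℂ → Matrix (Fin n) (Fin n) ℂ) (wt : U → Fin n → ℤ)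
    (s a₀ a₁ b₀ b₁ : ℂ → Tens n b) : Prop where
  type : ∀ σ, ‖σ‖ < 1 → HasType b F wt σ 0 (s σ)
  deriv : ∀ σ, ‖σ‖ < 1 → HasWirt s (a₀ σ + a₁ σ) (b₀ σ + b₁ σ) σ
  type_a₀ : ∀ σ, ‖σ‖ < 1 → HasType b F wt σ 0 (a₀ σ)
  type_a₁ : ∀ σ, ‖σ‖ < 1 → HasType b F wt σ (-1) (a₁ σ)
  type_b₀ : ∀ σ, ‖σ‖ < 1 → HasType b F wt σ 0 (b₀ σ)
  type_b₁ : ∀ σ, ‖σ‖ < 1 → HasType b F wt σ 1 (b₁ σ)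

theorem eventually_norm_lt_one (hτ : ‖τ‖ < 1) : ∀ᶠ σ in nhds τ, ‖σ‖ < 1 :=
  continuous_norm.continuousAt.eventually_lt continuousAt_const hτ

/-- To differentiate `D^c s` at `τ` it must be known on a neighbourhood; this is why the types are
prescribed on the whole disc. -/
theorem TypedSection.ddc_eq {s a₀ a₁ b₀ b₁ : ℂ → Tens n b}
    (h : TypedSection b F wt s a₀ a₁ b₀ b₁) (hτ : ‖τ‖ < 1) {d d' e e' : Tens n b}
    (hd : HasWirt (fun σ => a₀ σ - a₁ σ) d d' τ) (he : HasWirt (fun σ => b₁ σ - b₀ σ) e e' τ) :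
    ddc b F wt s τ = areaForm ((4 * Real.pi * Complex.I : ℂ)⁻¹ • (e - d')) := by
  have h1 : (fun σ => ContinuousAlternatingMap.ofSubsingleton ℝ ℂ (Tens n b) (0 : Fin 1)
      (dc b F wt s σ)) =ᶠ[nhds τ] fun σ =>
      ContinuousAlternatingMap.ofSubsingleton ℝ ℂ (Tens n b) (0 : Fin 1)
        (wirt ((4 * Real.pi * Complex.I : ℂ)⁻¹ • (a₀ σ - a₁ σ))
          ((4 * Real.pi * Complex.I : ℂ)⁻¹ • (b₁ σ - b₀ σ))) := by
    filter_upwards [eventually_norm_lt_one hτ] with σ hσ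
    rw [dc_eq ((eventually_norm_lt_one hσ).mono h.type) (h.deriv σ hσ) (h.type_a₀ σ hσ)
      (h.type_a₁ σ hσ) (h.type_b₀ σ hσ) (h.type_b₁ σ hσ)]
    congr 1
    ext1 v
    simp only [smul_apply, wirt_apply]
    module
  rw [ddc, h1.extDeriv_eq, extDeriv_wirt (hd.const_smul _) (he.const_smul _), smul_sub]

end Operators

end FunkeMillson
end

noncomputable section

namespace FunkeMillson

/-! ### Moving frames -/

section MovingFrame

variable {n : ℕ} {U : Type*} [Fintype U] [DecidableEq U] {b : U → ℕ}
  {F : U → ℂ → Matrix (Fin n) (Fin n) ℂ} {wt : U → Fin n → ℤ} {τ : ℂ}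

/-- Structure equations over the unit disc: `E` is a section of type `(0,0)` with
`dE = A E dτ + A' E dτ̄ + Y dτ + X dτ̄`, where `X` and `Y` are of type `(1,-1)` and `(-1,1)`, and the
derivatives of `X` with respect to `τ` and of `Y` with respect to `τ̄` involve `Z`. -/
structure MovingFrame (b : U → ℕ) (F : U → ℂ → Matrix (Fin n) (Fin n) ℂ) (wt : U → Fin n → ℤ)
    (E X Y Z : ℂ → Tens n b) (A A' K K' : ℂ → ℂ) : Prop where
  type_E : ∀ σ, ‖σ‖ < 1 → HasType b F wt σ 0 (E σ)
  type_X : ∀ σ, ‖σ‖ < 1 → HasType b F wt σ 1 (X σ)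
  type_Y : ∀ σ, ‖σ‖ < 1 → HasType b F wt σ (-1) (Y σ)
  deriv_E : ∀ σ, ‖σ‖ < 1 → HasWirt E (A σ • E σ + Y σ) (A' σ • E σ + X σ) σ
  deriv_X : ∀ σ, ‖σ‖ < 1 → ∃ d, HasWirt X (A σ • X σ + K σ • E σ + Z σ) d σ
  deriv_Y : ∀ σ, ‖σ‖ < 1 → ∃ d, HasWirt Y d (A' σ • Y σ + K' σ • E σ + Z σ) σ

/-- Since `T` is constant in `σ`, it passes through the derivatives. It is applied to the identity
and to the harmonic projection. -/
theorem MovingFrame.map {E X Y Z : ℂ → Tens n b} {A A' K K' : ℂ → ℂ}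
    (h : MovingFrame b F wt E X Y Z A A' K K') {T : Tens n b →ₗ[ℂ] Tens n b}
    (hT : ∀ σ, ‖σ‖ < 1 → ∀ q, hodgeProj b F wt q σ ∘ₗ T = T ∘ₗ hodgeProj b F wt q σ) :
    MovingFrame b F wt (fun σ => T (E σ)) (fun σ => T (X σ)) (fun σ => T (Y σ))
      (fun σ => T (Z σ)) A A' K K' where
  type_E σ hσ := (h.type_E σ hσ).map (hT σ hσ)
  type_X σ hσ := (h.type_X σ hσ).map (hT σ hσ)
  type_Y σ hσ := (h.type_Y σ hσ).map (hT σ hσ)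
  deriv_E σ hσ := ((h.deriv_E σ hσ).map T).congr (by simp) (by simp)
  deriv_X σ hσ := by
    obtain ⟨d, hd⟩ := h.deriv_X σ hσ
    exact ⟨T d, (hd.map T).congr (by simp) rfl⟩
  deriv_Y σ hσ := by
    obtain ⟨d, hd⟩ := h.deriv_Y σ hσ
    exact ⟨T d, (hd.map T).congr rfl (by simp)⟩

/-- By the hypothesis on `f`, `D(f E) = (P E + f Y) dτ + (Q E + f X) dτ̄`, so up to the factor
`(4πi)⁻¹` one has `D^c(f E) = (P E - f Y) dτ + (f X - Q E) dτ̄`. In the derivative of this the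
coefficient of `X` is `(P - A f) + f A - P = 0`, that of `Y` vanishes likewise, and each of `f X`
and `f Y` contributes one `f Z`. -/
theorem MovingFrame.ddc_eq {E X Y Z : ℂ → Tens n b} {A A' K K' : ℂ → ℂ}
    (h : MovingFrame b F wt E X Y Z A A' K K') {f P Q : ℂ → ℂ}
    (hf : ∀ σ, ‖σ‖ < 1 → HasWirt f (P σ - A σ * f σ) (Q σ - A' σ * f σ) σ) (hτ : ‖τ‖ < 1)
    {P₁ P₂ Q₁ Q₂ : ℂ} (hP : HasWirt P P₁ P₂ τ) (hQ : HasWirt Q Q₁ Q₂ τ) :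
    ddc b F wt (fun σ => f σ • E σ) τ = areaForm ((4 * Real.pi * Complex.I : ℂ)⁻¹ •
      ((f τ * (K τ + K' τ) - (Q₁ + A τ * Q τ) - (P₂ + A' τ * P τ)) • E τ
        + (2 * f τ) • Z τ)) := by
  have hs : TypedSection b F wt (fun σ => f σ • E σ) (fun σ => P σ • E σ) (fun σ => f σ • Y σ)
      (fun σ => Q σ • E σ) (fun σ => f σ • X σ) :=
    { type := fun σ hσ => (h.type_E σ hσ).smul _
      deriv := fun σ hσ => ((hf σ hσ).smul (h.deriv_E σ hσ)).congr (by module) (by module)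
      type_a₀ := fun σ hσ => (h.type_E σ hσ).smul _
      type_a₁ := fun σ hσ => (h.type_Y σ hσ).smul _
      type_b₀ := fun σ hσ => (h.type_E σ hσ).smul _
      type_b₁ := fun σ hσ => (h.type_X σ hσ).smul _ }
  obtain ⟨x', hX⟩ := h.deriv_X τ hτ
  obtain ⟨y', hY⟩ := h.deriv_Y τ hτ
  rw [hs.ddc_eq hτ ((hP.smul (h.deriv_E τ hτ)).sub ((hf τ hτ).smul hY))
    (((hf τ hτ).smul hX).sub (hQ.smul (h.deriv_E τ hτ)))]
  congr 2
  module

/-- The sum over all ways to replace one factor of a pure tensor. -/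
def replaceOne (c x : Spot b → Fin n → ℂ) : Tens n b :=
  ∑ s, pureTensor n b (Function.update c s (x s))

/-- The sum over all ways to replace two factors of a pure tensor. -/
def replaceTwo (c x y : Spot b → Fin n → ℂ) : Tens n b :=
  ∑ s, ∑ s', if s' = s then 0 else
    pureTensor n b (Function.update (Function.update c s (x s)) s' (y s'))

theorem replaceTwo_comm (c x y : Spot b → Fin n → ℂ) : replaceTwo c x y = replaceTwo c y x := by
  rw [replaceTwo, replaceTwo, Finset.sum_comm]
  refine Finset.sum_congr rfl fun s _ => Finset.sum_congr rfl fun s' _ => ?_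
  by_cases h : s' = s
  · simp [h]
  · rw [if_neg h, if_neg (Ne.symm h), Function.update_comm h]

/-- Leibniz rule. In the replaced spot, `x` reproduces itself and returns `κ` times the original
factor; in any other spot the factor reproduces itself or turns into `y`, which gives the double
replacement. The self-reproducing terms add up to `∑ α`. -/
theorem hasWirt_replaceOne {c x : ℂ → Spot b → Fin n → ℂ} {α κ : Spot b → ℂ}
    {y a' d' : Spot b → Fin n → ℂ}
    (hc : ∀ s, HasWirt (fun σ => c σ s) (α s • c τ s + y s) (a' s) τ)
    (hx : ∀ s, HasWirt (fun σ => x σ s) (α s • x τ s + κ s • c τ s) (d' s) τ) :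
    ∃ d, HasWirt (fun σ => replaceOne (c σ) (x σ))
      ((∑ s, α s) • replaceOne (c τ) (x τ) + (∑ s, κ s) • pureTensor n b (c τ)
        + replaceTwo (c τ) (x τ) y) d τ := by
  have h1 : ∀ s, HasWirt (fun σ => pureTensor n b (Function.update (c σ) s (x σ s)))
      (∑ s', pureTensor n b (Function.update (Function.update (c τ) s (x τ s)) s'
        (if s' = s then α s • x τ s + κ s • c τ s else α s' • c τ s' + y s')))
      (∑ s', pureTensor n b (Function.update (Function.update (c τ) s (x τ s)) s'
        (if s' = s then d' s else a' s'))) τ := by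
    intro s
    refine HasWirt.pureTensor fun s' => ?_
    by_cases h : s' = s
    · subst h
      simpa using hx s'
    · simpa [h, Function.update_of_ne h] using hc s'
  refine ⟨_, (HasWirt.sum Finset.univ fun s _ => h1 s).congr ?_ rfl⟩
  rw [replaceOne, replaceTwo, Finset.smul_sum, Finset.sum_smul, ← Finset.sum_add_distrib,
    ← Finset.sum_add_distrib]
  refine Finset.sum_congr rfl fun s _ => ?_
  rw [Finset.sum_smul, ← Finset.sum_erase_add _ _ (Finset.mem_univ s),
    ← Finset.sum_erase_add (s := Finset.univ) (a := s) (f := fun s' => α s' • _)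
      (h := Finset.mem_univ s),
    ← Finset.sum_erase_add (s := Finset.univ) (a := s) (f := fun s' => ite (s' = s) 0 _)
      (h := Finset.mem_univ s)]
  simp only [if_true, Function.update_idem, ContinuousMultilinearMap.map_update_add,
    ContinuousMultilinearMap.map_update_smul, Function.update_eq_self]
  have h2 : ∀ s' ∈ Finset.univ.erase s,
      pureTensor n b (Function.update (Function.update (c τ) s (x τ s)) s'
        (if s' = s then α s • x τ s + κ s • c τ s else α s' • c τ s' + y s'))
      = α s' • pureTensor n b (Function.update (c τ) s (x τ s))
        + if s' = s then 0 else
          pureTensor n b (Function.update (Function.update (c τ) s (x τ s)) s' (y s')) := by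
    intro s' hs'
    have h : s' ≠ s := Finset.ne_of_mem_erase hs'
    have h3 : Function.update (Function.update (c τ) s (x τ s)) s' (c τ s')
        = Function.update (c τ) s (x τ s) := by
      conv_lhs => rw [show c τ s' = Function.update (c τ) s (x τ s) s' by
        rw [Function.update_of_ne h]]
      rw [Function.update_eq_self]
    rw [if_neg h, if_neg h, ContinuousMultilinearMap.map_update_add,
      ContinuousMultilinearMap.map_update_smul, h3]
  rw [Finset.sum_congr rfl h2, Finset.sum_add_distrib]
  abel

theorem HasWirt.of_swap {T : Type*} [NormedAddCommGroup T] [NormedSpace ℝ T] [NormedSpace ℂ T]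
    [IsScalarTower ℝ ℂ T] {f : ℂ → T} {a a' : T}
    (h : HasWirt (fun σ => f (starRingEnd ℂ σ)) a a' (starRingEnd ℂ τ)) : HasWirt f a' a τ := by
  have := h.comp (hasWirt_conj (τ := τ))
  simp only [Complex.conj_conj] at this
  exact this.congr (by simp) (by simp)

theorem HasWirt.swap {T : Type*} [NormedAddCommGroup T] [NormedSpace ℝ T] [NormedSpace ℂ T]
    [IsScalarTower ℝ ℂ T] {f : ℂ → T} {a a' : T}
    (h : HasWirt f a a' τ) : HasWirt (fun σ => f (starRingEnd ℂ σ)) a' a (starRingEnd ℂ τ) := by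
  have h' : HasWirt f a a' (starRingEnd ℂ (starRingEnd ℂ τ)) := by rwa [Complex.conj_conj]
  exact (h'.comp (hasWirt_conj (τ := starRingEnd ℂ τ))).congr (by simp) (by simp)

/-- The statement of `hasWirt_replaceOne` with `τ` and `τ̄` exchanged; precomposition with complex
conjugation reduces one to the other. -/
theorem hasWirt_replaceOne' {c y : ℂ → Spot b → Fin n → ℂ} {α' κ' : Spot b → ℂ}
    {x a d : Spot b → Fin n → ℂ}
    (hc : ∀ s, HasWirt (fun σ => c σ s) (a s) (α' s • c τ s + x s) τ)
    (hy : ∀ s, HasWirt (fun σ => y σ s) (d s) (α' s • y τ s + κ' s • c τ s) τ) :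
    ∃ d, HasWirt (fun σ => replaceOne (c σ) (y σ)) d
      ((∑ s, α' s) • replaceOne (c τ) (y τ) + (∑ s, κ' s) • pureTensor n b (c τ)
        + replaceTwo (c τ) x (y τ)) τ := by
  obtain ⟨d, hd⟩ := hasWirt_replaceOne (τ := starRingEnd ℂ τ)
    (c := fun σ => c (starRingEnd ℂ σ)) (x := fun σ => y (starRingEnd ℂ σ)) (α := α') (κ := κ')
    (y := x) (a' := a) (d' := d)
    (fun s => by simpa using (hc s).swap) (fun s => by simpa using (hy s).swap)
  rw [replaceTwo_comm]
  simp only [Complex.conj_conj] at hd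
  exact ⟨d, hd.of_swap⟩

/-- Moving frames of pure tensors: the factors `c` of type `(0,0)` and the vectors `x`, `y` of type
`(1,-1)` and `(-1,1)` satisfy the structure equations. -/
theorem movingFrame_pureTensor {M : Type*} [Fintype M] {ω : M → ℂ}
    {c : M → ℂ → Spot b → Fin n → ℂ} {x y : ℂ → Spot b → Fin n → ℂ} {α α' κ κ' : ℂ → Spot b → ℂ}
    (hF : ∀ u σ, ‖σ‖ < 1 → F u σ * (F u σ)⁻¹ = 1)
    (tc : ∀ μ, ω μ ≠ 0 → ∀ σ, ‖σ‖ < 1 → ∀ s, VecType F wt σ s.1 0 (c μ σ s))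
    (tx : ∀ σ, ‖σ‖ < 1 → ∀ s, VecType F wt σ s.1 1 (x σ s))
    (ty : ∀ σ, ‖σ‖ < 1 → ∀ s, VecType F wt σ s.1 (-1) (y σ s))
    (hc : ∀ μ, ω μ ≠ 0 → ∀ σ, ‖σ‖ < 1 → ∀ s, HasWirt (fun σ => c μ σ s)
      (α σ s • c μ σ s + y σ s) (α' σ s • c μ σ s + x σ s) σ)
    (hx : ∀ μ, ω μ ≠ 0 → ∀ σ, ‖σ‖ < 1 → ∀ s, ∃ d, HasWirt (fun σ => x σ s)
      (α σ s • x σ s + κ σ s • c μ σ s) d σ)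
    (hy : ∀ μ, ω μ ≠ 0 → ∀ σ, ‖σ‖ < 1 → ∀ s, ∃ d, HasWirt (fun σ => y σ s)
      d (α' σ s • y σ s + κ' σ s • c μ σ s) σ) :
    MovingFrame b F wt (fun σ => ∑ μ, ω μ • pureTensor n b (c μ σ))
      (fun σ => ∑ μ, ω μ • replaceOne (c μ σ) (x σ))
      (fun σ => ∑ μ, ω μ • replaceOne (c μ σ) (y σ))
      (fun σ => ∑ μ, ω μ • replaceTwo (c μ σ) (x σ) (y σ))
      (fun σ => ∑ s, α σ s) (fun σ => ∑ s, α' σ s)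
      (fun σ => ∑ s, κ σ s) (fun σ => ∑ s, κ' σ s) := by
  -- Indices with `ω μ = 0` are exempt from all hypotheses: in the applications their factors need
  -- not be of type `(0,0)`.
  have red : ∀ {σ : ℂ} {p : ℤ} {t : M → Tens n b}, (∀ μ, ω μ ≠ 0 → HasType b F wt σ p (t μ)) →
      HasType b F wt σ p (∑ μ, ω μ • t μ) := by
    intro σ p t ht
    refine HasType.sum _ fun μ _ => ?_
    by_cases h : ω μ = 0
    · rw [h, zero_smul]; exact HasType.zero
    · exact (ht μ h).smul _
  have one : ∀ {σ : ℂ}, ‖σ‖ < 1 → ∀ {p : ℤ} {z : Spot b → Fin n → ℂ},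
      (∀ s, VecType F wt σ s.1 p (z s)) → ∀ μ, ω μ ≠ 0 →
      HasType b F wt σ p (replaceOne (c μ σ) z) := by
    intro σ hσ p z hz μ hμ
    refine HasType.sum _ fun s _ => HasType.pureTensor (fun u => hF u σ hσ)
      (w := fun s' => if s' = s then p else 0) (fun s' => ?_) (by simp)
    by_cases h : s' = s
    · subst h; simpa using hz s'
    · simpa [h, Function.update_of_ne h] using tc μ hμ σ hσ s'
  have red2 : ∀ {σ : ℂ} {t : M → ℂ → Tens n b} {a a' : M → Tens n b},
      (∀ μ, ω μ ≠ 0 → HasWirt (t μ) (a μ) (a' μ) σ) →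
      HasWirt (fun σ => ∑ μ, ω μ • t μ σ) (∑ μ, ω μ • a μ) (∑ μ, ω μ • a' μ) σ := by
    intro σ t a a' ht
    refine HasWirt.sum _ fun μ _ => ?_
    by_cases h : ω μ = 0
    · simpa [h] using hasWirt_const (T := Tens n b) (τ := σ) 0
    · exact (ht μ h).const_smul _
  refine ⟨?_, ?_, ?_, ?_, ?_, ?_⟩
  · intro σ hσ
    exact red fun μ hμ => HasType.pureTensor (fun u => hF u σ hσ) (tc μ hμ σ hσ) (by simp)
  · exact fun σ hσ => red (one hσ (tx σ hσ))
  · exact fun σ hσ => red (one hσ (ty σ hσ))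
  · intro σ hσ
    refine (red2 fun μ hμ => HasWirt.pureTensor (hc μ hμ σ hσ)).congr ?_ ?_
    all_goals
      simp only [ContinuousMultilinearMap.map_update_add, ContinuousMultilinearMap.map_update_smul,
        Function.update_eq_self, replaceOne, Finset.smul_sum, ← Finset.sum_add_distrib, smul_add]
      refine Finset.sum_congr rfl fun μ _ => ?_
      rw [Finset.sum_add_distrib, Finset.sum_smul]
      simp only [smul_smul, mul_comm]
  · intro σ hσ
    have h1 : ∀ μ, ∃ d, ω μ ≠ 0 → HasWirt (fun σ => replaceOne (c μ σ) (x σ))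
      ((∑ s, α σ s) • replaceOne (c μ σ) (x σ) + (∑ s, κ σ s) • pureTensor n b (c μ σ)
        + replaceTwo (c μ σ) (x σ) (y σ)) d σ := by
      intro μ
      by_cases hμ : ω μ = 0
      · exact ⟨0, fun h => absurd hμ h⟩
      · choose d hd using hx μ hμ σ hσ
        obtain ⟨e, he⟩ := hasWirt_replaceOne (hc μ hμ σ hσ) hd
        exact ⟨e, fun _ => he⟩
    choose d hd using h1
    refine ⟨_, (red2 hd).congr ?_ rfl⟩
    simp only [smul_add, Finset.sum_add_distrib, Finset.smul_sum (s := (Finset.univ : Finset M)),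
      smul_smul, mul_comm]
  · intro σ hσ
    have h1 : ∀ μ, ∃ d, ω μ ≠ 0 → HasWirt (fun σ => replaceOne (c μ σ) (y σ)) d
      ((∑ s, α' σ s) • replaceOne (c μ σ) (y σ) + (∑ s, κ' σ s) • pureTensor n b (c μ σ)
        + replaceTwo (c μ σ) (x σ) (y σ)) σ := by
      intro μ
      by_cases hμ : ω μ = 0
      · exact ⟨0, fun h => absurd hμ h⟩
      · choose d hd using hy μ hμ σ hσ
        obtain ⟨e, he⟩ := hasWirt_replaceOne' (hc μ hμ σ hσ) hd
        exact ⟨e, fun _ => he⟩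
    choose d hd using h1
    refine ⟨_, (red2 hd).congr rfl ?_⟩
    simp only [smul_add, Finset.sum_add_distrib, Finset.smul_sum (s := (Finset.univ : Finset M)),
      smul_smul, mul_comm]

end MovingFrame

end FunkeMillson
end

noncomputable section

namespace FunkeMillson

/-! ### Evaluation of the weighted functions -/

section Weighted

variable {n : ℕ} {U X : Type*} [DecidableEq U] {R : U → Fin n → (X → ℂ) → (X → ℂ)}
  {G : (U → Fin n → ℕ) → X → ℂ} {ok : U → Fin n → Prop}

/-- The number of spots of each label in which each basis vector occurs. -/
def multiplicity [Fintype U] {b : U → ℕ} (m : Idx n b) : U → Fin n → ℕ :=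
  ∑ s : Spot b, Pi.single s.1 (Pi.single (m s.1 s.2) 1)

/-- Each application reads the first spot of label `u` and passes on the rest, so the iteration
consumes the list exactly, with the operator of the first spot outermost. -/
theorem iterate_create (u : U) (Φ : X → (U → List (Fin n)) → ℂ) (l : List (Fin n)) (x : X)
    (m : U → List (Fin n)) (hm : m u = l) :
    (create R u)^[l.length] Φ x m
      = l.foldr (R u) (fun y => Φ y (Function.update m u [])) x := by
  induction l generalizing m x with
  | nil =>
    have h : Function.update m u [] = m := by rw [← hm, Function.update_eq_self]
    show Φ x m = Φ x (Function.update m u [])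
    rw [h]
  | cons j l ih =>
    rw [List.length_cons, Function.iterate_succ_apply', List.foldr_cons]
    have h1 : ∀ Ψ : X → (U → List (Fin n)) → ℂ, create R u Ψ x m
        = R u j (fun y => Ψ y (Function.update m u l)) x := by
      intro Ψ
      simp only [create]
      rw [hm]
    rw [h1]
    congr 1
    ext y
    rw [ih y (Function.update m u l) (by simp), Function.update_idem]

/-- A single forbidden entry kills the function, as the operators further out preserve `0`. The last
clause serves the labels that are treated after the function has already vanished. -/
theorem foldr_raise (h1 : ∀ u j P, ok u j → R u j (G P) = G (P + Pi.single u (Pi.single j 1)))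
    (h2 : ∀ u j f, ¬ ok u j → R u j f = 0) (h0 : ∀ u j, R u j 0 = 0) (u : U)
    (l : List (Fin n)) (P : U → Fin n → ℕ) :
    ((∀ j ∈ l, ok u j) → l.foldr (R u) (G P)
        = G (P + (l.map fun j => Pi.single u (Pi.single j 1)).sum)) ∧
      ((¬ ∀ j ∈ l, ok u j) → l.foldr (R u) (G P) = 0) ∧ l.foldr (R u) 0 = 0 := by
  induction l with
  | nil => simp
  | cons j l ih =>
    refine ⟨fun h => ?_, fun h => ?_, ?_⟩
    · rw [List.foldr_cons, ih.1 fun i hi => h i (List.mem_cons_of_mem _ hi),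
        h1 _ _ _ (h j List.mem_cons_self), List.map_cons, List.sum_cons]
      congr 1
      abel
    · rw [List.foldr_cons]
      by_cases hj : ok u j
      · rw [ih.2.1, h0]
        intro h'
        exact h fun i hi => (List.mem_cons.1 hi).elim (fun e => e ▸ hj) (h' i)
      · exact h2 _ _ _ hj
    · rw [List.foldr_cons, ih.2.2, h0]

/-- Induction over the labels: consuming the spots of one label leaves the multi-index with that
list emptied, and the starting function is supported at the empty multi-index. -/
theorem foldr_create [Fintype U]
    (h1 : ∀ u j P, ok u j → R u j (G P) = G (P + Pi.single u (Pi.single j 1)))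
    (h2 : ∀ u j f, ¬ ok u j → R u j f = 0) (h0 : ∀ u j, R u j 0 = 0) (b : U → ℕ)
    (P : U → Fin n → ℕ) (L : List U) (hL : L.Nodup) (m : U → List (Fin n))
    (hm : ∀ u ∈ L, (m u).length = b u) (hm' : ∀ u ∉ L, m u = []) :
    ((∀ u ∈ L, ∀ j ∈ m u, ok u j) →
      (fun x => L.foldr (fun u Φ => (create R u)^[b u] Φ)
        (fun y l => if l = (fun _ => []) then G P y else 0) x m)
      = G (P + (L.map fun u => ((m u).map fun j => Pi.single u (Pi.single j 1)).sum).sum)) ∧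
    ((¬ ∀ u ∈ L, ∀ j ∈ m u, ok u j) →
      (fun x => L.foldr (fun u Φ => (create R u)^[b u] Φ)
        (fun y l => if l = (fun _ => []) then G P y else 0) x m) = 0) := by
  induction L generalizing m with
  | nil =>
    have : m = fun _ => [] := funext fun u => hm' u List.not_mem_nil
    subst this
    simp
  | cons u L ih =>
    rw [List.nodup_cons] at hL
    have hne : ∀ w ∈ L, w ≠ u := fun w hw e => hL.1 (e ▸ hw)
    have ih' := ih hL.2 (Function.update m u [])
      (fun w hw => by rw [Function.update_of_ne (hne w hw)]; exact hm w (List.mem_cons_of_mem _ hw))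
      (fun w hw => by
        by_cases e : w = u
        · subst e; simp
        · rw [Function.update_of_ne e]
          exact hm' w fun h => (List.mem_cons.1 h).elim e hw)
    have hstep : (fun x => (u :: L).foldr (fun u Φ => (create R u)^[b u] Φ)
        (fun y l => if l = (fun _ => []) then G P y else 0) x m)
        = (m u).foldr (R u) (fun y => L.foldr (fun u Φ => (create R u)^[b u] Φ)
        (fun y l => if l = (fun _ => []) then G P y else 0) y (Function.update m u [])) := by
      ext x
      rw [List.foldr_cons, ← hm u List.mem_cons_self, iterate_create u _ _ _ _ rfl]
    have hup : (∀ w ∈ L, ∀ j ∈ Function.update m u [] w, ok w j) ↔ ∀ w ∈ L, ∀ j ∈ m w, ok w j :=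
      forall₂_congr fun w hw => by rw [Function.update_of_ne (hne w hw)]
    rw [hstep]
    by_cases hok : ∀ w ∈ L, ∀ j ∈ m w, ok w j
    · rw [ih'.1 (hup.2 hok)]
      have hsum : (L.map fun w => ((Function.update m u [] w).map
          fun j => (Pi.single w (Pi.single j 1) : U → Fin n → ℕ)).sum)
          = L.map fun w => ((m w).map fun j => Pi.single w (Pi.single j 1)).sum :=
        List.map_congr_left fun w hw => by rw [Function.update_of_ne (hne w hw)]
      rw [hsum]
      refine ⟨fun h => ?_, fun h => ?_⟩
      · rw [(foldr_raise h1 h2 h0 u (m u) _).1 (h u List.mem_cons_self), List.map_cons,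
          List.sum_cons]
        congr 1
        abel
      · refine (foldr_raise h1 h2 h0 u (m u) _).2.1 fun h' => h fun w hw => ?_
        exact (List.mem_cons.1 hw).elim (fun e => e ▸ h') (hok w)
    · rw [ih'.2 fun h => hok (hup.1 h)]
      refine ⟨fun h => absurd (fun w hw => h w (List.mem_cons_of_mem _ hw)) hok, fun _ => ?_⟩
      exact (foldr_raise h1 h2 h0 u (m u) P).2.2

/-- For a family `G` on which the operators shift one exponent at a time, the order of the spots is
lost and only multiplicities count. -/
theorem weighted_eq [Fintype U]
    (h1 : ∀ u j P, ok u j → R u j (G P) = G (P + Pi.single u (Pi.single j 1)))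
    (h2 : ∀ u j f, ¬ ok u j → R u j f = 0) (h0 : ∀ u j, R u j 0 = 0) (b : U → ℕ)
    (P : U → Fin n → ℕ) (x : X) (m : Idx n b) :
    ((∀ u k, ok u (m u k)) → weighted R b (G P) x m = G (P + multiplicity m) x) ∧
      ((¬ ∀ u k, ok u (m u k)) → weighted R b (G P) x m = 0) := by
  have h := foldr_create h1 h2 h0 b P Finset.univ.toList (Finset.nodup_toList _)
    (fun u => List.ofFn (m u)) (fun u _ => List.length_ofFn) (fun u hu => by simp at hu)
  have hiff : (∀ u ∈ Finset.univ.toList, ∀ j ∈ List.ofFn (m u), ok u j) ↔ ∀ u k, ok u (m u k) := by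
    simp [List.mem_ofFn]
  have hsum : (Finset.univ.toList.map fun u =>
      ((List.ofFn (m u)).map fun j => (Pi.single u (Pi.single j 1) : U → Fin n → ℕ)).sum).sum
      = multiplicity m := by
    rw [Finset.sum_map_toList, multiplicity, Fintype.sum_sigma]
    refine Finset.sum_congr rfl fun u _ => ?_
    rw [List.map_ofFn, List.sum_ofFn]
    rfl
  rw [hiff, hsum] at h
  exact ⟨fun hok => congrFun (h.1 hok) x, fun hok => congrFun (h.2 hok) x⟩

theorem multiplicity_permute [Fintype U] {b : U → ℕ} (m : Idx n b)
    (σ : ∀ u, Equiv.Perm (Fin (b u))) :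
    multiplicity (fun u k => m u (σ u k)) = multiplicity m := by
  simp only [multiplicity, Fintype.sum_sigma]
  exact Finset.sum_congr rfl fun u _ => Fintype.sum_equiv (σ u) _ _ fun k => rfl

theorem multiplicity_apply [Fintype U] {b : U → ℕ} (m : Idx n b) (u : U) (j : Fin n) :
    multiplicity m u j = ∑ k, if m u k = j then 1 else 0 := by
  simp only [multiplicity, Fintype.sum_sigma, Finset.sum_apply]
  rw [Finset.sum_eq_single u]
  · refine Finset.sum_congr rfl fun k _ => ?_
    simp [Pi.single_apply, eq_comm]
  · intro w _ hw
    simp [Pi.single_eq_of_ne hw.symm]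
  · simp

end Weighted

/-! ### Hermite functions -/

section Hermite

open scoped ComplexConjugate

/-- The function `(½ (z - π⁻¹ ∂/∂z̄))^p (½ (z̄ - π⁻¹ ∂/∂z))^q e^{-π |z|²}`. -/
def hermC : ℕ → ℕ → ℂ → ℂ
  | 0, q, z => conj z ^ q * Complex.exp (-Real.pi * (z * conj z))
  | p + 1, q, z => z * hermC p q z - q / (2 * Real.pi) * hermC p (q - 1) z

theorem pi_ne_zero' : (Real.pi : ℂ) ≠ 0 := Complex.ofReal_ne_zero.2 Real.pi_ne_zero

theorem mul_hermC (p q : ℕ) (z : ℂ) :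
    z * hermC p q z = hermC (p + 1) q z + q / (2 * Real.pi) * hermC p (q - 1) z := by
  rw [hermC]; ring

/-- The definition of `hermC` is a recursion in `p`; this one in `q` restores the symmetry between
`z` and `z̄`. -/
theorem conj_mul_hermC (p q : ℕ) (z : ℂ) :
    conj z * hermC p q z = hermC p (q + 1) z + p / (2 * Real.pi) * hermC (p - 1) q z := by
  induction p generalizing q with
  | zero => simp [hermC]; ring
  | succ p ih =>
    have e1 : hermC (p + 1) (q + 1) z
        = z * hermC p (q + 1) z - (q + 1) / (2 * Real.pi) * hermC p q z := by
      rw [hermC]; simp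
    -- The recursions at lower indices are multiplied by `p` and by `q`, so that the truncated
    -- differences do no harm at `0`.
    have e2 : (p : ℂ) * hermC p q z
        = p * (z * hermC (p - 1) q z - q / (2 * Real.pi) * hermC (p - 1) (q - 1) z) := by
      rcases p with _ | p
      · simp
      · rw [hermC]; simp
    have e3 : (q : ℂ) * (conj z * hermC p (q - 1) z)
        = q * (hermC p q z + p / (2 * Real.pi) * hermC (p - 1) (q - 1) z) := by
      rcases q with _ | q
      · simp
      · rw [ih]; simp
    have e4 := ih q
    rw [e1, hermC]
    push_cast
    linear_combination z * e4 - 1 / (2 * Real.pi) * e3 - 1 / (2 * Real.pi) * e2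

/-- Apart from the derivative of the Gaussian, differentiation lowers one exponent: the polynomials
`e^{π|z|²} hermC p q` form an Appell sequence in each variable. -/
theorem hasWirt_hermC (p q : ℕ) (z : ℂ) :
    HasWirt (hermC p q) (p * hermC (p - 1) q z - Real.pi * conj z * hermC p q z)
      (q * hermC p (q - 1) z - Real.pi * z * hermC p q z) z := by
  induction p generalizing q with
  | zero =>
    have hexp : HasWirt (fun z : ℂ => Complex.exp (-Real.pi * (z * conj z)))
        (-Real.pi * conj z * Complex.exp (-Real.pi * (z * conj z)))
        (-Real.pi * z * Complex.exp (-Real.pi * (z * conj z))) z := by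
      have h1 := (hasWirt_id (τ := z)).mul hasWirt_conj
      have h2 := HasWirt.comp (f := fun z : ℂ => -Real.pi * (z * conj z)) (hasWirt_of_hasDerivAt
        (Complex.hasDerivAt_exp (-Real.pi * (z * conj z)))) (h1.const_mul (-Real.pi : ℂ))
      exact h2.congr (by simp) (by simp)
    have hpow : HasWirt (fun z : ℂ => conj z ^ q) 0 (q * conj z ^ (q - 1)) z :=
      ((hasWirt_of_hasDerivAt (hasDerivAt_pow q (conj z))).comp hasWirt_conj).congr
        (by simp) (by simp)
    refine (hpow.mul hexp).congr ?_ ?_ <;> simp only [hermC] <;> push_cast <;> ring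
  | succ p ih =>
    have h := ((hasWirt_id (τ := z)).mul (ih q)).sub ((ih (q - 1)).const_mul (q / (2 * Real.pi)))
    have e2 : (p : ℂ) * hermC p q z
        = p * (z * hermC (p - 1) q z - q / (2 * Real.pi) * hermC (p - 1) (q - 1) z) := by
      rcases p with _ | p
      · simp
      · rw [hermC]; simp
    have e5 : (q : ℂ) * hermC (p + 1) (q - 1) z
        = q * (z * hermC p (q - 1) z - (q - 1 : ℂ) / (2 * Real.pi) * hermC p (q - 1 - 1) z) := by
      rcases q with _ | q
      · simp
      · rw [hermC]; rcases q with _ | q <;> simp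
    -- Reconciles the truncated difference of the induction hypothesis with the difference in `ℂ`;
    -- the factor `q` covers `q = 0`.
    have e6 : (q : ℂ) * ((q - 1 : ℕ) : ℂ) = q * (q - 1) := by
      rcases q with _ | q <;> simp
    have e0 := mul_hermC p q z
    refine h.congr ?_ ?_
    · push_cast
      linear_combination -e2 - Real.pi * conj z * e0
    · linear_combination -e5 - Real.pi * z * e0 - (1 / (2 * Real.pi)) * hermC p (q - 1 - 1) z * e6

/-- The function `(½ (z - (2π)⁻¹ ∂/∂z))^p e^{-π z²}`. -/
def hermR : ℕ → ℂ → ℂ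
  | 0, z => Complex.exp (-Real.pi * z ^ 2)
  | 1, z => z * Complex.exp (-Real.pi * z ^ 2)
  | p + 2, z => z * hermR (p + 1) z - (p + 1) / (4 * Real.pi) * hermR p z

theorem mul_hermR (p : ℕ) (z : ℂ) :
    z * hermR p z = hermR (p + 1) z + p / (4 * Real.pi) * hermR (p - 1) z := by
  rcases p with _ | p
  · simp [hermR]
  · rw [hermR]; simp

theorem hasDerivAt_hermR (p : ℕ) (z : ℂ) :
    HasDerivAt (hermR p) (p * hermR (p - 1) z - 2 * Real.pi * z * hermR p z) z := by
  have hexp : HasDerivAt (fun z : ℂ => Complex.exp (-Real.pi * z ^ 2))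
      (-2 * Real.pi * z * Complex.exp (-Real.pi * z ^ 2)) z := by
    have h := ((hasDerivAt_pow 2 z).const_mul (-Real.pi : ℂ)).cexp
    exact h.congr_deriv (by push_cast; ring)
  induction p using Nat.twoStepInduction with
  | zero => exact hexp.congr_deriv (by simp [hermR])
  | one =>
    have h := (hasDerivAt_id' z).fun_mul hexp
    exact h.congr_deriv (by simp [hermR]; ring)
  | more p ih ih' =>
    have h := ((hasDerivAt_id' z).fun_mul ih').fun_sub
      (ih.const_mul ((p + 1) / (4 * Real.pi) : ℂ))
    have e := mul_hermR p z
    have e' := mul_hermR (p + 1) z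
    refine h.congr_deriv ?_
    simp only [Nat.add_sub_cancel, show p + 2 - 1 = p + 1 from rfl] at e' ⊢
    push_cast at e' ⊢
    linear_combination ((p : ℂ) + 1) * e - 2 * Real.pi * z * e'

theorem contDiff_hermC (p q : ℕ) : ContDiff ℝ 2 (hermC p q) := by
  induction p generalizing q with
  | zero =>
    have h : ContDiff ℝ 2 (fun z : ℂ => conj z) := (Complex.conjCLE : ℂ →L[ℝ] ℂ).contDiff
    show ContDiff ℝ 2 fun z : ℂ => conj z ^ q * Complex.exp (-Real.pi * (z * conj z))
    fun_prop
  | succ p ih =>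
    show ContDiff ℝ 2 fun z => z * hermC p q z - q / (2 * Real.pi) * hermC p (q - 1) z
    have h1 := ih q
    have h2 := ih (q - 1)
    fun_prop

theorem contDiff_hermR (p : ℕ) : ContDiff ℝ 2 (hermR p) := by
  induction p using Nat.twoStepInduction with
  | zero =>
    show ContDiff ℝ 2 fun z : ℂ => Complex.exp (-Real.pi * z ^ 2)
    fun_prop
  | one =>
    show ContDiff ℝ 2 fun z : ℂ => z * Complex.exp (-Real.pi * z ^ 2)
    fun_prop
  | more p ih ih' =>
    show ContDiff ℝ 2 fun z => z * hermR (p + 1) z - (p + 1) / (4 * Real.pi) * hermR p z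
    fun_prop

end Hermite

/-! ### Products over the coordinates -/

section Coordinates

variable {S E : Type*} [Fintype S] [NormedAddCommGroup E] [NormedSpace ℝ E] {n : ℕ}
  {H : S × Fin n → E → ℂ}

theorem contDiff_prod_coord (hH : ∀ k, ContDiff ℝ 2 (H k)) :
    ContDiff ℝ 2 fun x : S → Fin n → E => ∏ k, H k (x k.1 k.2) :=
  contDiff_prod fun k _ => (hH k).comp
    ((ContinuousLinearMap.proj (R := ℝ) (φ := fun _ : Fin n => E) k.2).comp
      (ContinuousLinearMap.proj (R := ℝ) (φ := fun _ : S => Fin n → E) k.1)).contDiff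

theorem fderiv_prod_coord [DecidableEq S] (hH : ∀ k, ContDiff ℝ 2 (H k)) (x : S → Fin n → E) (v : S) (j : Fin n)
    (h : E) :
    fderiv ℝ (fun x : S → Fin n → E => ∏ k, H k (x k.1 k.2)) x (Pi.single v (Pi.single j h))
      = (∏ k ∈ Finset.univ.erase (v, j), H k (x k.1 k.2)) * fderiv ℝ (H (v, j)) (x v j) h := by
  have hp : ∀ k : S × Fin n, HasFDerivAt (fun x : S → Fin n → E => H k (x k.1 k.2))
      ((fderiv ℝ (H k) (x k.1 k.2)).comp
        ((ContinuousLinearMap.proj (R := ℝ) (φ := fun _ : Fin n => E) k.2).comp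
          (ContinuousLinearMap.proj (R := ℝ) (φ := fun _ : S => Fin n → E) k.1))) x := fun k =>
    (((hH k).differentiable (by norm_num)) (x k.1 k.2)).hasFDerivAt.comp x
      ((ContinuousLinearMap.proj (R := ℝ) (φ := fun _ : Fin n => E) k.2).comp
        (ContinuousLinearMap.proj (R := ℝ) (φ := fun _ : S => Fin n → E) k.1)).hasFDerivAt
  rw [(HasFDerivAt.finsetProd (u := Finset.univ) fun k _ => hp k).fderiv, sum_apply,
    Finset.sum_eq_single (v, j)]
  · simp
  · intro k _ hk
    have : (Pi.single v (Pi.single j h) : S → Fin n → E) k.1 k.2 = 0 := by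
      by_cases hv : k.1 = v
      · have hj : k.2 ≠ j := fun e => hk (Prod.ext hv e)
        rw [hv, Pi.single_eq_same, Pi.single_eq_of_ne hj]
      · rw [Pi.single_eq_of_ne hv]; rfl
    simp [this]
  · simp

theorem prod_coord_split [DecidableEq S] (f : S × Fin n → ℂ) (v₀ : S) :
    ∏ k, f k = (∏ j, f (v₀, j)) * ∏ v ∈ Finset.univ.erase v₀, ∏ j, f (v, j) := by
  rw [Fintype.prod_prod_type, Finset.mul_prod_erase _ (fun v => ∏ j, f (v, j)) (Finset.mem_univ v₀)]

end Coordinates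

/-! ### The lowering operator -/

section Weil

variable {X W ι : Type*} [NormedAddCommGroup X] [NormedSpace ℝ X] [NormedAddCommGroup W]
  [NormedSpace ℝ W] [NormedSpace ℂ W] [Fintype ι]

/-- The operators only differentiate along the image of `incl`, so they can be computed on the
affine slice through the point. -/
theorem weilAction_slice {X' : Type*} [NormedAddCommGroup X'] [NormedSpace ℝ X'] (ε : ι → ℝ)
    (d : ι → X') (c : ι → X → ℝ) (c' : ι → X' → ℝ) (g : LieAlgebra.SpecialLinear.sl (Fin 2) ℂ)
    (incl : X' →L[ℝ] X) {φ : X → W} (hφ : ContDiff ℝ 2 φ) (x₀ : X) (w : X')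
    (hc : ∀ i, c i (x₀ + incl w) = c' i w) :
    weilAction ε (fun i => incl (d i)) c g φ (x₀ + incl w)
      = weilAction ε d c' g (fun w => φ (x₀ + incl w)) w := by
  have h1 : ∀ v, fderiv ℝ (fun w => φ (x₀ + incl w)) w v = fderiv ℝ φ (x₀ + incl w) (incl v) := by
    intro v
    have h := ((hφ.differentiable (by norm_num)) (x₀ + incl w)).hasFDerivAt.comp w
      (incl.hasFDerivAt.const_add x₀)
    rw [show (fun w => φ (x₀ + incl w)) = φ ∘ fun w => x₀ + incl w from rfl, h.fderiv]
    rfl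
  have h2 : ∀ v, iteratedFDeriv ℝ 2 (fun w => φ (x₀ + incl w)) w ![v, v]
      = iteratedFDeriv ℝ 2 φ (x₀ + incl w) ![incl v, incl v] := by
    intro v
    have hs : ContDiff ℝ 2 fun y => φ (x₀ + y) := hφ.comp (contDiff_const.add contDiff_id)
    have h := incl.iteratedFDeriv_comp_right hs w (i := 2) le_rfl
    rw [show (fun w => φ (x₀ + incl w)) = (fun y => φ (x₀ + y)) ∘ incl from rfl, h,
      iteratedFDeriv_comp_add_left]
    rw [ContinuousMultilinearMap.compContinuousLinearMap_apply]
    congr 1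
    ext i
    fin_cases i <;> rfl
  simp only [weilAction, hc, h1, h2]

/-- When `Φ` is differentiated in linear forms `ζ a`, the first order term only involves their
values at the point and the second order term only the dual Gram matrix `∑ ε i ζ a (d i) ζ a' (d
i)`. This permits coordinates adapted to a point of the disc. -/
theorem weilAction_lowering [SMulCommClass ℝ ℂ W] [IsScalarTower ℝ ℂ W] {A : Type*} [Fintype A]
    (ε : ι → ℝ) (d : ι → X) (c : ι → X → ℝ) (ζ : A → X →L[ℝ] ℂ) {Φ : X → ℂ} {Φ₁ : A → X → ℂ}
    {Φ₂ : A → A → ℂ} {x : X} (T : W)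
    (h₁ : ∀ y, HasFDerivAt Φ (∑ a, Φ₁ a y • ζ a) y)
    (h₂ : ∀ a, HasFDerivAt (Φ₁ a) (∑ a', Φ₂ a a' • ζ a') x) :
    weilAction ε d c lowering (fun y => Φ y • T) x
      = (1 / 2 * ((Fintype.card ι : ℂ) / 2 * Φ x + ∑ a, (∑ i, (c i x : ℂ) * ζ a (d i)) * Φ₁ a x)
        + Real.pi / 2 * (∑ i, (ε i : ℂ) * (c i x : ℂ) ^ 2) * Φ x
        + 1 / (8 * Real.pi) * ∑ a, ∑ a', (∑ i, (ε i : ℂ) * (ζ a (d i) * ζ a' (d i))) * Φ₂ a a')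
        • T := by
  have hf : ∀ y, HasFDerivAt (fun y => Φ y • T) ((∑ a, Φ₁ a y • ζ a).smulRight T) y :=
    fun y => (h₁ y).smul_const T
  have hfd : fderiv ℝ (fun y => Φ y • T) = fun y => (∑ a, Φ₁ a y • ζ a).smulRight T :=
    funext fun y => (hf y).fderiv
  have hsec : ∀ v, iteratedFDeriv ℝ 2 (fun y => Φ y • T) x ![v, v]
      = (∑ a, ∑ a', ζ a v * ζ a' v * Φ₂ a a') • T := by
    intro v
    have hd : HasFDerivAt (fun y => (∑ a, Φ₁ a y • ζ a)) (∑ a,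
        (∑ a', Φ₂ a a' • ζ a').smulRight (ζ a)) x :=
      HasFDerivAt.fun_sum fun a _ => (h₂ a).smul_const (ζ a)
    have hdiff : DifferentiableAt ℝ (fun y => (∑ a, Φ₁ a y • ζ a).smulRight T) x := by
      have h3 : (fun y => (∑ a, Φ₁ a y • ζ a).smulRight T) = fun y =>
          ((ContinuousLinearMap.lsmul ℝ ℂ : ℂ →L[ℝ] W →L[ℝ] W).flip T).comp
            (∑ a, Φ₁ a y • ζ a) := by
        ext y w
        simp [Finset.sum_smul]
      rw [h3]
      exact (differentiableAt_const _).clm_comp hd.differentiableAt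
    rw [iteratedFDeriv_two_apply, hfd]
    simp only [Matrix.cons_val_zero, Matrix.cons_val_one]
    have h4 : HasFDerivAt (fun y => (∑ a, Φ₁ a y • ζ a).smulRight T v)
        ((∑ a, ζ a v • (∑ a', Φ₂ a a' • ζ a')).smulRight T) x := by
      have h5 : (fun y => (∑ a, Φ₁ a y • ζ a).smulRight T v)
          = fun y => (∑ a, ζ a v • Φ₁ a y) • T := by
        ext y
        simp [mul_comm]
      rw [h5]
      exact (HasFDerivAt.fun_sum fun a _ => (h₂ a).const_smul (ζ a v)).smul_const T
    have h6 := h4.fderiv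
    rw [fderiv_clm_apply hdiff (differentiableAt_const v)] at h6
    have h7 := congrArg (fun l : X →L[ℝ] W => l v) h6
    simp only [fderiv_fun_const] at h7
    simp at h7
    rw [h7]
    congr 1
    simp only [Finset.mul_sum]
    exact Finset.sum_congr rfl fun _ _ => Finset.sum_congr rfl fun _ _ => by ring
  have hfst : ∀ v, fderiv ℝ (fun y => Φ y • T) x v = (∑ a, ζ a v * Φ₁ a x) • T := by
    intro v
    rw [hfd]
    simp [mul_comm]
  unfold weilAction
  simp only [hfst, hsec, lowering]
  simp only [Matrix.of_apply, Matrix.cons_val_zero, Matrix.cons_val_one, Matrix.cons_val',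
    Matrix.cons_val_fin_one, smul_smul, ← Finset.sum_smul, ← add_smul]
  congr 1
  have s1 : ∑ i, (c i x : ℂ) * ∑ a, ζ a (d i) * Φ₁ a x
      = ∑ a, (∑ i, (c i x : ℂ) * ζ a (d i)) * Φ₁ a x := by
    simp only [Finset.mul_sum, Finset.sum_mul]
    rw [Finset.sum_comm]
    exact Finset.sum_congr rfl fun _ _ => Finset.sum_congr rfl fun _ _ => by ring
  have s2 : ∑ i, (ε i : ℂ) * ∑ a, ∑ a', ζ a (d i) * ζ a' (d i) * Φ₂ a a'
      = ∑ a, ∑ a', (∑ i, (ε i : ℂ) * (ζ a (d i) * ζ a' (d i))) * Φ₂ a a' := by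
    simp only [Finset.mul_sum, Finset.sum_mul]
    rw [Finset.sum_comm]
    refine Finset.sum_congr rfl fun _ _ => ?_
    rw [Finset.sum_comm]
    exact Finset.sum_congr rfl fun _ _ => Finset.sum_congr rfl fun _ _ => by ring
  rw [s1, s2]
  -- The constants come from the entries `-i/2` of the lowering operator: `(-i/2) πi = π/2` and
  -- `(-i/2) i/(4π) = 1/(8π)`.
  linear_combination (-(Real.pi : ℂ) / 2 * (∑ i, (ε i : ℂ) * (c i x : ℂ) ^ 2) * Φ x
    - 1 / (8 * Real.pi) * ∑ a, ∑ a', (∑ i, (ε i : ℂ) * (ζ a (d i) * ζ a' (d i))) * Φ₂ a a')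
    * Complex.I_sq

end Weil

end FunkeMillson
end

noncomputable section

namespace FunkeMillson

namespace Unitary

open scoped ComplexConjugate

variable {S : Type*} [Fintype S]

/-! ### The Schwartz functions of the unitary case -/

/-- The product of Hermite functions with exponents `P`. -/
def hermite (P : S × Bool → Fin 2 → ℕ) (x : Space S) : ℂ :=
  ∏ k : S × Fin 2, hermC (P (k.1, false) k.2) (P (k.1, true) k.2) (x k.1 k.2)

theorem gaussian_eq : gaussian (S := S) = hermite 0 := by
  ext x
  simp [gaussian, hermite, Fintype.prod_prod_type, hermC, coord, emb]

theorem contDiff_hermite (P : S × Bool → Fin 2 → ℕ) : ContDiff ℝ 2 (hermite P) :=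
  contDiff_prod_coord (H := fun k : S × Fin 2 => hermC (P (k.1, false) k.2) (P (k.1, true) k.2))
    fun _ => contDiff_hermC _ _

variable [DecidableEq S]

theorem raise_const_mul (u : S × Bool) (j : Fin 2) (c : ℂ) {f : Space S → ℂ}
    (hf : Differentiable ℝ f) : raise u j (fun y => c * f y) = fun y => c * raise u j f y := by
  ext x
  simp only [raise, dz, fderiv_const_mul (hf x), smul_apply, smul_eq_mul]
  ring

/-- Only the factor at `(v, j)` is affected. There the derivative of the Gaussian doubles the term
with the coordinate, and what remains is the recursion defining `hermC`, or `conj_mul_hermC` for a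
conjugate embedding. -/
theorem raise_hermite (u : S × Bool) (j : Fin 2) (P : S × Bool → Fin 2 → ℕ) :
    raise u j (hermite P) = hermite (P + Pi.single u (Pi.single j 1)) := by
  ext x
  obtain ⟨v, e⟩ := u
  let Δ : S × Bool → Fin 2 → ℕ := Pi.single (v, e) (Pi.single j 1)
  let H : S × Fin 2 → ℂ → ℂ := fun k => hermC (P (k.1, false) k.2) (P (k.1, true) k.2)
  let C : ℂ := ∏ k ∈ Finset.univ.erase (v, j), H k (x k.1 k.2)
  have hd : ∀ h : ℂ, fderiv ℝ (hermite P) x (Pi.single v (Pi.single j h))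
      = C * fderiv ℝ (H (v, j)) (x v j) h := fun h =>
    fderiv_prod_coord (H := H) (fun _ => contDiff_hermC _ _) x v j h
  have hw := hasWirt_hermC (P (v, false) j) (P (v, true) j) (x v j)
  have hf : hermite P x = C * H (v, j) (x v j) :=
    (Finset.prod_erase_mul _ _ (Finset.mem_univ (v, j))).symm
  have hr : hermite (P + Δ) x = C *
      hermC ((P + Δ) (v, false) j)
        ((P + Δ) (v, true) j) (x v j) := by
    rw [hermite, ← Finset.prod_erase_mul _ _ (Finset.mem_univ (v, j))]
    congr 1
    refine Finset.prod_congr rfl fun k hk => ?_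
    have hk' := Finset.ne_of_mem_erase hk
    have h0 : ∀ e', (P + Δ) (k.1, e') k.2 = P (k.1, e') k.2 := by
      intro e'
      by_cases h1 : k.1 = v
      · have h2 : k.2 ≠ j := fun h2 => hk' (Prod.ext h1 h2)
        by_cases h3 : e' = e
        · rw [h1, h3]; simp [Δ, Pi.single_eq_of_ne h2]
        · simp [Δ, Pi.single_eq_of_ne (show (k.1, e') ≠ (v, e) from fun h => h3 (congrArg Prod.snd h))]
      · simp [Δ, Pi.single_eq_of_ne (show (k.1, e') ≠ (v, e) from fun h => h1 (congrArg Prod.fst h))]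
    rw [h0, h0]
  have hfd : ∀ h : ℂ, fderiv ℝ (H (v, j)) (x v j) h = _ := fun h => by
    rw [HasFDerivAt.fderiv hw, wirt_apply]
  show _ = hermite (P + Δ) x
  simp only [raise, dz, bar, hd, hfd, hf, hr, smul_eq_mul, map_one, Complex.conj_I]
  simp only [H]
  cases e
  · have e1 := mul_hermC (P (v, false) j) (P (v, true) j) (x v j)
    simp [emb, coord, Δ]
    field_simp [pi_ne_zero'] at e1 ⊢
    ring_nf at e1 ⊢
    simp only [Complex.I_sq]
    linear_combination (2 * C) * e1
  · have e1 := conj_mul_hermC (P (v, false) j) (P (v, true) j) (x v j)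
    simp [emb, coord, Δ]
    field_simp [pi_ne_zero'] at e1 ⊢
    ring_nf at e1 ⊢
    simp only [Complex.I_sq]
    linear_combination (2 * C) * e1

/-- The multi-indices that occur in `ν_b` and `φ_b`: only `e_1` occurs at `v₀`. -/
def Good (v₀ : S) {b : S × Bool → ℕ} (m : Idx 2 b) : Prop :=
  ∀ u k, ¬ (u.1 = v₀ ∧ m u k = 1)

open Classical in
theorem weighted_hermite (v₀ : S) (b : S × Bool → ℕ) (c : ℂ) (P : S × Bool → Fin 2 → ℕ)
    (x : Space S) (m : Idx 2 b) :
    weighted (raiseE v₀) b (fun y => c * hermite P y) x m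
      = if Good v₀ m then c * hermite (P + multiplicity m) x else 0 := by
  have h := weighted_eq (R := raiseE v₀) (G := fun P y => c * hermite P y)
    (ok := fun u j => ¬ (u.1 = v₀ ∧ j = 1)) ?_ ?_ ?_ b P x m
  · split_ifs with hm
    · exact h.1 hm
    · exact h.2 hm
  · intro u j P h
    ext y
    rw [raiseE, if_neg h, raise_const_mul _ _ _ ((contDiff_hermite P).differentiable (by norm_num)),
      raise_hermite]
  · intro u j f h
    ext y
    rw [raiseE, if_pos (not_not.1 h)]
  · intro u j
    ext y
    rw [raiseE]
    split_ifs
    · rfl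
    · have h0 : fderiv ℝ (0 : Space S → ℂ) = 0 := fderiv_zero
      simp [raise, dz, h0]

/-- The contribution of the places different from `v₀`. -/
def away (v₀ : S) {b : S × Bool → ℕ} (m : Idx 2 b) (x : Space S) : ℂ :=
  ∏ v ∈ Finset.univ.erase v₀, ∏ j,
    hermC (multiplicity m (v, false) j) (multiplicity m (v, true) j) (x v j)

/-- In a good multi-index all spots above `v₀` carry `e_1`, so the factor at `v₀` does not depend on
`m`. The shift `k` is `0` for `ν_b` and `1` for `φ_b`. -/
theorem hermite_update (v₀ : S) {b : S × Bool → ℕ} {m : Idx 2 b} (hm : Good v₀ m) (k : ℕ)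
    (x : Space S) (w : Fin 2 → ℂ) :
    hermite (Pi.single (v₀, false) (Pi.single 0 k) + Pi.single (v₀, true) (Pi.single 0 k)
        + multiplicity m) (Function.update x v₀ w)
      = hermC (b (v₀, false) + k) (b (v₀, true) + k) (w 0) * hermC 0 0 (w 1) * away v₀ m x := by
  have h0 : ∀ e, multiplicity m (v₀, e) 0 = b (v₀, e) := by
    intro e
    rw [multiplicity_apply, Finset.sum_congr rfl fun k _ => if_pos ?_]
    · simp
    · have h2 : ∀ i : Fin 2, ¬ i = 1 → i = 0 := by decide
      exact h2 _ fun h => hm (v₀, e) k ⟨rfl, h⟩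
  have h1 : ∀ e, multiplicity m (v₀, e) 1 = 0 := by
    intro e
    rw [multiplicity_apply, Finset.sum_congr rfl fun k _ => if_neg ?_]
    · simp
    · exact fun h => hm (v₀, e) k ⟨rfl, h⟩
  rw [hermite, prod_coord_split _ v₀, Fin.prod_univ_two, away]
  congr 1
  · simp [h0, h1, add_comm]
  · refine Finset.prod_congr rfl fun v hv => Finset.prod_congr rfl fun j _ => ?_
    have hv' := Finset.ne_of_mem_erase hv
    simp [hv']

end Unitary

end FunkeMillson
end

noncomputable section

namespace FunkeMillson

/-! ### Derivatives in terms of raised Hermite functions; the normalizing factor of the boost. -/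

open scoped ComplexConjugate

/-- Lowered terms are traded for raised ones, because `DD^c ν_b` is to be compared with `φ_b`, whose
exponents are raised. -/
theorem hasWirt_hermC' (p q : ℕ) (z : ℂ) :
    HasWirt (hermC p q) (Real.pi * (conj z * hermC p q z - 2 * hermC p (q + 1) z))
      (Real.pi * (z * hermC p q z - 2 * hermC (p + 1) q z)) z := by
  refine (hasWirt_hermC p q z).congr ?_ ?_
  · have h := conj_mul_hermC p q z
    field_simp [pi_ne_zero'] at h ⊢
    linear_combination -h
  · have h := mul_hermC p q z
    field_simp [pi_ne_zero'] at h ⊢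
    linear_combination -h

/-- The inverse of `√(1 - |σ|²)`. -/
def rho (σ : ℂ) : ℂ := (Real.sqrt (1 - ‖σ‖ ^ 2) : ℂ)⁻¹

variable {σ : ℂ}

theorem conj_rho (σ : ℂ) : conj (rho σ) = rho σ := by
  rw [rho, map_inv₀, Complex.conj_ofReal]

theorem rho_sq (hσ : ‖σ‖ < 1) : rho σ ^ 2 * (1 - σ * conj σ) = 1 := by
  have h : 0 < 1 - ‖σ‖ ^ 2 := by nlinarith [norm_nonneg σ]
  have h1 : (Real.sqrt (1 - ‖σ‖ ^ 2) : ℂ) ^ 2 = 1 - σ * conj σ := by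
    rw [Complex.mul_conj, Complex.normSq_eq_norm_sq, ← Complex.ofReal_pow, Real.sq_sqrt h.le]
    push_cast
    ring
  have h2 : (Real.sqrt (1 - ‖σ‖ ^ 2) : ℂ) ≠ 0 :=
    Complex.ofReal_ne_zero.2 (Real.sqrt_pos.2 h).ne'
  rw [rho, ← h1, inv_pow, inv_mul_cancel₀ (pow_ne_zero _ h2)]

theorem hasWirt_rho (hσ : ‖σ‖ < 1) :
    HasWirt rho (conj σ * rho σ ^ 3 / 2) (σ * rho σ ^ 3 / 2) σ := by
  have h : 0 < 1 - ‖σ‖ ^ 2 := by nlinarith [norm_nonneg σ]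
  have h1 : HasFDerivAt (fun σ : ℂ => 1 - ‖σ‖ ^ 2) (-(2 • innerSL ℝ σ)) σ :=
    (hasStrictFDerivAt_norm_sq σ).hasFDerivAt.const_sub 1
  have h2 := (Real.hasDerivAt_sqrt h.ne').inv (Real.sqrt_pos.2 h).ne'
  have h3 := Complex.ofRealCLM.hasFDerivAt.comp σ (h2.comp_hasFDerivAt σ h1)
  have h4 : (Complex.ofRealCLM ∘ fun σ : ℂ => (Real.sqrt (1 - ‖σ‖ ^ 2))⁻¹) = rho := by
    ext w
    simp [rho]
  refine hasWirt_of_hasFDerivAt (L := _) (h4 ▸ h3) fun v => ?_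
  have h5 : ((inner ℝ σ v : ℝ) : ℂ) = (conj σ * v + σ * conj v) / 2 := by
    rw [Complex.inner, Complex.re_eq_add_conj]
    simp [mul_comm]
  have h6 : (Real.sqrt (1 - ‖σ‖ ^ 2) : ℂ) ≠ 0 :=
    Complex.ofReal_ne_zero.2 (Real.sqrt_pos.2 h).ne'
  simp only [ContinuousLinearMap.comp_apply, smul_apply, Complex.ofRealCLM_apply,
    neg_apply, innerSL_apply_apply, smul_eq_mul, nsmul_eq_mul]
  push_cast
  rw [h5, rho]
  field_simp

namespace Unitary

/-! ### The moving frame of the unitary case -/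

theorem boost_eq (σ : ℂ) : boost σ = !![rho σ, σ * rho σ; conj σ * rho σ, rho σ] := by
  ext i j
  fin_cases i <;> fin_cases j <;> simp [boost, rho, mul_comm]

theorem rho_eq_zero (hσ : ¬ ‖σ‖ < 1) : rho σ = 0 := by
  have h : 1 - ‖σ‖ ^ 2 ≤ 0 := by nlinarith [norm_nonneg σ]
  rw [rho, Real.sqrt_eq_zero_of_nonpos h, Complex.ofReal_zero, inv_zero]

/-- Outside the disc `rho` is zero and both sides are the zero matrix. Validity for all `σ` makes
`nu_eq` an equality of functions. -/
theorem boost_inv (σ : ℂ) :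
    (boost σ)⁻¹ = !![rho σ, -σ * rho σ; -conj σ * rho σ, rho σ] := by
  by_cases hσ : ‖σ‖ < 1
  · refine Matrix.inv_eq_right_inv ?_
    have h := rho_sq hσ
    rw [boost_eq]
    ext i j
    fin_cases i <;> fin_cases j <;> simp [Matrix.mul_apply, Fin.sum_univ_two] <;>
      first | linear_combination h | ring
  · have h : (!![0, 0; 0, 0] : Matrix (Fin 2) (Fin 2) ℂ) = 0 := by
      ext i j
      fin_cases i <;> fin_cases j <;> rfl
    simp [boost_eq, rho_eq_zero hσ, h]

theorem boost_mul_inv (hσ : ‖σ‖ < 1) : boost σ * (boost σ)⁻¹ = 1 := by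
  have h := rho_sq hσ
  rw [boost_inv, boost_eq]
  ext i j
  fin_cases i <;> fin_cases j <;> simp [Matrix.mul_apply, Fin.sum_univ_two] <;>
    first | linear_combination h | ring

/-- The first coordinate of the translate of `w` to the base point. -/
def posCoord (w : Fin 2 → ℂ) (σ : ℂ) : ℂ := rho σ * (w 0 - σ * w 1)

/-- The second coordinate of the translate of `w` to the base point. -/
def negCoord (w : Fin 2 → ℂ) (σ : ℂ) : ℂ := rho σ * (w 1 - conj σ * w 0)

theorem boost_inv_mulVec (σ : ℂ) (w : Fin 2 → ℂ) :
    (boost σ)⁻¹.mulVec w = ![posCoord w σ, negCoord w σ] := by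
  rw [boost_inv]
  ext i
  fin_cases i <;> simp [Matrix.mulVec, dotProduct, Fin.sum_univ_two, posCoord, negCoord] <;> ring

/-- With `hasWirt_negCoord`, these are the structure equations of the boost: each coordinate
differentiates into the other, and the diagonal terms form a connection. -/
theorem hasWirt_posCoord (hσ : ‖σ‖ < 1) (w : Fin 2 → ℂ) : HasWirt (posCoord w)
    (-rho σ ^ 2 * negCoord w σ - conj σ * rho σ ^ 2 / 2 * posCoord w σ)
    (σ * rho σ ^ 2 / 2 * posCoord w σ) σ := by
  have h := (hasWirt_rho hσ).mul ((hasWirt_const (w 0)).sub (hasWirt_id.mul (hasWirt_const (w 1))))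
  refine h.congr ?_ ?_ <;> simp only [posCoord, negCoord]
  · linear_combination (rho σ * w 1) * rho_sq hσ
  · ring

theorem hasWirt_negCoord (hσ : ‖σ‖ < 1) (w : Fin 2 → ℂ) : HasWirt (negCoord w)
    (conj σ * rho σ ^ 2 / 2 * negCoord w σ)
    (-rho σ ^ 2 * posCoord w σ - σ * rho σ ^ 2 / 2 * negCoord w σ) σ := by
  have h := (hasWirt_rho hσ).mul
    ((hasWirt_const (w 1)).sub (hasWirt_conj.mul (hasWirt_const (w 0))))
  refine h.congr ?_ ?_ <;> simp only [posCoord, negCoord]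
  · ring
  · linear_combination (rho σ * w 0) * rho_sq hσ

/-- The translate of `e_1`. -/
def posVec (σ : ℂ) : Fin 2 → ℂ := ![rho σ, conj σ * rho σ]

/-- The translate of `e_2`. -/
def negVec (σ : ℂ) : Fin 2 → ℂ := ![σ * rho σ, rho σ]

/-- Up to the factor `rho` the translate of `e_1` is antiholomorphic, so its component along the
negative line appears with `dτ̄` only, in accordance with the type `(1,-1)` of that line. -/
theorem hasWirt_posVec (hσ : ‖σ‖ < 1) : HasWirt posVec ((conj σ * rho σ ^ 2 / 2) • posVec σ)
    (-(σ * rho σ ^ 2 / 2) • posVec σ + rho σ ^ 2 • negVec σ) σ := by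
  refine hasWirt_pi fun i => ?_
  fin_cases i
  · refine (hasWirt_rho hσ).congr ?_ ?_ <;> simp [posVec, negVec] <;> ring
  · refine (hasWirt_conj.mul (hasWirt_rho hσ)).congr ?_ ?_ <;> simp [posVec, negVec]
    · ring
    · linear_combination (-rho σ) * rho_sq hσ

/-- The factor `rho σ ^ 2` makes the connection coefficient equal to that of `posVec`, as a moving
frame requires. -/
theorem hasWirt_negVec (hσ : ‖σ‖ < 1) : HasWirt (fun σ => rho σ ^ 2 • negVec σ)
    ((conj σ * rho σ ^ 2 / 2) • (rho σ ^ 2 • negVec σ) + rho σ ^ 4 • posVec σ)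
    ((3 / 2 * σ * rho σ ^ 4) • negVec σ) σ := by
  have h2 := (hasWirt_rho hσ).mul (hasWirt_rho hσ)
  refine hasWirt_pi fun i => ?_
  fin_cases i
  · have h := h2.mul (hasWirt_id.mul (hasWirt_rho hσ))
    refine HasWirt.congr (f := fun σ => rho σ ^ 2 * (σ * rho σ)) ?_ rfl rfl
    simp only [sq]
    refine h.congr ?_ ?_ <;> simp [posVec, negVec]
    · linear_combination (-rho σ ^ 3) * rho_sq hσ
    · ring
  · have h := h2.mul (hasWirt_rho hσ)
    refine HasWirt.congr (f := fun σ => rho σ ^ 2 * rho σ) ?_ rfl rfl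
    simp only [sq]
    refine h.congr ?_ ?_ <;> simp [posVec, negVec] <;> ring

theorem HasWirt.starPi {n : ℕ} {f : ℂ → Fin n → ℂ} {a a' : Fin n → ℂ} (hf : HasWirt f a a' σ) :
    HasWirt (fun σ i => conj (f σ i)) (fun i => conj (a' i)) (fun i => conj (a i)) σ :=
  hasWirt_pi fun i => HasWirt.star <|
    hasWirt_of_hasFDerivAt (hasFDerivAt_pi'.1 hf i) fun v => by simp [wirt_apply]

end Unitary

end FunkeMillson
end

noncomputable section

namespace FunkeMillson

open scoped ComplexConjugate

set_option linter.unusedSectionVars false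

theorem sum_spot {U : Type*} [Fintype U] {b : U → ℕ} (f : U → ℂ) :
    ∑ s : Spot b, f s.1 = ∑ u, b u * f u := by
  simp [Fintype.sum_sigma]

/-! ### The moving frame of `T_b` in the unitary case. -/

namespace Unitary

variable {S : Type*} [Fintype S] [DecidableEq S] {v₀ : S} {b : S × Bool → ℕ} {m : Idx 2 b} {σ : ℂ}

theorem true_ne_false (v₀ : S) : (v₀, true) ≠ (v₀, false) := by simp

/-- The function on the labels with values `a` and `c` at the two embeddings above `v₀`. -/
def pairVal (v₀ : S) (a c : ℂ) (u : S × Bool) : ℂ :=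
  if u = (v₀, false) then a else if u = (v₀, true) then c else 0

theorem pairVal_false (a c : ℂ) : pairVal v₀ a c (v₀, false) = a := by simp [pairVal]

theorem pairVal_true (a c : ℂ) : pairVal v₀ a c (v₀, true) = c := by simp [pairVal]

theorem pairVal_of_ne {u : S × Bool} (hu : u.1 ≠ v₀) (a c : ℂ) : pairVal v₀ a c u = 0 := by
  have h1 : ∀ e, u ≠ (v₀, e) := fun e h => hu (by rw [h])
  simp [pairVal, h1]

theorem sum_pairVal (a c : ℂ) :
    ∑ s : Spot b, pairVal v₀ a c s.1 = b (v₀, false) * a + b (v₀, true) * c := by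
  rw [sum_spot, Fintype.sum_eq_add (v₀, false) (v₀, true) (by simp)]
  · rw [pairVal_false, pairVal_true]
  · rintro u ⟨h1, h2⟩
    simp [pairVal, h1, h2]

theorem label_cases (v₀ : S) (u : S × Bool) : u = (v₀, false) ∨ u = (v₀, true) ∨ u.1 ≠ v₀ := by
  obtain ⟨v, e⟩ := u
  by_cases h : v = v₀
  · subst h; cases e <;> simp
  · simp [h]

/-- The translates of the basis vectors prescribed by `m`. -/
def frameVec (v₀ : S) (m : Idx 2 b) (σ : ℂ) (s : Spot b) (i : Fin 2) : ℂ :=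
  boostAt v₀ s.1 σ i (m s.1 s.2)

/-- The derivative of `posVec` in the direction of the negative line, at the spots of `u₀`. -/
def negAt (v₀ : S) (σ : ℂ) (u : S × Bool) : Fin 2 → ℂ :=
  if u = (v₀, false) then rho σ ^ 2 • negVec σ else 0

/-- The complex conjugate of `negAt`, at the spots of `ū₀`. -/
def negAtBar (v₀ : S) (σ : ℂ) (u : S × Bool) : Fin 2 → ℂ :=
  if u = (v₀, true) then fun i => conj ((rho σ ^ 2 • negVec σ) i) else 0

theorem Good.eq_zero (hm : Good v₀ m) (e : Bool) (k : Fin (b (v₀, e))) : m (v₀, e) k = 0 := by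
  have h2 : ∀ i : Fin 2, ¬ i = 1 → i = 0 := by decide
  exact h2 _ fun h => hm (v₀, e) k ⟨rfl, h⟩

theorem frameVec_false (hm : Good v₀ m) (σ : ℂ) (k : Fin (b (v₀, false))) :
    frameVec v₀ m σ ⟨(v₀, false), k⟩ = posVec σ := by
  ext i
  fin_cases i <;> simp [frameVec, hm.eq_zero false k, boostAt, boost_eq, posVec]

theorem frameVec_true (hm : Good v₀ m) (σ : ℂ) (k : Fin (b (v₀, true))) :
    frameVec v₀ m σ ⟨(v₀, true), k⟩ = fun i => conj (posVec σ i) := by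
  ext i
  fin_cases i <;> simp [frameVec, hm.eq_zero true k, boostAt, boost_eq, posVec]

theorem frameVec_of_ne {s : Spot b} (hs : s.1.1 ≠ v₀) (σ : ℂ) :
    frameVec v₀ m σ s = Pi.single (m s.1 s.2) 1 := by
  have h1 : ∀ e, s.1 ≠ (v₀, e) := fun e h => hs (by rw [h])
  ext i
  simp [frameVec, boostAt, h1, Matrix.one_apply, Pi.single_apply]

theorem boostAt_false (σ : ℂ) : boostAt v₀ (v₀, false) σ = boost σ := by simp [boostAt]

theorem boostAt_true (σ : ℂ) : boostAt v₀ (v₀, true) σ = (boost σ).map conj := by simp [boostAt]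

theorem boostAt_of_ne {u : S × Bool} (hu : u.1 ≠ v₀) (σ : ℂ) : boostAt v₀ u σ = 1 := by
  have h1 : ∀ e, u ≠ (v₀, e) := fun e h => hu (by rw [h])
  simp [boostAt, h1]

theorem boostAt_mul_inv (hσ : ‖σ‖ < 1) (u : S × Bool) :
    boostAt v₀ u σ * (boostAt v₀ u σ)⁻¹ = 1 := by
  rcases label_cases v₀ u with rfl | rfl | h
  · rw [boostAt_false, boost_mul_inv hσ]
  · have h1 := congrArg (fun M => M.map (starRingEnd ℂ)) (boost_mul_inv hσ)
    have h2 : (boost σ).map conj * (boost σ)⁻¹.map conj = 1 := by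
      rw [← Matrix.map_mul, boost_mul_inv hσ, Matrix.map_one _ (map_zero _) (map_one _)]
    rw [boostAt_true, Matrix.inv_eq_right_inv h2, h2]
  · rw [boostAt_of_ne h]; simp

theorem wt_false (j : Fin 2) : wt v₀ (v₀, false) j = if j = 1 then 1 else 0 := by simp [wt]

theorem wt_true (j : Fin 2) : wt v₀ (v₀, true) j = if j = 1 then -1 else 0 := by simp [wt]

theorem wt_of_ne {u : S × Bool} (hu : u.1 ≠ v₀) (j : Fin 2) : wt v₀ u j = 0 := by
  have h1 : ∀ e, u ≠ (v₀, e) := fun e h => hu (by rw [h])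
  simp [wt, h1]

theorem vecType_frameVec (hm : Good v₀ m) (hσ : ‖σ‖ < 1) (s : Spot b) :
    VecType (boostAt v₀) (wt v₀) σ s.1 0 (frameVec v₀ m σ s) := by
  refine VecType.of_mulVec (boostAt_mul_inv hσ _) (x := Pi.single (m s.1 s.2) 1) ?_ fun j hj => ?_
  · ext i
    simp [frameVec]
  · obtain ⟨u, k⟩ := s
    rcases label_cases v₀ u with rfl | rfl | h
    · rw [hm.eq_zero]
      refine Pi.single_eq_of_ne (fun h => hj ?_) _
      simp [h, wt_false]
    · rw [hm.eq_zero]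
      refine Pi.single_eq_of_ne (fun h => hj ?_) _
      simp [h, wt_true]
    · exact absurd (wt_of_ne h j) hj

theorem vecType_negAt (hσ : ‖σ‖ < 1) (u : S × Bool) :
    VecType (boostAt v₀) (wt v₀) σ u 1 (negAt v₀ σ u) := by
  rw [negAt]
  split_ifs with h
  · subst h
    refine VecType.smul (VecType.of_mulVec (boostAt_mul_inv hσ _) (x := Pi.single 1 1) ?_
      fun j hj => ?_) _
    · ext i
      fin_cases i <;> simp [boostAt_false, boost_eq, negVec]
    · refine Pi.single_eq_of_ne (fun h => hj ?_) _
      simp [h, wt_false]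
  · exact VecType.zero

theorem vecType_negAtBar (hσ : ‖σ‖ < 1) (u : S × Bool) :
    VecType (boostAt v₀) (wt v₀) σ u (-1) (negAtBar v₀ σ u) := by
  rw [negAtBar]
  split_ifs with h
  · subst h
    refine VecType.of_mulVec (boostAt_mul_inv hσ _) (x := Pi.single 1 (rho σ ^ 2)) ?_
      fun j hj => ?_
    · ext i
      fin_cases i <;> simp [boostAt_true, boost_eq, negVec, conj_rho] <;> ring
    · refine Pi.single_eq_of_ne (fun h => hj ?_) _
      simp [h, wt_true]
  · exact VecType.zero

theorem negAt_false : negAt v₀ σ (v₀, false) = rho σ ^ 2 • negVec σ := if_pos rfl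

theorem negAt_of_ne {u : S × Bool} (hu : u ≠ (v₀, false)) : negAt v₀ σ u = 0 := if_neg hu

theorem negAtBar_true : negAtBar v₀ σ (v₀, true) = fun i => conj ((rho σ ^ 2 • negVec σ) i) :=
  if_pos rfl

theorem negAtBar_of_ne {u : S × Bool} (hu : u ≠ (v₀, true)) : negAtBar v₀ σ u = 0 := if_neg hu

/-- The coefficient of `ν_b` at `m`, up to a factor that only depends on the component at `v₀`. -/
def coeff (v₀ : S) (m : Idx 2 b) (x : Space S) : ℂ :=
  open Classical in if Good v₀ m then away v₀ m x else 0

theorem good_of_coeff {x : Space S} (h : coeff v₀ m x ≠ 0) : Good v₀ m := by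
  by_contra h'
  exact h (if_neg h')

/-- The section to which `ν_b` and the coefficients of `φ_b` are proportional. -/
def sect (v₀ : S) (b : S × Bool → ℕ) (x : Space S) (σ : ℂ) : Tens 2 b :=
  ∑ m : Idx 2 b, coeff v₀ m x • pureTensor 2 b (frameVec v₀ m σ)

/-- The mixed second derivative of `sect`, up to multiples of `sect`. -/
def sectMixed (v₀ : S) (b : S × Bool → ℕ) (x : Space S) (σ : ℂ) : Tens 2 b :=
  ∑ m : Idx 2 b, coeff v₀ m x •
    replaceTwo (frameVec v₀ m σ) (fun s => negAt v₀ σ s.1) (fun s => negAtBar v₀ σ s.1)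

/-- The connection coefficients at `u₀` and `ū₀` have opposite signs, whence the difference of the
two exponents. The spots of `u₀` give the term `K`, those of `ū₀` the term `K'`. -/
theorem movingFrame_sect (v₀ : S) (b : S × Bool → ℕ) (x : Space S) :
    ∃ X Y, MovingFrame b (boostAt v₀) (wt v₀) (sect v₀ b x) X Y (sectMixed v₀ b x)
      (fun σ => ((b (v₀, false) : ℂ) - b (v₀, true)) * (conj σ * rho σ ^ 2 / 2))
      (fun σ => (b (v₀, true) - (b (v₀, false) : ℂ)) * (σ * rho σ ^ 2 / 2))
      (fun σ => b (v₀, false) * rho σ ^ 4) (fun σ => b (v₀, true) * rho σ ^ 4) := by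
  have h := movingFrame_pureTensor (b := b) (F := boostAt v₀) (wt := wt v₀)
    (ω := fun m => coeff v₀ m x) (c := frameVec v₀)
    (x := fun σ s => negAt v₀ σ s.1) (y := fun σ s => negAtBar v₀ σ s.1)
    (α := fun σ s => pairVal v₀ (conj σ * rho σ ^ 2 / 2) (-(conj σ * rho σ ^ 2 / 2)) s.1)
    (α' := fun σ s => pairVal v₀ (-(σ * rho σ ^ 2 / 2)) (σ * rho σ ^ 2 / 2) s.1)
    (κ := fun σ s => pairVal v₀ (rho σ ^ 4) 0 s.1)
    (κ' := fun σ s => pairVal v₀ 0 (rho σ ^ 4) s.1)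
    (fun u σ hσ => boostAt_mul_inv hσ u)
    (fun m hm σ hσ s => vecType_frameVec (good_of_coeff hm) hσ s)
    (fun σ hσ s => vecType_negAt hσ s.1) (fun σ hσ s => vecType_negAtBar hσ s.1) ?_ ?_ ?_
  · simp only [sum_pairVal] at h
    refine ⟨fun σ => ∑ m, coeff v₀ m x • replaceOne (frameVec v₀ m σ) fun s => negAt v₀ σ s.1,
      fun σ => ∑ m, coeff v₀ m x • replaceOne (frameVec v₀ m σ) fun s => negAtBar v₀ σ s.1, ?_⟩
    convert h using 2 <;> first | rfl | ring
  · rintro m hm σ hσ ⟨u, k⟩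
    have hg := good_of_coeff hm
    rcases label_cases v₀ u with rfl | rfl | hu
    · simp only [pairVal_false, frameVec_false hg, negAt_false,
        negAtBar_of_ne (true_ne_false v₀).symm, add_zero]
      exact hasWirt_posVec hσ
    · simp only [pairVal_true, frameVec_true hg, negAtBar_true,
        negAt_of_ne (true_ne_false v₀), add_zero]
      refine (HasWirt.starPi (hasWirt_posVec hσ)).congr ?_ ?_ <;> ext i <;> simp [conj_rho, map_ofNat]
    · have hu' : ∀ e, u ≠ (v₀, e) := fun e h => hu (by rw [h])
      simp only [pairVal_of_ne hu, negAt_of_ne (hu' _), negAtBar_of_ne (hu' _),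
        frameVec_of_ne (s := ⟨u, k⟩) hu, zero_smul, add_zero]
      exact hasWirt_const _
  · rintro m hm σ hσ ⟨u, k⟩
    have hg := good_of_coeff hm
    by_cases hu : u = (v₀, false)
    · subst hu
      simp only [pairVal_false, frameVec_false hg, negAt_false]
      exact ⟨_, hasWirt_negVec hσ⟩
    · have h0 : pairVal v₀ (rho σ ^ 4) 0 u = 0 := by simp [pairVal, hu]
      simp only [negAt_of_ne hu, h0, smul_zero, zero_smul, add_zero]
      exact ⟨_, hasWirt_const _⟩
  · rintro m hm σ hσ ⟨u, k⟩
    have hg := good_of_coeff hm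
    by_cases hu : u = (v₀, true)
    · subst hu
      simp only [pairVal_true, frameVec_true hg, negAtBar_true]
      refine ⟨_, (HasWirt.starPi (hasWirt_negVec hσ)).congr rfl ?_⟩
      ext i
      simp [conj_rho, map_ofNat]
    · have h0 : pairVal v₀ 0 (rho σ ^ 4) u = 0 := by simp [pairVal, hu]
      simp only [negAtBar_of_ne hu, h0, smul_zero, zero_smul, add_zero]
      exact ⟨_, hasWirt_const _⟩

/-! ### The scalar factors -/

/-- The component at `v₀` of `ν_b`, translated to the base point. -/
def radial (p q : ℕ) (w : Fin 2 → ℂ) (σ : ℂ) : ℂ :=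
  hermC p q (posCoord w σ) * hermC 0 0 (negCoord w σ)

/-- The connection terms are opposite to those of `sect`, so the covariant derivative of the product
consists of raised terms only. These become `P` and `Q` in `MovingFrame.ddc_eq`. -/
theorem hasWirt_radial (p q : ℕ) (w : Fin 2 → ℂ) (hσ : ‖σ‖ < 1) : HasWirt (radial p q w)
    (2 * Real.pi * (rho σ ^ 2 * (negCoord w σ * radial p (q + 1) w σ))
      - ((p : ℂ) - q) * (conj σ * rho σ ^ 2 / 2) * radial p q w σ)
    (2 * Real.pi * (rho σ ^ 2 * (conj (negCoord w σ) * radial (p + 1) q w σ))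
      - (q - (p : ℂ)) * (σ * rho σ ^ 2 / 2) * radial p q w σ) σ := by
  have h := (((hasWirt_hermC' p q (posCoord w σ)).comp (hasWirt_posCoord hσ w))).mul
    ((hasWirt_hermC' 0 0 (negCoord w σ)).comp (hasWirt_negCoord hσ w))
  -- The doubly raised function is common to `e1` and `e2`; in their difference only `q - p`
  -- survives, the connection coefficient.
  have e1 : 2 * Real.pi * (posCoord w σ * hermC p (q + 1) (posCoord w σ))
      = 2 * Real.pi * hermC (p + 1) (q + 1) (posCoord w σ)
        + (q + 1) * hermC p q (posCoord w σ) := by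
    rw [mul_hermC]
    field_simp [pi_ne_zero']
    simp
  have e2 : 2 * Real.pi * (conj (posCoord w σ) * hermC (p + 1) q (posCoord w σ))
      = 2 * Real.pi * hermC (p + 1) (q + 1) (posCoord w σ)
        + (p + 1) * hermC p q (posCoord w σ) := by
    rw [conj_mul_hermC]
    field_simp [pi_ne_zero']
    simp
  have e3 : negCoord w σ * hermC 0 0 (negCoord w σ) = hermC 1 0 (negCoord w σ) := by
    simp [mul_hermC]
  have e4 : conj (negCoord w σ) * hermC 0 0 (negCoord w σ) = hermC 0 1 (negCoord w σ) := by
    simp [conj_mul_hermC]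
  refine h.congr ?_ ?_ <;>
    simp only [radial, smul_eq_mul, map_sub, map_mul, map_neg, map_div₀, map_pow, conj_rho,
      Complex.conj_conj, map_ofNat, zero_add, ← e3, ← e4]
  · linear_combination (conj σ * rho σ ^ 2 / 2 * hermC 0 0 (negCoord w σ)) * (e1 - e2)
  · linear_combination (σ * rho σ ^ 2 / 2 * hermC 0 0 (negCoord w σ)) * (e2 - e1)

end Unitary

end FunkeMillson
end

noncomputable section

namespace FunkeMillson

open scoped ComplexConjugate

set_option linter.unusedSectionVars false

/-! ### Evaluation of `DD^c` and of `φ_b` in the unitary case. -/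

namespace Unitary

variable {S : Type*} [Fintype S] [DecidableEq S] {v₀ : S} {b : S × Bool → ℕ} {τ : ℂ}

/-- Differentiating `P` and `Q` raises both exponents once. In the coefficient `2(p + q + 1)`, the
part `p + q` is `K + K'` and the part `p + q + 2` comes from the recursions `e1` and `e2`, which
remove the factors `posCoord`. -/
theorem DDc_radial_smul (v₀ : S) (b : S × Bool → ℕ) (x : Space S) {T : Tens 2 b →ₗ[ℂ] Tens 2 b}
    (hT : ∀ σ, ‖σ‖ < 1 → ∀ q, hodgeProj b (boostAt v₀) (wt v₀) q σ ∘ₗ T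
      = T ∘ₗ hodgeProj b (boostAt v₀) (wt v₀) q σ) (hτ : ‖τ‖ < 1) :
    DDc v₀ b (fun σ => radial (b (v₀, false)) (b (v₀, true)) (x v₀) σ • T (sect v₀ b x σ)) τ
      = areaForm ((4 * Real.pi * Complex.I : ℂ)⁻¹ • (rho τ ^ 4 *
          (2 * (b (v₀, false) + b (v₀, true) + 1)
              * radial (b (v₀, false)) (b (v₀, true)) (x v₀) τ
            - 4 * Real.pi * (2 * Real.pi * (negCoord (x v₀) τ * conj (negCoord (x v₀) τ)) - 1)
              * radial (b (v₀, false) + 1) (b (v₀, true) + 1) (x v₀) τ)) • T (sect v₀ b x τ)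
        + (4 * Real.pi * Complex.I : ℂ)⁻¹ • (2 * radial (b (v₀, false)) (b (v₀, true)) (x v₀) τ)
            • T (sectMixed v₀ b x τ)) := by
  obtain ⟨X, Y, h⟩ := movingFrame_sect v₀ b x
  have hz := hasWirt_negCoord hτ (x v₀)
  have hr := (hasWirt_rho hτ).mul (hasWirt_rho hτ)
  have hP := (hr.mul (hz.mul (hasWirt_radial (b (v₀, false)) (b (v₀, true) + 1) (x v₀) hτ))).const_mul
    (2 * Real.pi)
  have hQ := (hr.mul (hz.star.mul
    (hasWirt_radial (b (v₀, false) + 1) (b (v₀, true)) (x v₀) hτ))).const_mul (2 * Real.pi)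
  simp only [← sq] at hP hQ
  rw [DDc, (h.map hT).ddc_eq (fun σ hσ => hasWirt_radial (b (v₀, false)) (b (v₀, true)) (x v₀) hσ)
    hτ hP hQ]
  generalize hp : b (v₀, false) = p
  generalize hq : b (v₀, true) = q
  have e1 : 2 * Real.pi * (posCoord (x v₀) τ * radial p (q + 1) (x v₀) τ)
      = 2 * Real.pi * radial (p + 1) (q + 1) (x v₀) τ + (q + 1) * radial p q (x v₀) τ := by
    rw [radial, ← mul_assoc (posCoord _ _), mul_hermC, radial, radial]
    field_simp [pi_ne_zero']
    simp
    ring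
  have e2 : 2 * Real.pi * (conj (posCoord (x v₀) τ) * radial (p + 1) q (x v₀) τ)
      = 2 * Real.pi * radial (p + 1) (q + 1) (x v₀) τ + (p + 1) * radial p q (x v₀) τ := by
    rw [radial, ← mul_assoc (conj _), conj_mul_hermC, radial, radial]
    field_simp [pi_ne_zero']
    simp
    ring
  congr 1
  rw [smul_add]
  congr 3
  simp only [map_sub, map_mul, map_neg, map_div₀, map_pow, conj_rho, Complex.conj_conj, map_ofNat]
  push_cast
  linear_combination (rho τ ^ 4) * (e1 + e2)

theorem nu_eq (v₀ : S) (b : S × Bool → ℕ) (x : Space S) :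
    nu v₀ b x = fun σ =>
      radial (b (v₀, false)) (b (v₀, true)) (x v₀) σ • sect v₀ b x σ := by
  ext1 σ
  rw [nu, tensorMap_eq_sum, sect, Finset.smul_sum]
  refine Finset.sum_congr rfl fun m _ => ?_
  rw [smul_smul]
  congr 1
  have h := weighted_hermite v₀ b 1 0 (backSpace v₀ σ x) m
  simp only [one_mul] at h
  rw [nuBase, gaussian_eq, h, coeff]
  split_ifs with hm
  · have h2 := hermite_update v₀ hm 0 x ((boost σ)⁻¹.mulVec (x v₀))
    simp only [Pi.single_zero, zero_add, add_zero] at h2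
    rw [zero_add, backSpace, h2, boost_inv_mulVec, radial]
    rfl
  · simp

theorem areaForm_compContinuousLinearMap {T : Type*} [NormedAddCommGroup T] [NormedSpace ℝ T]
    [NormedSpace ℂ T] [IsScalarTower ℝ ℂ T] (t : T) {L : ℂ →L[ℝ] ℂ} {d : ℂ}
    (hL : ∀ v, L v = d * v) :
    (areaForm t).compContinuousLinearMap L = areaForm ((d * conj d) • t) := by
  ext v
  rw [ContinuousAlternatingMap.compContinuousLinearMap_apply, areaForm_apply, areaForm_apply,
    smul_smul]
  simp only [Function.comp_apply, hL, map_mul]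
  congr 1
  ring

theorem map_areaForm {X Y : Type*} [Fintype X] [Fintype Y] (L : (X → ℂ) →ₗ[ℂ] (Y → ℂ)) (t : X → ℂ) :
    (realCLM L).compContinuousAlternatingMap (areaForm t) = areaForm (L t) := by
  ext1 v
  rw [areaForm_apply]
  show L (areaForm t v) = _
  rw [areaForm_apply, map_smul]

/-- The Möbius transformation takes `τ` to `0`, so only the derivative of the numerator contributes.
-/
theorem fderiv_moebius (hτ : ‖τ‖ < 1) (v : ℂ) :
    fderiv ℝ (moebius (boost τ)⁻¹) τ v = rho τ ^ 2 * v := by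
  have h0 := rho_sq hτ
  have hr : rho τ ≠ 0 := by
    intro h
    simp [h] at h0
  have hd : rho τ * (1 - τ * conj τ) ≠ 0 := by
    intro h
    rw [sq, mul_assoc, h, mul_zero] at h0
    exact zero_ne_one h0
  have hm : moebius (boost τ)⁻¹ = fun w => (rho τ * (w - τ)) / (rho τ * (1 - w * conj τ)) := by
    ext w
    rw [moebius, boost_inv_mulVec]
    simp [posCoord, negCoord]
    ring
  have h1 : HasDerivAt (fun w => (rho τ * (w - τ)) / (rho τ * (1 - w * conj τ))) (rho τ ^ 2) τ := by
    have h2 : HasDerivAt (fun w => rho τ * (w - τ)) (rho τ * 1) τ :=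
      ((hasDerivAt_id τ).sub_const τ).const_mul _
    have h3 : HasDerivAt (fun w => rho τ * (1 - w * conj τ)) (rho τ * -(1 * conj τ)) τ :=
      (((hasDerivAt_id τ).mul_const (conj τ)).const_sub 1).const_mul _
    refine (h2.div h3 hd).congr_deriv ?_
    rw [sub_self, mul_zero, zero_mul, sub_zero, div_eq_iff (pow_ne_zero _ hd)]
    linear_combination (-rho τ ^ 2 * (1 - τ * conj τ)) * h0
  rw [hm, (h1.hasFDerivAt.restrictScalars ℝ).fderiv]
  simp [mul_comm]

/-- The two Howe operators raise both exponents of `e_1` by one; the operators `E_u` are applied to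
a Hermite function again. The pullback to `τ` contributes `rho τ ^ 4`. -/
theorem phi_eq (v₀ : S) (b : S × Bool → ℕ) (x : Space S) (hτ : ‖τ‖ < 1) :
    phi v₀ b x τ = areaForm ((Complex.I * rho τ ^ 4 *
      radial (b (v₀, false) + 1) (b (v₀, true) + 1) (x v₀) τ) • sect v₀ b x τ) := by
  rw [phi, phiBase, ← areaForm, areaForm_compContinuousLinearMap _ (fderiv_moebius hτ), map_areaForm]
  congr 1
  rw [map_smul, tensorMap_eq_sum, sect, Finset.smul_sum, Finset.smul_sum]
  refine Finset.sum_congr rfl fun m _ => ?_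
  rw [smul_smul, smul_smul]
  congr 1
  have h := weighted_hermite v₀ b Complex.I
    (Pi.single (v₀, false) (Pi.single 0 1) + Pi.single (v₀, true) (Pi.single 0 1))
    (backSpace v₀ τ x) m
  rw [gaussian_eq, raise_hermite, raise_hermite, zero_add, h, coeff]
  split_ifs with hm
  · rw [backSpace, hermite_update v₀ hm 1, boost_inv_mulVec, radial, map_pow, conj_rho]
    simp only [Matrix.cons_val_zero, Matrix.cons_val_one]
    ring
  · simp

end Unitary

end FunkeMillson
end

noncomputable section

namespace FunkeMillson

open scoped ComplexConjugate

set_option linter.unusedSectionVars false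

/-! ### Linearity of area forms. -/

section AreaForm

variable {T : Type*} [NormedAddCommGroup T] [NormedSpace ℝ T] [NormedSpace ℂ T]
    [IsScalarTower ℝ ℂ T]

theorem areaForm_smul (c : ℂ) (t : T) : areaForm (c • t) = c • areaForm t := by
  ext v
  rw [ContinuousAlternatingMap.smul_apply, areaForm_apply, areaForm_apply, smul_comm]

theorem areaForm_add (t t' : T) : areaForm (t + t') = areaForm t + areaForm t' := by
  ext v
  rw [ContinuousAlternatingMap.add_apply, areaForm_apply, areaForm_apply, areaForm_apply, smul_add]

theorem areaForm_neg (t : T) : areaForm (-t) = -areaForm t := by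
  rw [← neg_one_smul ℂ, areaForm_smul, neg_one_smul]

theorem areaForm_sum {J : Type*} (s : Finset J) (t : J → T) :
    areaForm (∑ i ∈ s, t i) = ∑ i ∈ s, areaForm (t i) := by
  ext v
  simp only [ContinuousAlternatingMap.sum_apply, areaForm_apply, Finset.smul_sum]

end AreaForm

theorem hasFDerivAt_mul_comp {X : Type*} [NormedAddCommGroup X] [NormedSpace ℝ X]
    (L₁ L₂ : X →L[ℝ] ℂ) {g₁ g₂ : ℂ → ℂ} {a a' d d' : ℂ} {w : X} (h₁ : HasWirt g₁ a a' (L₁ w))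
    (h₂ : HasWirt g₂ d d' (L₂ w)) :
    HasFDerivAt (fun w => g₁ (L₁ w) * g₂ (L₂ w))
      (∑ k, (![a * g₂ (L₂ w), a' * g₂ (L₂ w), g₁ (L₁ w) * d, g₁ (L₁ w) * d'] : Fin 4 → ℂ) k •
        (![L₁, (Complex.conjCLE : ℂ →L[ℝ] ℂ).comp L₁, L₂,
          (Complex.conjCLE : ℂ →L[ℝ] ℂ).comp L₂] : Fin 4 → X →L[ℝ] ℂ) k) w := by
  have h := (HasFDerivAt.comp w h₁ L₁.hasFDerivAt).mul (HasFDerivAt.comp w h₂ L₂.hasFDerivAt)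
  refine h.congr_fderiv ?_
  ext v
  simp [Fin.sum_univ_four, wirt_apply]
  ring

/-! ### The lowering operator in the unitary case. -/

namespace Unitary

variable {S : Type*} [Fintype S] [DecidableEq S] {v₀ : S} {b : S × Bool → ℕ} {τ : ℂ}

/-- `posCoord`, as a linear map. -/
def posCLM (τ : ℂ) : (Fin 2 → ℂ) →L[ℝ] ℂ :=
  ((ContinuousLinearMap.mul ℝ ℂ (rho τ)).comp (ContinuousLinearMap.proj (R := ℝ) (φ := fun _ : Fin 2 => ℂ) 0
    - (ContinuousLinearMap.mul ℝ ℂ τ).comp (ContinuousLinearMap.proj (R := ℝ) (φ := fun _ : Fin 2 => ℂ) 1)))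

/-- `negCoord`, as a linear map. -/
def negCLM (τ : ℂ) : (Fin 2 → ℂ) →L[ℝ] ℂ :=
  ((ContinuousLinearMap.mul ℝ ℂ (rho τ)).comp (ContinuousLinearMap.proj (R := ℝ) (φ := fun _ : Fin 2 => ℂ) 1
    - (ContinuousLinearMap.mul ℝ ℂ (conj τ)).comp (ContinuousLinearMap.proj (R := ℝ) (φ := fun _ : Fin 2 => ℂ) 0)))

theorem posCLM_apply (τ : ℂ) (w : Fin 2 → ℂ) : posCLM τ w = posCoord w τ := rfl

theorem negCLM_apply (τ : ℂ) (w : Fin 2 → ℂ) : negCLM τ w = negCoord w τ := rfl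

/-- The coordinates at `τ` and their complex conjugates. -/
def zeta (τ : ℂ) : Fin 4 → (Fin 2 → ℂ) →L[ℝ] ℂ :=
  ![posCLM τ, (Complex.conjCLE : ℂ →L[ℝ] ℂ).comp (posCLM τ), negCLM τ,
    (Complex.conjCLE : ℂ →L[ℝ] ℂ).comp (negCLM τ)]

/-- The boost is an isometry, so the dual Gram matrix is that of the base point, where each
coordinate is paired with its own conjugate only. -/
theorem sum_sign_zeta (v₀ : S) (hτ : ‖τ‖ < 1) (a a' : Fin 4) :
    ∑ i : Fin 2 × Bool, (sign v₀ v₀ i.1 : ℂ) *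
      (zeta τ a (Pi.single i.1 (if i.2 then Complex.I else 1))
        * zeta τ a' (Pi.single i.1 (if i.2 then Complex.I else 1)))
      = (!![0, 2, 0, 0; 2, 0, 0, 0; 0, 0, 0, -2; 0, 0, -2, 0] : Matrix (Fin 4) (Fin 4) ℂ) a a' := by
  have hρ := rho_sq hτ
  fin_cases a <;> fin_cases a' <;>
    simp [zeta, Fintype.sum_prod_type, Fin.sum_univ_two, sign, posCLM_apply, negCLM_apply,
      posCoord, negCoord, conj_rho] <;> ring_nf <;> simp only [Complex.I_sq] <;>
    first | ring1 | linear_combination 2 * hρ | linear_combination (-2) * hρ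

theorem sum_zeta (w : Fin 2 → ℂ) (a : Fin 4) :
    ∑ i : Fin 2 × Bool, ((if i.2 then (w i.1).im else (w i.1).re : ℝ) : ℂ) *
      zeta τ a (Pi.single i.1 (if i.2 then Complex.I else 1)) = zeta τ a w := by
  have h : w = ∑ i : Fin 2 × Bool, (if i.2 then (w i.1).im else (w i.1).re) •
      (Pi.single i.1 (if i.2 then Complex.I else 1) : Fin 2 → ℂ) := by
    ext j
    have e := Complex.re_add_im (w j)
    fin_cases j <;> simp [Fintype.sum_prod_type, Fin.sum_univ_two, -Complex.re_add_im] at e ⊢ <;>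
      linear_combination -e
  conv_rhs => rw [h, map_sum]
  refine Finset.sum_congr rfl fun i _ => ?_
  rw [map_smul, Complex.real_smul]

theorem sum_sign_sq (v₀ : S) (hτ : ‖τ‖ < 1) (w : Fin 2 → ℂ) :
    ∑ i : Fin 2 × Bool, (sign v₀ v₀ i.1 : ℂ)
      * ((if i.2 then (w i.1).im else (w i.1).re : ℝ) : ℂ) ^ 2
    = posCoord w τ * conj (posCoord w τ) - negCoord w τ * conj (negCoord w τ) := by
  have hn : ∀ z : ℂ, (z.im : ℂ) ^ 2 + (z.re : ℂ) ^ 2 = z * conj z := by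
    intro z
    rw [Complex.mul_conj, Complex.normSq_apply]
    push_cast
    ring
  simp [Fintype.sum_prod_type, Fin.sum_univ_two, sign, posCoord, negCoord, conj_rho]
  linear_combination hn (w 0) - hn (w 1)
    - (w 0 * conj (w 0) - w 1 * conj (w 1)) * rho_sq hτ

/-- On the positive coordinate the operator lowers both exponents and annihilates the Gaussian; on
the Gaussian of the negative coordinate it is multiplication by `1 - 2π |z|²`. -/
theorem weil_radial {W : Type*} [NormedAddCommGroup W] [NormedSpace ℝ W] [NormedSpace ℂ W]
    [SMulCommClass ℝ ℂ W] [IsScalarTower ℝ ℂ W] (v₀ : S) (p q : ℕ) (w : Fin 2 → ℂ) (hτ : ‖τ‖ < 1)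
    (t : W) :
    weilAction (ι := Fin 2 × Bool) (fun k => sign v₀ v₀ k.1)
      (fun k => Pi.single k.1 (if k.2 then Complex.I else 1))
      (fun k (x : Fin 2 → ℂ) => if k.2 then (x k.1).im else (x k.1).re) lowering
      (fun w => radial p q w τ • t) w
    = ((1 - 2 * Real.pi * (negCoord w τ * conj (negCoord w τ))) * radial p q w τ
      + p * q / (2 * Real.pi) * radial (p - 1) (q - 1) w τ) • t := by
  let H : ℂ → ℂ := fun z => p * hermC (p - 1) q z - Real.pi * conj z * hermC p q z
  let H' : ℂ → ℂ := fun z => q * hermC p (q - 1) z - Real.pi * z * hermC p q z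
  let G : ℂ → ℂ := fun z => -(Real.pi * conj z * hermC 0 0 z)
  let G' : ℂ → ℂ := fun z => -(Real.pi * z * hermC 0 0 z)
  have dh : ∀ z, HasWirt (hermC p q) (H z) (H' z) z := hasWirt_hermC p q
  have dg : ∀ z, HasWirt (hermC 0 0) (G z) (G' z) z := fun z =>
    (hasWirt_hermC 0 0 z).congr (by simp [G]) (by simp [G'])
  let HH : ℂ → ℂ := fun z => p * (q * hermC (p - 1) (q - 1) z - Real.pi * z * hermC (p - 1) q z)
    - (Real.pi * hermC p q z + Real.pi * conj z * H' z)
  let GG : ℂ → ℂ := fun z => -(Real.pi * hermC 0 0 z + Real.pi * conj z * G' z)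
  have dH : ∀ z, HasWirt H (p * ((p - 1 : ℕ) * hermC (p - 1 - 1) q z
        - Real.pi * conj z * hermC (p - 1) q z) - (Real.pi * conj z) * H z) (HH z) z := fun z =>
    (((hasWirt_hermC (p - 1) q z).const_mul p).sub
      ((hasWirt_conj.const_mul (Real.pi : ℂ)).mul (dh z))).congr (by simp) (by simp [HH]; ring)
  have dH' : ∀ z, HasWirt H' (HH z)
      (q * ((q - 1 : ℕ) * hermC p (q - 1 - 1) z - Real.pi * z * hermC p (q - 1) z)
        - (Real.pi * z * H' z)) z := fun z =>
    (((hasWirt_hermC p (q - 1) z).const_mul q).sub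
      ((hasWirt_id.const_mul (Real.pi : ℂ)).mul (dh z))).congr
        (by simp [HH, H, H']; ring) (by simp)
  have dG : ∀ z, HasWirt G (-(Real.pi * conj z * G z)) (GG z) z := fun z => by
    simpa only [neg_one_mul, G] using
      ((((hasWirt_conj.const_mul (Real.pi : ℂ)).mul (dg z))).const_mul (-1)).congr
        (by simp [G]) (by simp [GG]; ring)
  have dG' : ∀ z, HasWirt G' (GG z) (-(Real.pi * z * G' z)) z := fun z => by
    simpa only [neg_one_mul, G'] using
      ((((hasWirt_id.const_mul (Real.pi : ℂ)).mul (dg z))).const_mul (-1)).congr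
        (by simp [GG, G, G']; ring) (by simp [G'])
  -- The unmixed second derivatives meet zero entries of the Gram matrix, so their values can be
  -- forgotten.
  obtain ⟨A, hA⟩ : ∃ A : ℂ → ℂ, ∀ z, HasWirt H (A z) (HH z) z := ⟨_, dH⟩
  obtain ⟨A', hA'⟩ : ∃ A : ℂ → ℂ, ∀ z, HasWirt H' (HH z) (A z) z := ⟨_, dH'⟩
  obtain ⟨B, hB⟩ : ∃ A : ℂ → ℂ, ∀ z, HasWirt G (A z) (GG z) z := ⟨_, dG⟩
  obtain ⟨B', hB'⟩ : ∃ A : ℂ → ℂ, ∀ z, HasWirt G' (GG z) (A z) z := ⟨_, dG'⟩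
  have key := weilAction_lowering (ι := Fin 2 × Bool) (A := Fin 4)
    (fun k => sign v₀ v₀ k.1)
    (fun k => (Pi.single k.1 (if k.2 then Complex.I else 1) : Fin 2 → ℂ))
    (fun k (x : Fin 2 → ℂ) => if k.2 then (x k.1).im else (x k.1).re)
    (zeta τ)
    (Φ := fun w => hermC p q (posCLM τ w) * hermC 0 0 (negCLM τ w))
    (Φ₁ := fun a w => ![H (posCLM τ w) * hermC 0 0 (negCLM τ w),
      H' (posCLM τ w) * hermC 0 0 (negCLM τ w), hermC p q (posCLM τ w) * G (negCLM τ w),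
      hermC p q (posCLM τ w) * G' (negCLM τ w)] a)
    (Φ₂ := ![![A (posCLM τ w) * hermC 0 0 (negCLM τ w), HH (posCLM τ w) * hermC 0 0 (negCLM τ w),
        H (posCLM τ w) * G (negCLM τ w), H (posCLM τ w) * G' (negCLM τ w)],
      ![HH (posCLM τ w) * hermC 0 0 (negCLM τ w), A' (posCLM τ w) * hermC 0 0 (negCLM τ w),
        H' (posCLM τ w) * G (negCLM τ w), H' (posCLM τ w) * G' (negCLM τ w)],
      ![H (posCLM τ w) * G (negCLM τ w), H' (posCLM τ w) * G (negCLM τ w),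
        hermC p q (posCLM τ w) * B (negCLM τ w), hermC p q (posCLM τ w) * GG (negCLM τ w)],
      ![H (posCLM τ w) * G' (negCLM τ w), H' (posCLM τ w) * G' (negCLM τ w),
        hermC p q (posCLM τ w) * GG (negCLM τ w), hermC p q (posCLM τ w) * B' (negCLM τ w)]])
    (x := w) t (fun y => hasFDerivAt_mul_comp _ _ (dh _) (dg _)) (fun a => by
      fin_cases a
      · exact hasFDerivAt_mul_comp _ _ (hA _) (dg _)
      · exact hasFDerivAt_mul_comp _ _ (hA' _) (dg _)
      · exact hasFDerivAt_mul_comp _ _ (dh _) (hB _)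
      · exact hasFDerivAt_mul_comp _ _ (dh _) (hB' _))
  have hΦ : (fun w => radial p q w τ • t)
      = fun w => (hermC p q (posCLM τ w) * hermC 0 0 (negCLM τ w)) • t := rfl
  rw [hΦ, key]
  congr 1
  simp only [sum_sign_zeta v₀ hτ, sum_zeta, sum_sign_sq v₀ hτ]
  simp [Fin.sum_univ_four, zeta, posCLM_apply, negCLM_apply, radial, H, H', G, G', HH, GG]
  field_simp [pi_ne_zero']
  ring

theorem sect_slice (v₀ : S) (b : S × Bool → ℕ) (x : Space S) (w : Fin 2 → ℂ) :
    sect v₀ b (Function.update x v₀ w) = sect v₀ b x := by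
  ext1 σ
  refine Finset.sum_congr rfl fun m _ => ?_
  congr 1
  rw [coeff, coeff]
  split_ifs
  swap
  · rfl
  refine Finset.prod_congr rfl fun v hv => ?_
  rw [Function.update_of_ne (Finset.ne_of_mem_erase hv)]

theorem contDiff_coeff (v₀ : S) (m : Idx 2 b) : ContDiff ℝ 2 (coeff v₀ m) := by
  by_cases hm : Good v₀ m
  · have h : coeff v₀ m = away v₀ m := funext fun x => if_pos hm
    rw [h]
    refine contDiff_prod fun v _ => contDiff_prod fun j _ => (contDiff_hermC _ _).comp ?_
    fun_prop
  · have h : coeff v₀ m = 0 := funext fun x => if_neg hm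
    rw [h]
    exact contDiff_const

/-- The tensor `sect` depends on the components of `x` away from `v₀` only. It is constant along the
slice, and the operator sees just `radial`. -/
theorem weilL_radial_smul (v₀ : S) (b : S × Bool → ℕ) (x : Space S) (hτ : ‖τ‖ < 1) (p q : ℕ)
    (c : ℂ) (T : Tens 2 b →ₗ[ℂ] Tens 2 b) :
    weilL v₀ (fun y => areaForm ((c * radial p q (y v₀) τ) • T (sect v₀ b y τ))) x
      = areaForm ((c * ((1 - 2 * Real.pi * (negCoord (x v₀) τ * conj (negCoord (x v₀) τ)))
          * radial p q (x v₀) τ + p * q / (2 * Real.pi) * radial (p - 1) (q - 1) (x v₀) τ))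
        • T (sect v₀ b x τ)) := by
  have hsm : ContDiff ℝ 2 fun y : Space S =>
      areaForm ((c * radial p q (y v₀) τ) • T (sect v₀ b y τ)) := by
    have h : (fun y : Space S => areaForm ((c * radial p q (y v₀) τ) • T (sect v₀ b y τ)))
        = fun y => ∑ m : Idx 2 b, ((c * radial p q (y v₀) τ) * coeff v₀ m y) •
            areaForm (T (pureTensor 2 b (frameVec v₀ m τ))) := by
      ext1 y
      simp only [sect, map_sum, map_smul, Finset.smul_sum, areaForm_sum, areaForm_smul, smul_smul]
    rw [h]
    refine ContDiff.sum fun m _ => ContDiff.smul (ContDiff.mul (contDiff_const.mul ?_)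
      (contDiff_coeff v₀ m)) contDiff_const
    exact ((contDiff_hermC p q).comp ((posCLM τ).contDiff.comp (contDiff_apply ℝ _ v₀))).mul
      ((contDiff_hermC 0 0).comp ((negCLM τ).contDiff.comp (contDiff_apply ℝ _ v₀)))
  have hx : ∀ w, Function.update x v₀ 0 + ContinuousLinearMap.single ℝ (fun _ => Fin 2 → ℂ) v₀ w
      = Function.update x v₀ w := by
    intro w
    ext v : 1
    by_cases hv : v = v₀
    · subst hv; simp
    · simp [hv]
  have h := weilAction_slice (ι := Fin 2 × Bool) (fun k => sign v₀ v₀ k.1)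
    (fun k => (Pi.single k.1 (if k.2 then Complex.I else 1) : Fin 2 → ℂ))
    (fun k x => if k.2 then (x v₀ k.1).im else (x v₀ k.1).re)
    (fun k (x : Fin 2 → ℂ) => if k.2 then (x k.1).im else (x k.1).re) lowering
    (ContinuousLinearMap.single ℝ (fun _ => Fin 2 → ℂ) v₀) hsm (Function.update x v₀ 0) (x v₀)
    (fun k => by rw [hx]; simp)
  simp only [hx, Function.update_eq_self, Function.update_self, sect_slice] at h
  refine h.trans ?_
  have h2 : (fun w => areaForm ((c * radial p q w τ) • T (sect v₀ b x τ)))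
      = fun w => radial p q w τ • areaForm (c • T (sect v₀ b x τ)) := by
    ext1 w
    rw [← areaForm_smul, smul_smul, mul_comm]
  rw [h2, weil_radial v₀ p q (x v₀) hτ, ← areaForm_smul, smul_smul, mul_comm]

end Unitary

end FunkeMillson
end

noncomputable section

namespace FunkeMillson

open scoped ComplexConjugate

set_option linter.unusedSectionVars false

/-! ### Combinatorics of deleting two spots. -/

section Skip

theorem skip_injective (i : ℕ) : Function.Injective (skip i) := by
  intro k l h
  unfold skip at h
  split_ifs at h <;> omega

theorem skip_ne (i k : ℕ) : skip i k ≠ i := by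
  unfold skip
  split_ifs <;> omega

theorem exists_skip {N i k : ℕ} (hi : i < N) (hk : k < N) (h : k ≠ i) :
    ∃ l < N - 1, skip i l = k := by
  by_cases h1 : k < i
  · exact ⟨k, by omega, if_pos h1⟩
  · refine ⟨k - 1, by omega, ?_⟩
    unfold skip
    split_ifs <;> omega

end Skip

section Removes

variable {n : ℕ} {U : Type*} {b b' b'' : U → ℕ}

/-- The support of `f` consists of multi-indices with entry `z` in both removed spots. They are
determined by their restrictions, and every multi-index on the remaining spots extends by `z`. -/
theorem Removes.sum_restrictIdx [Fintype U] [DecidableEq U] {M : Type*} [AddCommMonoid M]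
    {ι : Spot b' → Spot b} {a a' : Spot b} (h : Removes ι a a') (z : Fin n) {f : Idx n b → M}
    {f' : Idx n b' → M} (hf : ∀ m, f m ≠ 0 → m a.1 a.2 = z ∧ m a'.1 a'.2 = z)
    (hff' : ∀ m, m a.1 a.2 = z → m a'.1 a'.2 = z → f m = f' (restrictIdx ι m)) :
    ∑ m, f m = ∑ m', f' m' := by
  refine Finset.sum_bij_ne_zero (fun m _ _ => restrictIdx ι m) (fun _ _ _ => Finset.mem_univ _)
    ?_ ?_ fun m _ hm => hff' m (hf m hm).1 (hf m hm).2
  · intro m _ hm m' _ hm' e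
    ext1 u
    ext1 k
    by_cases h1 : (⟨u, k⟩ : Spot b) = a
    · subst h1
      exact (hf m hm).1.trans (hf m' hm').1.symm
    · by_cases h2 : (⟨u, k⟩ : Spot b) = a'
      · subst h2
        exact (hf m hm).2.trans (hf m' hm').2.symm
      · obtain ⟨y, hy⟩ := (h.range ⟨u, k⟩).2 ⟨h1, h2⟩
        have := congrFun (congrFun e y.1) y.2
        simp only [restrictIdx] at this
        rw [show (⟨y.1, y.2⟩ : Spot b') = y from rfl, hy] at this
        exact this
  · intro m' _ hm'
    let m : Idx n b := fun u k => Function.extend ι (fun s => m' s.1 s.2) (fun _ => z) ⟨u, k⟩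
    have ha : m a.1 a.2 = z := Function.extend_apply' _ _ _ fun hy => ((h.range a).1 hy).1 rfl
    have ha' : m a'.1 a'.2 = z := Function.extend_apply' _ _ _ fun hy => ((h.range a').1 hy).2 rfl
    have hm : restrictIdx ι m = m' := by
      ext1 u
      ext1 k
      exact h.injective.extend_apply (fun s : Spot b' => m' s.1 s.2) (fun _ => z) ⟨u, k⟩
    refine ⟨m, Finset.mem_univ _, ?_, hm⟩
    rw [hff' m ha ha', hm]
    exact hm'

theorem Removes.forall {X Y : Type*} {ι : Y → X} {a a' : X} (h : Removes ι a a') {P : X → Prop}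
    (ha : P a) (ha' : P a') : (∀ x, P x) ↔ ∀ y, P (ι y) := by
  refine ⟨fun h1 y => h1 _, fun h1 x => ?_⟩
  by_cases e : x = a
  · rwa [e]
  by_cases e' : x = a'
  · rwa [e']
  obtain ⟨y, rfl⟩ := (h.range x).2 ⟨e, e'⟩
  exact h1 y

/-- The inserted tensor moves to the permuted spots, and the rest does not depend on those. Through
`mem_range_expand` no induced permutation of the remaining spots has to be written down. -/
theorem permute_expand_mem {ι : Spot b' → Spot b} {a a' : Spot b} (h : Removes ι a a')
    (q : Fin n → Fin n → ℝ) (σ : ∀ u, Equiv.Perm (Fin (b u))) {ι₂ : Spot b'' → Spot b}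
    (h₂ : Removes ι₂ ⟨a.1, σ a.1 a.2⟩ ⟨a'.1, σ a'.1 a'.2⟩) (t : Tens n b') :
    permute n σ (expand (restrictIdx ι) (twoSpots q a a') t) ∈
      LinearMap.range (expand (restrictIdx ι₂)
        (twoSpots (n := n) q ⟨a.1, σ a.1 a.2⟩ ⟨a'.1, σ a'.1 a'.2⟩)) := by
  refine mem_range_expand h₂ (twoSpots q ⟨a.1, σ a.1 a.2⟩ ⟨a'.1, σ a'.1 a'.2⟩)
    (fun m => t (restrictIdx ι fun u k => m u (σ u k))) fun m m' hm => congrArg t ?_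
  have hσ : Function.Injective fun s : Spot b => (⟨s.1, σ s.1 s.2⟩ : Spot b) := by
    rintro ⟨u, k⟩ ⟨u', k'⟩ e
    obtain rfl : u = u' := congrArg Sigma.fst e
    simpa using e
  ext1 w
  ext1 k
  have := (h.range (ι ⟨w, k⟩)).1 ⟨_, rfl⟩
  exact hm ⟨_, _⟩ (hσ.ne this.1) (hσ.ne this.2)

end Removes

namespace Unitary

variable {S : Type*} [Fintype S] [DecidableEq S] {v₀ : S} {b : S × Bool → ℕ} {σ : ℂ}

/-! ### Insertions in the unitary case -/

theorem ne_bar (u : S × Bool) : u ≠ bar u := fun h => by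
  have := congrArg Prod.snd h
  simp [bar] at this

/-- The embedding of the spots that remain after deleting the `i`-th spot of label `u` and the
`j`-th spot of label `ū`. -/
def keep (b : S × Bool → ℕ) (u : S × Bool) (i : Fin (b u)) (j : Fin (b (bar u)))
    (s : Spot (lower b u.1)) : Spot b :=
  ⟨s.1, ⟨if s.1 = u then skip i s.2 else if s.1 = bar u then skip j s.2 else s.2, by
    obtain ⟨w, k⟩ := s
    have hk : k.1 < if w.1 = u.1 then b w - 1 else b w := k.2
    generalize k.1 = k' at hk ⊢
    unfold skip
    by_cases h : w.1 = u.1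
    · rw [if_pos h] at hk
      dsimp only
      split_ifs <;> omega
    · have h1 : w ≠ u := fun e => h (by rw [e])
      have h2 : w ≠ bar u := fun e => h (by rw [e]; rfl)
      rw [if_neg h] at hk
      rw [if_neg h1, if_neg h2]
      exact hk⟩⟩

/-- The matrix of the hermitian form at `v`. -/
def gram (v₀ v : S) (k l : Fin 2) : ℝ := if k = l then sign v₀ v k else 0

theorem removes_keep (u : S × Bool) (i : Fin (b u)) (j : Fin (b (bar u))) :
    Removes (keep b u i j) ⟨u, i⟩ ⟨bar u, j⟩ := by
  have hne := ne_bar u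
  refine ⟨?_, fun h => hne (congrArg Sigma.fst h), ?_⟩
  · rintro ⟨w, k⟩ ⟨w', k'⟩ h
    obtain rfl : w = w' := congrArg Sigma.fst h
    have h1 := Fin.val_eq_of_eq (eq_of_heq (Sigma.mk.inj_iff.1 h).2)
    simp only at h1
    congr 1
    ext
    split_ifs at h1
    · exact skip_injective _ h1
    · exact skip_injective _ h1
    · exact h1
  · rintro ⟨w, k⟩
    by_cases hw : w = u
    · subst hw
      have h2 : (⟨w, k⟩ : Spot b) ≠ ⟨bar w, j⟩ := fun h => hne (congrArg Sigma.fst h)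
      constructor
      · rintro ⟨⟨w', l⟩, h⟩
        obtain rfl : w' = w := congrArg Sigma.fst h
        refine ⟨fun e => ?_, h2⟩
        rw [e] at h
        have h1 := Fin.val_eq_of_eq (eq_of_heq (Sigma.mk.inj_iff.1 h).2)
        simp only [if_true] at h1
        exact skip_ne _ _ h1
      · rintro ⟨h1, -⟩
        have h3 : k.1 ≠ i.1 := fun e => h1 (by rw [Fin.ext e])
        obtain ⟨l, hl, hl'⟩ := exists_skip i.2 k.2 h3
        refine ⟨⟨w, ⟨l, by simpa [lower] using hl⟩⟩, ?_⟩
        simp [keep, hl']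
    · by_cases hw' : w = bar u
      · subst hw'
        have h2 : (⟨bar u, k⟩ : Spot b) ≠ ⟨u, i⟩ := fun h => hne (congrArg Sigma.fst h).symm
        constructor
        · rintro ⟨⟨w', l⟩, h⟩
          obtain rfl : w' = bar u := congrArg Sigma.fst h
          refine ⟨h2, fun e => ?_⟩
          rw [e] at h
          have h1 := Fin.val_eq_of_eq (eq_of_heq (Sigma.mk.inj_iff.1 h).2)
          simp only [if_neg hne.symm, if_true] at h1
          exact skip_ne _ _ h1
        · rintro ⟨-, h1⟩
          have h3 : k.1 ≠ j.1 := fun e => h1 (by rw [Fin.ext e])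
          obtain ⟨l, hl, hl'⟩ := exists_skip j.2 k.2 h3
          refine ⟨⟨bar u, ⟨l, ?_⟩⟩, ?_⟩
          · simpa [lower, bar] using hl
          · simp [keep, hl', hne.symm]
      · have h1 : (⟨w, k⟩ : Spot b) ≠ ⟨u, i⟩ := fun h => hw (congrArg Sigma.fst h)
        have h2 : (⟨w, k⟩ : Spot b) ≠ ⟨bar u, j⟩ := fun h => hw' (congrArg Sigma.fst h)
        -- Only `u` and `ū` lie above the place of `u`.
        have h3 : w.1 ≠ u.1 := by
          intro e
          obtain ⟨v, e'⟩ := w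
          obtain ⟨v', e''⟩ := u
          obtain rfl : v = v' := e
          cases e' <;> cases e'' <;> simp [bar] at hw hw'
        simp only [ne_eq, h1, h2, not_false_eq_true, and_self, iff_true]
        refine ⟨⟨w, ⟨k, ?_⟩⟩, ?_⟩
        · simp [lower, h3]
        · simp [keep, hw, hw']

/-- The deleted spots lie above `v₀` and carry `e_1`, so neither the multiplicities elsewhere nor
goodness change. -/
theorem coeff_restrictIdx (i : Fin (b (v₀, false))) (j : Fin (b (v₀, true))) (m : Idx 2 b)
    (hi : m (v₀, false) i = 0) (hj : m (v₀, true) j = 0) (x : Space S) :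
    coeff v₀ (restrictIdx (keep b (v₀, false) i j) m) x = coeff v₀ m x := by
  have hr := removes_keep (b := b) (v₀, false) i j
  have hgood : Good v₀ (restrictIdx (keep b (v₀, false) i j) m) ↔ Good v₀ m := by
    have h1 : ∀ {b : S × Bool → ℕ} (m : Idx 2 b), Good v₀ m ↔
        ∀ s : Spot b, ¬ (s.1.1 = v₀ ∧ m s.1 s.2 = 1) := fun m =>
      ⟨fun h s => h s.1 s.2, fun h u k => h ⟨u, k⟩⟩
    rw [h1, h1, hr.forall (P := fun s => ¬ (s.1.1 = v₀ ∧ m s.1 s.2 = 1))]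
    · exact Iff.rfl
    · simp [hi]
    · show ¬ (_ ∧ m (v₀, true) j = 1)
      simp [hj]
  have hmult : ∀ v ≠ v₀, ∀ e, multiplicity (restrictIdx (keep b (v₀, false) i j) m) (v, e)
      = multiplicity m (v, e) := by
    intro v hv e
    have h2 : ∀ e', (v₀, e') ≠ (v, e) := fun e' h => hv (congrArg Prod.fst h).symm
    rw [multiplicity, multiplicity, hr.sum]
    simp only [Pi.add_apply]
    rw [Pi.single_eq_of_ne (h2 false).symm, Pi.single_eq_of_ne (show (v, e) ≠ bar (v₀, false) from
      (h2 true).symm), zero_add, zero_add]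
    rfl
  rw [coeff, coeff]
  by_cases hm : Good v₀ m
  · rw [if_pos hm, if_pos (hgood.2 hm), away, away]
    refine Finset.prod_congr rfl fun v hv => Finset.prod_congr rfl fun k _ => ?_
    rw [hmult v (Finset.ne_of_mem_erase hv), hmult v (Finset.ne_of_mem_erase hv)]
  · rw [if_neg hm, if_neg fun h => hm (hgood.1 h)]

/-- The boost preserves the hermitian form, so the dual tensor has the same shape in the translated
basis at every point of the disc. -/
theorem gram_eq (hσ : ‖σ‖ < 1) (k l : Fin 2) : (gram v₀ v₀ k l : ℂ) = ∑ c : Fin 2,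
    (![1, -1] : Fin 2 → ℂ) c * (![posVec σ, negVec σ] : Fin 2 → Fin 2 → ℂ) c k
      * (![fun i => conj (posVec σ i), fun i => conj (negVec σ i)] : Fin 2 → Fin 2 → ℂ) c l := by
  have h := rho_sq hσ
  fin_cases k <;> fin_cases l <;>
    simp [gram, sign, Fin.sum_univ_two, posVec, negVec, conj_rho] <;>
    first | ring1 | linear_combination -h | linear_combination h

/-- In the translated basis, the positive part of the dual tensor restores the deleted factors and
the negative part puts negative vectors in their place. -/
theorem insertion_sect (x : Space S) (hσ : ‖σ‖ < 1) (i : Fin (b (v₀, false)))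
    (j : Fin (b (v₀, true))) :
    insertion v₀ b (v₀, false) i j (sect v₀ (lower b v₀) x σ)
      = ∑ m : Idx 2 b, coeff v₀ m x • (pureTensor 2 b (frameVec v₀ m σ)
        - pureTensor 2 b (Function.update (Function.update (frameVec v₀ m σ)
            ⟨(v₀, false), i⟩ (negVec σ)) ⟨(v₀, true), j⟩ fun k => conj (negVec σ k))) := by
  have hr := removes_keep (b := b) (v₀, false) i j
  rw [sect, map_sum]
  symm
  refine hr.sum_restrictIdx 0 (fun m hm => ?_) fun m hi hj => ?_
  · have hg : Good v₀ m := good_of_coeff fun h => hm (by rw [h, zero_smul])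
    exact ⟨hg.eq_zero _ _, hg.eq_zero _ _⟩
  · have hc := coeff_restrictIdx i j m hi hj x
    by_cases h0 : coeff v₀ m x = 0
    · rw [hc, h0, zero_smul, zero_smul, map_zero]
    · have hg := good_of_coeff h0
      have he := expand_pureTensor hr (gram_eq (v₀ := v₀) hσ) (frameVec v₀ m σ)
      rw [hc, map_smul]
      congr 1
      refine Eq.trans ?_ he.symm
      have e1 : Function.update (Function.update (frameVec v₀ m σ) ⟨(v₀, false), i⟩ (posVec σ))
          ⟨(v₀, true), j⟩ (fun k => conj (posVec σ k)) = frameVec v₀ m σ := by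
        rw [← frameVec_true hg σ j, ← frameVec_false hg σ i, Function.update_eq_self,
          Function.update_eq_self]
      rw [Fin.sum_univ_two]
      simp only [Matrix.cons_val_zero, Matrix.cons_val_one, one_smul, neg_smul]
      rw [← sub_eq_add_neg]
      exact congrArg (fun c => pureTensor 2 b c - _) e1.symm

theorem insertion_true (i : Fin (b (v₀, true))) (j : Fin (b (v₀, false))) :
    insertion v₀ b (v₀, true) i j = insertion v₀ b (v₀, false) j i := by
  have h1 : drop b (v₀, true) i j = drop b (v₀, false) j i := by
    ext m w k : 3
    refine congrArg (m w) (Fin.ext ?_)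
    simp only [bar, Bool.not_true, Bool.not_false]
    split_ifs with h2 h3
    · exact absurd (h2.symm.trans h3) (true_ne_false v₀)
    · rfl
    · rfl
    · rfl
  have h2 : pairing v₀ b (v₀, true) i j = pairing v₀ b (v₀, false) j i := by
    ext m
    show (if m (v₀, true) i = m (v₀, false) j then sign v₀ v₀ (m (v₀, true) i) else 0)
      = if m (v₀, false) j = m (v₀, true) i then sign v₀ v₀ (m (v₀, false) j) else 0
    by_cases h : m (v₀, true) i = m (v₀, false) j
    · rw [if_pos h, if_pos h.symm, h]
    · rw [if_neg h, if_neg (Ne.symm h)]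
  show expand _ _ = expand _ _
  exact congrArg₂ expand h1 h2

/-- A double replacement is nonzero only for one spot of `u₀` and one of `ū₀`. By `insertion_sect`
each of these tensors is the original one minus an insertion, and the number of such pairs is the
coefficient of `sect`. -/
theorem sectMixed_eq (x : Space S) (hσ : ‖σ‖ < 1) :
    sectMixed v₀ b x σ = rho σ ^ 4 • ((b (v₀, false) * b (v₀, true) : ℂ) • sect v₀ b x σ
      - ∑ i, ∑ j, insertion v₀ b (v₀, false) i j (sect v₀ (lower b v₀) x σ)) := by
  have h1 : ∑ i, ∑ j, insertion v₀ b (v₀, false) i j (sect v₀ (lower b v₀) x σ)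
      = ∑ m : Idx 2 b, coeff v₀ m x • ∑ i, ∑ j, (pureTensor 2 b (frameVec v₀ m σ)
        - pureTensor 2 b (Function.update (Function.update (frameVec v₀ m σ)
            ⟨(v₀, false), i⟩ (negVec σ)) ⟨(v₀, true), j⟩ fun k => conj (negVec σ k))) := by
    refine (Finset.sum_congr rfl fun i _ => Finset.sum_congr rfl fun j _ =>
      insertion_sect x hσ i j).trans ?_
    refine (Finset.sum_congr rfl fun i _ => Finset.sum_comm).trans ?_
    refine Finset.sum_comm.trans (Finset.sum_congr rfl fun m _ => ?_)
    simp only [Finset.smul_sum]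
    rfl
  have h2 : ∀ m : Idx 2 b, replaceTwo (frameVec v₀ m σ) (fun s => negAt v₀ σ s.1)
      (fun s => negAtBar v₀ σ s.1) = rho σ ^ 4 • ∑ i, ∑ j,
        pureTensor 2 b (Function.update (Function.update (frameVec v₀ m σ)
            ⟨(v₀, false), i⟩ (negVec σ)) ⟨(v₀, true), j⟩ fun k => conj (negVec σ k)) := by
    intro m
    rw [replaceTwo, Fintype.sum_sigma, Finset.sum_eq_single (v₀, false), Finset.smul_sum]
    · refine Finset.sum_congr rfl fun i _ => ?_
      rw [Fintype.sum_sigma, Finset.sum_eq_single (v₀, true), Finset.smul_sum]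
      · refine Finset.sum_congr rfl fun j _ => ?_
        have h3 : (⟨(v₀, true), j⟩ : Spot b) ≠ ⟨(v₀, false), i⟩ := fun h =>
          true_ne_false v₀ (congrArg Sigma.fst h)
        have h4 : (fun k => conj ((rho σ ^ 2 • negVec σ) k)) = rho σ ^ 2 • fun k => conj (negVec σ k) := by
          ext k
          simp [conj_rho]
        rw [if_neg h3, negAt_false, negAtBar_true, h4, ContinuousMultilinearMap.map_update_smul,
          Function.update_comm h3.symm, ContinuousMultilinearMap.map_update_smul,
          Function.update_comm h3, smul_smul]
        congr 1
        ring
      · intro u _ hu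
        refine Finset.sum_eq_zero fun j _ => ?_
        rw [negAtBar_of_ne hu]
        split_ifs
        · rfl
        · exact ContinuousMultilinearMap.map_coord_zero _ ⟨u, j⟩ (Function.update_self _ _ _)
      · simp
    · intro u _ hu
      refine Finset.sum_eq_zero fun i _ => Finset.sum_eq_zero fun s' _ => ?_
      rw [negAt_of_ne hu]
      split_ifs with h
      · rfl
      · refine ContinuousMultilinearMap.map_coord_zero _ ⟨u, i⟩ ?_
        rw [Function.update_of_ne (Ne.symm h), Function.update_self]
    · simp
  rw [h1, sectMixed, sect, Finset.smul_sum, ← Finset.sum_sub_distrib, Finset.smul_sum]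
  refine Finset.sum_congr rfl fun m _ => ?_
  rw [h2]
  simp only [Finset.sum_sub_distrib, Finset.sum_const, Finset.card_univ, Fintype.card_fin,
    smul_sub, ← Nat.cast_smul_eq_nsmul ℂ]
  module

end Unitary

end FunkeMillson
end

noncomputable section

namespace FunkeMillson

open scoped ComplexConjugate

set_option linter.unusedSectionVars false

namespace Unitary

variable {S : Type*} [Fintype S] [DecidableEq S] {v₀ : S} {b : S × Bool → ℕ} {σ τ : ℂ}

/-! ### The harmonic projection in the unitary case -/

theorem harm_insertion (i : Fin (b (v₀, false))) (j : Fin (b (v₀, true)))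
    (t : Tens 2 (lower b v₀)) : harm v₀ b (insertion v₀ b (v₀, false) i j t) = 0 :=
  harmonicProj_expand (J := Σ v : S, Fin (b (v, false)) × Fin (b (v, true)))
    (drop := fun I => drop b (I.1, false) I.2.1 I.2.2)
    (g := fun I => pairing v₀ b (I.1, false) I.2.1 I.2.2) ⟨v₀, i, j⟩ t

/-- Permutations carry insertions to insertions in the permuted spots, and the transpose of a
permutation is its inverse. -/
theorem harm_comp_permute (π : ∀ u, Equiv.Perm (Fin (b u))) :
    harm v₀ b ∘ₗ permute 2 π = permute 2 π ∘ₗ harm v₀ b := by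
  have key : ∀ (π : ∀ u, Equiv.Perm (Fin (b u)))
      (I : Σ v : S, Fin (b (v, false)) × Fin (b (v, true))) s,
      permute 2 π (expand (drop b (I.1, false) I.2.1 I.2.2)
        (pairing v₀ b (I.1, false) I.2.1 I.2.2) s) ∈
      expansionSpace (ι := Σ v : S, Fin (b (v, false)) × Fin (b (v, true)))
        (fun I => drop b (I.1, false) I.2.1 I.2.2)
        (fun I => pairing v₀ b (I.1, false) I.2.1 I.2.2) := by
    intro π I s
    have h := permute_expand_mem (removes_keep (b := b) (I.1, false) I.2.1 I.2.2)
      (gram v₀ I.1) π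
      (removes_keep (b := b) (I.1, false) (π (I.1, false) I.2.1) (π (I.1, true) I.2.2)) s
    exact Submodule.mem_iSup_of_mem
      (⟨I.1, π (I.1, false) I.2.1, π (I.1, true) I.2.2⟩ :
        Σ v : S, Fin (b (v, false)) × Fin (b (v, true))) h
  exact harmonicProj_comm (permute_transpose π) (key π) (key fun u => (π u).symm)

theorem hodgeTorus_false (σ : ℂ) : hodgeTorus (boostAt v₀) (wt v₀) σ (v₀, false)
    = rho σ ^ 2 • !![1 - 2 * (σ * conj σ), σ; -conj σ, 2 - σ * conj σ] := by
  rw [hodgeTorus, boostAt_false, boost_inv, boost_eq]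
  ext i j
  simp only [Matrix.mul_apply, Fin.sum_univ_two, Matrix.diagonal_apply]
  fin_cases i <;> fin_cases j <;>
    simp [wt_false] <;> ring

theorem hodgeTorus_true (hσ : ‖σ‖ < 1) : hodgeTorus (boostAt v₀) (wt v₀) σ (v₀, true)
    = rho σ ^ 2 • !![1 - σ * conj σ / 2, -conj σ / 2; σ / 2, 1 / 2 - σ * conj σ] := by
  have h2 : (boost σ).map conj * (boost σ)⁻¹.map conj = 1 := by
    rw [← Matrix.map_mul, boost_mul_inv hσ, Matrix.map_one _ (map_zero _) (map_one _)]
  rw [hodgeTorus, boostAt_true, Matrix.inv_eq_right_inv h2, boost_inv, boost_eq]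
  ext i j
  simp only [Matrix.mul_apply, Fin.sum_univ_two, Matrix.diagonal_apply]
  fin_cases i <;> fin_cases j <;>
    simp [wt_true, conj_rho] <;> ring

theorem hodgeTorus_of_ne {u : S × Bool} (hu : u.1 ≠ v₀) :
    hodgeTorus (boostAt v₀) (wt v₀) σ u = 1 := by
  rw [hodgeTorus, boostAt_of_ne hu]
  simp [wt_of_ne hu]

/-- The form pairs type `(p,-p)` of `V_u` only with type `(-p,p)` of `V_ū`, so the torus fixes the
dual tensor. The transposed identity supplies the transposed operator for `harmonicProj_comm`. -/
theorem hodgeTorus_gram (hσ : ‖σ‖ < 1) (v : S) :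
    hodgeTorus (boostAt v₀) (wt v₀) σ (v, false) * (Matrix.of (gram v₀ v)).map Complex.ofReal
      * (hodgeTorus (boostAt v₀) (wt v₀) σ (v, true)).transpose
        = (Matrix.of (gram v₀ v)).map Complex.ofReal ∧
    (hodgeTorus (boostAt v₀) (wt v₀) σ (v, false)).transpose
      * (Matrix.of (gram v₀ v)).map Complex.ofReal
      * (hodgeTorus (boostAt v₀) (wt v₀) σ (v, true)).transpose.transpose
        = (Matrix.of (gram v₀ v)).map Complex.ofReal := by
  by_cases hv : v = v₀
  · subst hv
    have h := rho_sq hσ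
    rw [hodgeTorus_false, hodgeTorus_true hσ]
    constructor
    -- With `a = ρ² (1 - σσ̄)`, the diagonal entries amount to `a² = 1`; the coefficients below are
    -- from `a² - 1 = (a + 1)(a - 1)`.
    all_goals
      ext i j
      simp only [Matrix.mul_apply, Fin.sum_univ_two, Matrix.transpose_apply, Matrix.map_apply,
        Matrix.of_apply]
      fin_cases i <;> fin_cases j <;> simp [gram, sign] <;>
        first
        | ring1
        | linear_combination (rho σ ^ 2 * (1 - σ * conj σ) + 1) * h
        | linear_combination -(rho σ ^ 2 * (1 - σ * conj σ) + 1) * h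
  · rw [hodgeTorus_of_ne hv, hodgeTorus_of_ne hv]
    simp

theorem hodgeProj_comp_harm (hσ : ‖σ‖ < 1) (q : ℤ) :
    hodgeProj b (boostAt v₀) (wt v₀) q σ ∘ₗ harm v₀ b
      = harm v₀ b ∘ₗ hodgeProj b (boostAt v₀) (wt v₀) q σ := by
  refine hodgeProj_comm (fun u => boostAt_mul_inv hσ u) ?_ q
  refine harmonicProj_comm (tensorMap_transpose _) ?_ ?_
  · rintro I s
    have h := tensorMap_expand (removes_keep (b := b) (I.1, false) I.2.1 I.2.2)
      (hodgeTorus (boostAt v₀) (wt v₀) σ) (fun _ => rfl) (hodgeTorus_gram hσ I.1).1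
    exact Submodule.mem_iSup_of_mem I ⟨_, (LinearMap.congr_fun h s).symm⟩
  · rintro I s
    have h := tensorMap_expand (removes_keep (b := b) (I.1, false) I.2.1 I.2.2)
      (fun u => (hodgeTorus (boostAt v₀) (wt v₀) σ u).transpose) (fun _ => rfl)
      (hodgeTorus_gram hσ I.1).2
    exact Submodule.mem_iSup_of_mem I ⟨_, (LinearMap.congr_fun h s).symm⟩

/-- `sect` is the translate of a tensor whose components depend on multiplicities only. -/
theorem permute_sect (π : ∀ u, Equiv.Perm (Fin (b u))) (x : Space S) :
    permute 2 π (sect v₀ b x σ) = sect v₀ b x σ := by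
  have h : sect v₀ b x σ
      = tensorMap b (fun u _ => boostAt v₀ u σ) (fun m => coeff v₀ m x) := by
    rw [tensorMap_eq_sum]
    rfl
  rw [h, permute_tensorMap]
  congr 1
  ext m
  rw [permute_apply, coeff, coeff]
  have hg : Good v₀ (fun u k => m u (π u k)) ↔ Good v₀ m :=
    ⟨fun h u k => by simpa using h u ((π u).symm k), fun h u k => h u (π u k)⟩
  have ha : away v₀ (fun u k => m u (π u k)) x = away v₀ m x := by
    simp only [away, multiplicity_permute]
  by_cases hm : Good v₀ m
  · rw [if_pos hm, if_pos (hg.2 hm), ha]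
  · rw [if_neg hm, if_neg fun h => hm (hg.1 h)]

theorem symmetrizer_harm_sect (x : Space S) :
    symmetrizer 2 b (harm v₀ b (sect v₀ b x σ)) = harm v₀ b (sect v₀ b x σ) := by
  refine symmetrizer_eq_self fun π => ?_
  have h := LinearMap.congr_fun (harm_comp_permute (v₀ := v₀) π) (sect v₀ b x σ)
  simp only [LinearMap.comp_apply, permute_sect] at h
  exact h.symm

/-! ### The main result in the unitary case -/

theorem weilL_phi (v₀ : S) (b : S × Bool → ℕ) (x : Space S) (hτ : ‖τ‖ < 1) :
    weilL v₀ (fun y => phi v₀ b y τ) x = -DDc v₀ b (nu v₀ b x) τ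
      + (1 / (4 * Real.pi) : ℂ) •
        ((∑ i, ∑ j, (realCLM (insertion v₀ b (v₀, false) i j)).compContinuousAlternatingMap
            (phi v₀ (lower b v₀) x τ))
        + ∑ i, ∑ j, (realCLM (insertion v₀ b (v₀, true) i j)).compContinuousAlternatingMap
            (phi v₀ (lower b v₀) x τ)) := by
  have hsum : ∑ i, ∑ j, (realCLM (insertion v₀ b (v₀, true) i j)).compContinuousAlternatingMap
        (phi v₀ (lower b v₀) x τ)
      = ∑ i, ∑ j, (realCLM (insertion v₀ b (v₀, false) i j)).compContinuousAlternatingMap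
        (phi v₀ (lower b v₀) x τ) := by
    rw [Finset.sum_comm]
    refine Finset.sum_congr rfl fun i _ => Finset.sum_congr rfl fun j _ => ?_
    exact congrArg (fun L => (realCLM L).compContinuousAlternatingMap
      (phi v₀ (lower b v₀) x τ)) (insertion_true j i)
  have hins : ∑ i, ∑ j, (realCLM (insertion v₀ b (v₀, false) i j)).compContinuousAlternatingMap
        (phi v₀ (lower b v₀) x τ) = areaForm ((Complex.I * rho τ ^ 4 *
          radial (b (v₀, false)) (b (v₀, true)) (x v₀) τ) •
        ∑ i, ∑ j, insertion v₀ b (v₀, false) i j (sect v₀ (lower b v₀) x τ)) := by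
    simp only [Finset.smul_sum, areaForm_sum]
    refine Finset.sum_congr rfl fun i _ => Finset.sum_congr rfl fun j _ => ?_
    -- The spots `i` and `j` exist, so the truncated subtraction in `lower` is exact here.
    have hi : lower b v₀ (v₀, false) + 1 = b (v₀, false) := by
      have := i.2
      simp only [lower, if_true]
      omega
    have hj : lower b v₀ (v₀, true) + 1 = b (v₀, true) := by
      have h : j.1 < b (v₀, true) := j.2
      simp only [lower, if_true]
      omega
    rw [phi_eq v₀ (lower b v₀) x hτ, hi, hj, map_areaForm, map_smul]
  have hphi : (fun y => phi v₀ b y τ) = fun y => areaForm ((Complex.I * rho τ ^ 4 *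
      radial (b (v₀, false) + 1) (b (v₀, true) + 1) (y v₀) τ)
        • LinearMap.id (R := ℂ) (sect v₀ b y τ)) := by
    ext1 y
    exact phi_eq v₀ b y hτ
  rw [hsum, hins, hphi, weilL_radial_smul v₀ b x hτ, nu_eq]
  have hD := DDc_radial_smul v₀ b x (T := LinearMap.id) (fun σ _ q => rfl) hτ
  simp only [LinearMap.id_apply] at hD ⊢
  rw [hD, sectMixed_eq x hτ, ← areaForm_add, ← areaForm_smul, ← areaForm_neg, ← areaForm_add]
  congr 1
  simp only [Nat.add_sub_cancel]
  generalize ∑ i, ∑ j, insertion v₀ b (v₀, false) i j (sect v₀ (lower b v₀) x τ) = t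
  -- The coefficients of `sect` agree by `2(p + q + 1) + 2pq = 2(p + 1)(q + 1)`; those of the
  -- insertions cancel, the two equal double sums with factor `1/(4π)` against the mixed term of
  -- `DD^c`.
  match_scalars
  · field_simp [pi_ne_zero']
    ring_nf
    simp only [Complex.I_sq]
    ring
  · field_simp [pi_ne_zero']
    ring_nf
    simp only [Complex.I_sq]
    ring

theorem weilL_phiHarm (v₀ : S) (b : S × Bool → ℕ) (x : Space S) (hτ : ‖τ‖ < 1) :
    weilL v₀ (fun y => phiHarm v₀ b y τ) x = -DDc v₀ b (nuHarm v₀ b x) τ := by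
  have h1 : (fun y => phiHarm v₀ b y τ) = fun y => areaForm ((Complex.I * rho τ ^ 4 *
      radial (b (v₀, false) + 1) (b (v₀, true) + 1) (y v₀) τ) • harm v₀ b (sect v₀ b y τ)) := by
    ext1 y
    rw [phiHarm, phi_eq v₀ b y hτ, map_areaForm, map_smul, LinearMap.comp_apply,
      symmetrizer_harm_sect]
  have h2 : nuHarm v₀ b x = fun σ =>
      radial (b (v₀, false)) (b (v₀, true)) (x v₀) σ • harm v₀ b (sect v₀ b x σ) := by
    ext1 σ
    rw [nuHarm, nu_eq, map_smul]
  have h3 : harm v₀ b (sectMixed v₀ b x τ)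
      = (rho τ ^ 4 * (b (v₀, false) * b (v₀, true))) • harm v₀ b (sect v₀ b x τ) := by
    have h : harm v₀ b (∑ i, ∑ j, insertion v₀ b (v₀, false) i j (sect v₀ (lower b v₀) x τ)) = 0 := by
      simp only [map_sum]
      exact Finset.sum_eq_zero fun i _ => Finset.sum_eq_zero fun j _ => harm_insertion i j _
    rw [sectMixed_eq x hτ, map_smul, map_sub, map_smul, h, sub_zero, smul_smul]
  rw [h1, weilL_radial_smul v₀ b x hτ, h2,
    DDc_radial_smul v₀ b x (fun σ hσ q => hodgeProj_comp_harm hσ q) hτ, h3, ← areaForm_neg]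
  congr 1
  simp only [Nat.add_sub_cancel, smul_smul, ← add_smul, ← neg_smul]
  congr 1
  push_cast
  field_simp [pi_ne_zero']
  ring_nf
  simp only [Complex.I_sq]
  ring

end Unitary

end FunkeMillson
end

noncomputable section

namespace FunkeMillson

open scoped ComplexConjugate

set_option linter.unusedSectionVars false

theorem hasWirt_hermR (p : ℕ) (z : ℂ) :
    HasWirt (hermR p) (2 * Real.pi * z * hermR p z - 4 * Real.pi * hermR (p + 1) z) 0 z := by
  refine (hasWirt_of_hasDerivAt (hasDerivAt_hermR p z)).congr ?_ rfl
  have h := mul_hermR p z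
  field_simp [pi_ne_zero'] at h
  linear_combination -h

namespace Orthogonal

/-! ### The moving frame of the orthogonal case -/

/-- The inverse of `1 - |σ|²`. -/
def rad (σ : ℂ) : ℂ := (((1 - ‖σ‖ ^ 2)⁻¹ : ℝ) : ℂ)

variable {σ : ℂ}

theorem conj_rad (σ : ℂ) : conj (rad σ) = rad σ := Complex.conj_ofReal _

theorem one_sub_sq (σ : ℂ) : ((1 - ‖σ‖ ^ 2 : ℝ) : ℂ) = 1 - σ * conj σ := by
  rw [Complex.mul_conj, Complex.normSq_eq_norm_sq]
  push_cast
  ring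

theorem rad_eq (hσ : ‖σ‖ < 1) : rad σ * (1 - σ * conj σ) = 1 := by
  have h : 0 < 1 - ‖σ‖ ^ 2 := by nlinarith [norm_nonneg σ]
  rw [rad, ← one_sub_sq, ← Complex.ofReal_mul, inv_mul_cancel₀ h.ne', Complex.ofReal_one]

theorem hasWirt_rad (hσ : ‖σ‖ < 1) :
    HasWirt rad (conj σ * rad σ ^ 2) (σ * rad σ ^ 2) σ := by
  have h0 : 1 - σ * conj σ ≠ 0 := right_ne_zero_of_mul_eq_one (rad_eq hσ)
  have h1 : HasWirt (fun σ => 1 - σ * conj σ) (-conj σ) (-σ) σ :=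
    ((hasWirt_const 1).sub (hasWirt_id.mul hasWirt_conj)).congr (by simp) (by simp)
  have h2 := HasWirt.comp (g := fun z => z⁻¹) (f := fun σ => 1 - σ * conj σ)
    (hasWirt_of_hasDerivAt (hasDerivAt_inv h0)) h1
  have h3 : rad = fun σ => (1 - σ * conj σ)⁻¹ := by
    ext w
    rw [← one_sub_sq, rad, Complex.ofReal_inv]
  have h4 : (1 - σ * conj σ)⁻¹ = rad σ := by rw [h3]
  rw [← inv_pow, h4] at h2
  rw [← h3] at h2
  exact h2.congr (by simp) (by simp)

/-- The sign of the first and the third coordinate of `flip e`. -/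
def sgn (e : Bool) : ℂ := if e then -1 else 1

theorem conj_sgn (e : Bool) : conj (sgn e) = sgn e := by cases e <;> simp [sgn]

/-- The first coordinate of the translate of `w` to the base point. -/
def axis (e : Bool) (w : Fin 3 → ℝ) (σ : ℂ) : ℂ :=
  rad σ * ((1 + σ * conj σ) * (sgn e * w 0) - conj σ * (w 1 + Complex.I * (sgn e * w 2))
    - σ * (w 1 - Complex.I * (sgn e * w 2)))

/-- The last two coordinates of the translate of `w` to the base point, as a complex number. -/
def plane (e : Bool) (w : Fin 3 → ℝ) (σ : ℂ) : ℂ :=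
  rad σ * (-2 * σ * (sgn e * w 0) + (w 1 + Complex.I * (sgn e * w 2))
    + σ ^ 2 * (w 1 - Complex.I * (sgn e * w 2)))

/-- The translate of `e_1`. -/
def posVec (e : Bool) (σ : ℂ) : Fin 3 → ℂ :=
  ![sgn e * (rad σ * (1 + σ * conj σ)), rad σ * (σ + conj σ),
    sgn e * (-Complex.I * (rad σ * (σ - conj σ)))]

/-- A vector on the isotropic line at `σ`. -/
def isoVec (e : Bool) (σ : ℂ) : Fin 3 → ℂ :=
  ![sgn e * (rad σ ^ 2 * (2 * σ)), rad σ ^ 2 * (1 + σ ^ 2),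
    sgn e * (Complex.I * (rad σ ^ 2 * (1 - σ ^ 2)))]

/-- The complex conjugate of `isoVec`. -/
def isoVecBar (e : Bool) (σ : ℂ) : Fin 3 → ℂ :=
  ![sgn e * (rad σ ^ 2 * (2 * conj σ)), rad σ ^ 2 * (1 + conj σ ^ 2),
    sgn e * (-Complex.I * (rad σ ^ 2 * (1 - conj σ ^ 2)))]

/-- The first coordinate is unaffected by rotations of the negative plane, so no connection term
appears. -/
theorem hasWirt_axis (hσ : ‖σ‖ < 1) (e : Bool) (w : Fin 3 → ℝ) : HasWirt (axis e w)
    (-(rad σ * conj (plane e w σ))) (-(rad σ * plane e w σ)) σ := by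
  have h1 := hasWirt_id (τ := σ)
  have h2 := hasWirt_conj (τ := σ)
  have h := (hasWirt_rad hσ).mul ((((hasWirt_const 1).add (h1.mul h2)).mul
    (hasWirt_const (sgn e * w 0))).sub (h2.mul
      (hasWirt_const (w 1 + Complex.I * (sgn e * w 2)))) |>.sub (h1.mul
      (hasWirt_const (w 1 - Complex.I * (sgn e * w 2)))))
  have h0 := rad_eq hσ
  refine h.congr ?_ ?_ <;> simp only [plane, map_mul, map_add, map_sub, map_neg, map_pow, conj_rad,
    conj_sgn, Complex.conj_I, Complex.conj_ofReal, map_ofNat]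
  · linear_combination (-rad σ * (conj σ * (sgn e * w 0) - (w 1 - Complex.I * (sgn e * w 2)))) * h0
  · linear_combination (-rad σ * (σ * (sgn e * w 0) - (w 1 + Complex.I * (sgn e * w 2)))) * h0

theorem hasWirt_plane (hσ : ‖σ‖ < 1) (e : Bool) (w : Fin 3 → ℝ) : HasWirt (plane e w)
    (-(2 * rad σ * axis e w σ) - rad σ * conj σ * plane e w σ) (rad σ * σ * plane e w σ) σ := by
  have h1 := hasWirt_id (τ := σ)
  have h := (hasWirt_rad hσ).mul (((h1.const_mul (-2)).mul
    (hasWirt_const (sgn e * w 0))).add (hasWirt_const (w 1 + Complex.I * (sgn e * w 2))) |>.add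
      ((h1.mul h1).mul (hasWirt_const (w 1 - Complex.I * (sgn e * w 2)))))
  simp only [← sq] at h
  have h0 := rad_eq hσ
  refine h.congr ?_ ?_ <;> simp only [plane, axis]
  · linear_combination (2 * rad σ * ((sgn e * w 0) - σ * (w 1 - Complex.I * (sgn e * w 2)))) * h0
  · ring

/-- The isotropic line is holomorphic and orthogonal to the real unit vector `posVec`. Hence the
derivative along `τ̄` is orthogonal both to that line and to `posVec`, and so lies on the line; the
other derivative is its complex conjugate. -/
theorem hasWirt_posVec (hσ : ‖σ‖ < 1) (e : Bool) : HasWirt (posVec e)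
    (isoVecBar e σ) (isoVec e σ) σ := by
  have h1 := hasWirt_id (τ := σ)
  have h2 := hasWirt_conj (τ := σ)
  have h0 := rad_eq hσ
  have hr := hasWirt_rad hσ
  refine hasWirt_pi fun i => ?_
  fin_cases i
  · refine ((hr.mul ((hasWirt_const 1).add (h1.mul h2))).const_mul (sgn e)).congr ?_ ?_ <;>
      simp [isoVec, isoVecBar]
    · left; linear_combination (-rad σ * conj σ) * h0
    · left; linear_combination (-rad σ * σ) * h0
  · refine (hr.mul (h1.add h2)).congr ?_ ?_ <;> simp [isoVec, isoVecBar]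
    · linear_combination (-rad σ) * h0
    · linear_combination (-rad σ) * h0
  · refine ((hr.mul (h1.sub h2)).const_mul (-Complex.I) |>.const_mul (sgn e)).congr ?_ ?_ <;>
      simp [isoVec, isoVecBar]
    · left; linear_combination (-rad σ) * h0
    · linear_combination (-sgn e * Complex.I * rad σ) * h0

/-- The derivative is a multiple of `posVec` alone: there is no connection term with the
normalization `rad σ ^ 2`. -/
theorem hasWirt_isoVec (hσ : ‖σ‖ < 1) (e : Bool) : ∃ d, HasWirt (isoVec e)
    ((2 * rad σ ^ 2) • posVec e σ) d σ := by
  have h1 := hasWirt_id (τ := σ)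
  have h0 := rad_eq hσ
  have hr := (hasWirt_rad hσ).mul (hasWirt_rad hσ)
  simp only [← sq] at hr
  have hs := h1.mul h1
  simp only [← sq] at hs
  suffices h : ∀ i, ∃ d, HasWirt (fun σ => isoVec e σ i) (((2 * rad σ ^ 2) • posVec e σ) i) d σ by
    choose d hd using h
    exact ⟨d, hasWirt_pi hd⟩
  intro i
  fin_cases i
  · refine ⟨_, ((hr.mul (h1.const_mul 2)).const_mul (sgn e)).congr ?_ rfl⟩
    simp [posVec]
    linear_combination (-2 * sgn e * rad σ ^ 2) * h0
  · refine ⟨_, (hr.mul ((hasWirt_const 1).add hs)).congr ?_ rfl⟩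
    simp [posVec]
    linear_combination (-2 * rad σ ^ 2 * σ) * h0
  · refine ⟨_, ((hr.mul ((hasWirt_const 1).sub hs)).const_mul Complex.I |>.const_mul
      (sgn e)).congr ?_ rfl⟩
    simp [posVec]
    linear_combination (2 * sgn e * Complex.I * rad σ ^ 2 * σ) * h0

theorem hasWirt_isoVecBar (hσ : ‖σ‖ < 1) (e : Bool) : ∃ d, HasWirt (isoVecBar e) d
    ((2 * rad σ ^ 2) • posVec e σ) σ := by
  obtain ⟨d, hd⟩ := hasWirt_isoVec hσ e
  have h : isoVecBar e = fun σ i => conj (isoVec e σ i) := by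
    ext σ i
    fin_cases i <;> simp [isoVec, isoVecBar, conj_rad, conj_sgn, map_ofNat]
  rw [h]
  refine ⟨_, (Unitary.HasWirt.starPi hd).congr rfl ?_⟩
  ext i
  fin_cases i <;> simp [posVec, conj_rad, conj_sgn, map_ofNat] <;> ring_nf <;> simp

end Orthogonal

end FunkeMillson
end

noncomputable section

namespace FunkeMillson

open scoped ComplexConjugate

set_option linter.unusedSectionVars false

/-! ### Boosts, Hodge types and structure equations in the orthogonal case. -/

namespace Orthogonal

variable {S : Type*} [Fintype S] [DecidableEq S] {v₀ : S} {b : S → ℕ} {e : Bool} {m : Idx 3 b}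
  {σ τ : ℂ}

theorem move_eq (e : Bool) (σ : ℂ) : move e σ = (1 - ‖σ‖ ^ 2)⁻¹ •
    !![(if e then -1 else 1) * (1 + σ.re ^ 2 + σ.im ^ 2), (if e then -1 else 1) * (2 * σ.re),
        (if e then -1 else 1) * (2 * σ.im);
      2 * σ.re, 1 + σ.re ^ 2 - σ.im ^ 2, 2 * (σ.re * σ.im);
      (if e then -1 else 1) * (2 * σ.im), (if e then -1 else 1) * (2 * (σ.re * σ.im)),
        (if e then -1 else 1) * (1 - σ.re ^ 2 + σ.im ^ 2)] := by
  have h : ‖σ‖ ^ 2 = σ.re ^ 2 + σ.im ^ 2 := by rw [Complex.sq_norm, Complex.normSq_apply]; ring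
  rw [move, boost, h, Matrix.mul_smul]
  congr 1
  cases e <;> ext i j <;> fin_cases i <;> fin_cases j <;>
    simp [flip, line, sq, Matrix.mul_apply, Fin.sum_univ_three] <;> ring

/-- The inverse of `move e σ`. -/
def back (e : Bool) (σ : ℂ) : Matrix (Fin 3) (Fin 3) ℝ := (1 - ‖σ‖ ^ 2)⁻¹ •
  !![(if e then -1 else 1) * (1 + σ.re ^ 2 + σ.im ^ 2), -(2 * σ.re),
      -((if e then -1 else 1) * (2 * σ.im));
    -((if e then -1 else 1) * (2 * σ.re)), 1 + σ.re ^ 2 - σ.im ^ 2,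
      (if e then -1 else 1) * (2 * (σ.re * σ.im));
    -((if e then -1 else 1) * (2 * σ.im)), 2 * (σ.re * σ.im),
      (if e then -1 else 1) * (1 - σ.re ^ 2 + σ.im ^ 2)]

theorem move_mul_back (e : Bool) (h0 : 1 - ‖σ‖ ^ 2 ≠ 0) : move e σ * back e σ = 1 := by
  have h : ‖σ‖ ^ 2 = σ.re ^ 2 + σ.im ^ 2 := by rw [Complex.sq_norm, Complex.normSq_apply]; ring
  have h1 := inv_mul_cancel₀ h0
  rw [back, move_eq, Matrix.smul_mul, Matrix.mul_smul, smul_smul]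
  generalize (1 - ‖σ‖ ^ 2)⁻¹ = r at h1
  rw [h] at h1
  cases e <;> ext i j <;>
    simp only [Matrix.smul_apply, Matrix.mul_apply, Fin.sum_univ_three, smul_eq_mul] <;>
    fin_cases i <;> fin_cases j <;> simp <;>
    first
    | (right; ring1)
    | linear_combination (r * (1 - (σ.re ^ 2 + σ.im ^ 2)) + 1) * h1

/-- On the unit circle the scalar factor is `0` and both sides vanish, so the formula needs no
restriction on `σ`. -/
theorem move_inv (e : Bool) (σ : ℂ) : (move e σ)⁻¹ = back e σ := by
  by_cases h0 : 1 - ‖σ‖ ^ 2 = 0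
  · rw [move_eq, back, h0, inv_zero, zero_smul, zero_smul, Matrix.inv_zero]
  · exact Matrix.inv_eq_right_inv (move_mul_back e h0)

theorem move_mul_inv (hσ : ‖σ‖ < 1) (e : Bool) : move e σ * (move e σ)⁻¹ = 1 := by
  rw [move_inv, move_mul_back]
  nlinarith [norm_nonneg σ]

theorem move_col_zero (e : Bool) (σ : ℂ) (i : Fin 3) :
    (move e σ i 0 : ℂ) = posVec e σ i := by
  rw [move_eq, Matrix.smul_apply, smul_eq_mul, Complex.ofReal_mul, ← rad]
  cases e <;> fin_cases i <;> apply Complex.ext <;>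
    simp [posVec, sgn, rad, sq] <;> ring_nf <;> simp

theorem isoVec_eq (e : Bool) (σ : ℂ) (i : Fin 3) :
    isoVec e σ i = rad σ * (move e σ i 1 + Complex.I * move e σ i 2) := by
  rw [move_eq, Matrix.smul_apply, Matrix.smul_apply, smul_eq_mul, smul_eq_mul, Complex.ofReal_mul,
    Complex.ofReal_mul, ← rad]
  cases e <;> fin_cases i <;> apply Complex.ext <;>
    simp [isoVec, sgn, rad, sq] <;> ring

theorem isoVecBar_eq (e : Bool) (σ : ℂ) (i : Fin 3) :
    isoVecBar e σ i = rad σ * (move e σ i 1 - Complex.I * move e σ i 2) := by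
  rw [move_eq, Matrix.smul_apply, Matrix.smul_apply, smul_eq_mul, smul_eq_mul, Complex.ofReal_mul,
    Complex.ofReal_mul, ← rad]
  cases e <;> fin_cases i <;> apply Complex.ext <;>
    simp [isoVecBar, sgn, rad, sq] <;> ring

theorem move_inv_axis (e : Bool) (σ : ℂ) (w : Fin 3 → ℝ) :
    (((move e σ)⁻¹.mulVec w 0 : ℝ) : ℂ) = axis e w σ := by
  rw [move_inv, back, Matrix.smul_mulVec, Pi.smul_apply, smul_eq_mul, Complex.ofReal_mul, ← rad, axis]
  congr 1
  cases e <;> apply Complex.ext <;>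
    simp [Matrix.mulVec, dotProduct, Fin.sum_univ_three, sgn, sq] <;> ring

theorem move_inv_plane (e : Bool) (σ : ℂ) (w : Fin 3 → ℝ) :
    (((move e σ)⁻¹.mulVec w 1 : ℝ) : ℂ) + Complex.I * ((move e σ)⁻¹.mulVec w 2 : ℝ)
      = plane e w σ := by
  rw [move_inv, back, Matrix.smul_mulVec, Pi.smul_apply, Pi.smul_apply, smul_eq_mul, smul_eq_mul,
    Complex.ofReal_mul, Complex.ofReal_mul, ← rad, plane, mul_left_comm Complex.I, ← mul_add]
  congr 1
  cases e <;> apply Complex.ext <;>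
    simp [Matrix.mulVec, dotProduct, Fin.sum_univ_three, sgn, sq] <;> ring

theorem moveAt_self (e : Bool) (σ : ℂ) :
    moveAt v₀ e v₀ σ = (move e σ).map Complex.ofReal := if_pos rfl

theorem moveAt_of_ne {v : S} (hv : v ≠ v₀) (e : Bool) (σ : ℂ) : moveAt v₀ e v σ = 1 := if_neg hv

theorem wt_self (j : Fin 3) : wt v₀ v₀ j = (![0, 1, -1] : Fin 3 → ℤ) j := if_pos rfl

theorem wt_of_ne {v : S} (hv : v ≠ v₀) (j : Fin 3) : wt v₀ v j = 0 := if_neg hv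

theorem iso_mul_inv : (!![1, 0, 0; 0, 1, 1; 0, Complex.I, -Complex.I] : Matrix (Fin 3) (Fin 3) ℂ)
    * !![1, 0, 0; 0, 1 / 2, -Complex.I / 2; 0, 1 / 2, Complex.I / 2] = 1 := by
  ext i j
  simp only [Matrix.mul_apply, Fin.sum_univ_three]
  fin_cases i <;> fin_cases j <;> simp <;> ring_nf <;> simp [Complex.I_sq]

theorem moveAt_mul (hσ : ‖σ‖ < 1) (e : Bool) (v : S) :
    moveAt v₀ e v σ * (if v = v₀ then (move e σ)⁻¹.map Complex.ofReal else 1) = 1 := by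
  by_cases hv : v = v₀
  · rw [hv, moveAt_self, if_pos rfl]
    have h := congrArg (fun M : Matrix (Fin 3) (Fin 3) ℝ => M.map Complex.ofRealHom)
      (move_mul_inv hσ e)
    simp only [Matrix.map_mul, Matrix.map_one _ (map_zero _) (map_one _)] at h
    exact h
  · rw [moveAt_of_ne hv, if_neg hv, one_mul]

theorem frame_inv (hσ : ‖σ‖ < 1) (e : Bool) (v : S) : (frame v₀ e v σ)⁻¹
    = !![1, 0, 0; 0, 1 / 2, -Complex.I / 2; 0, 1 / 2, Complex.I / 2]
      * (if v = v₀ then (move e σ)⁻¹.map Complex.ofReal else 1) := by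
  refine Matrix.inv_eq_right_inv ?_
  rw [frame, Matrix.mul_assoc, ← Matrix.mul_assoc !![1, 0, 0; 0, 1, 1; 0, Complex.I, -Complex.I],
    iso_mul_inv, Matrix.one_mul, moveAt_mul hσ]

theorem frame_mul_inv (hσ : ‖σ‖ < 1) (e : Bool) (v : S) :
    frame v₀ e v σ * (frame v₀ e v σ)⁻¹ = 1 := by
  rw [frame_inv hσ, frame, Matrix.mul_assoc,
    ← Matrix.mul_assoc !![1, 0, 0; 0, 1, 1; 0, Complex.I, -Complex.I],
    iso_mul_inv, Matrix.one_mul, moveAt_mul hσ]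

/-- The translates of the basis vectors prescribed by `m`. -/
def frameVec (v₀ : S) (e : Bool) (m : Idx 3 b) (σ : ℂ) (s : Spot b) (i : Fin 3) : ℂ :=
  moveAt v₀ e s.1 σ i (m s.1 s.2)

/-- The derivatives of `posVec`, at the spots of `v₀`. -/
def isoAt (v₀ : S) (e : Bool) (σ : ℂ) (v : S) : Fin 3 → ℂ := if v = v₀ then isoVec e σ else 0

/-- The complex conjugate of `isoAt`. -/
def isoAtBar (v₀ : S) (e : Bool) (σ : ℂ) (v : S) : Fin 3 → ℂ :=
  if v = v₀ then isoVecBar e σ else 0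

/-- The multi-indices that occur in `ν_b` and `φ_b`: only `e_1` occurs at `v₀`. -/
def Good (v₀ : S) (m : Idx 3 b) : Prop := ∀ v k, ¬ (v = v₀ ∧ m v k ≠ 0)

theorem Good.eq_zero (hm : Good v₀ m) (k : Fin (b v₀)) : m v₀ k = 0 :=
  not_not.1 fun h => hm v₀ k ⟨rfl, h⟩

theorem frameVec_self (hm : Good v₀ m) (e : Bool) (σ : ℂ) (k : Fin (b v₀)) :
    frameVec v₀ e m σ ⟨v₀, k⟩ = posVec e σ := by
  ext i
  rw [← move_col_zero, frameVec, hm.eq_zero k, moveAt_self, Matrix.map_apply]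

theorem frameVec_of_ne {s : Spot b} (hs : s.1 ≠ v₀) (e : Bool) (σ : ℂ) :
    frameVec v₀ e m σ s = Pi.single (m s.1 s.2) 1 := by
  ext i
  simp [frameVec, moveAt, hs, Matrix.one_apply, Pi.single_apply]

theorem vecType_frameVec (hm : Good v₀ m) (hσ : ‖σ‖ < 1) (s : Spot b) :
    VecType (frame v₀ e) (wt v₀) σ s.1 0 (frameVec v₀ e m σ s) := by
  obtain ⟨v, k⟩ := s
  by_cases hv : v = v₀
  · subst hv
    refine VecType.of_mulVec (frame_mul_inv hσ e _) (x := Pi.single 0 1) ?_ fun j hj => ?_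
    · ext i
      rw [frameVec_self hm, ← move_col_zero]
      simp [frame, moveAt_self, Matrix.mul_apply, Fin.sum_univ_three]
    · refine Pi.single_eq_of_ne (fun h => hj ?_) _
      simp [h, wt_self]
  · exact fun j hj => absurd (wt_of_ne hv j) hj

theorem vecType_isoAt (hσ : ‖σ‖ < 1) (v : S) :
    VecType (frame v₀ e) (wt v₀) σ v 1 (isoAt v₀ e σ v) := by
  rw [isoAt]
  split_ifs with h
  · subst h
    refine VecType.of_mulVec (frame_mul_inv hσ e _) (x := Pi.single 1 (rad σ)) ?_ fun j hj => ?_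
    · ext i
      rw [isoVec_eq]
      simp [frame, moveAt_self, Matrix.mul_apply, Fin.sum_univ_three]
      ring
    · refine Pi.single_eq_of_ne (fun h => hj ?_) _
      simp [h, wt_self]
  · exact VecType.zero

theorem vecType_isoAtBar (hσ : ‖σ‖ < 1) (v : S) :
    VecType (frame v₀ e) (wt v₀) σ v (-1) (isoAtBar v₀ e σ v) := by
  rw [isoAtBar]
  split_ifs with h
  · subst h
    refine VecType.of_mulVec (frame_mul_inv hσ e _) (x := Pi.single 2 (rad σ)) ?_ fun j hj => ?_
    · ext i
      rw [isoVecBar_eq]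
      simp [frame, moveAt_self, Matrix.mul_apply, Fin.sum_univ_three]
      ring
    · refine Pi.single_eq_of_ne (fun h => hj ?_) _
      simp [h, wt_self]
  · exact VecType.zero

/-- The contribution of the places different from `v₀`. -/
def away (v₀ : S) (m : Idx 3 b) (x : Space S) : ℂ :=
  ∏ v ∈ Finset.univ.erase v₀, ∏ j, hermR (multiplicity m v j) (x v j)

/-- The coefficient of `ν_b` at `m`, up to a factor that only depends on the component at `v₀`. -/
def coeff (v₀ : S) (m : Idx 3 b) (x : Space S) : ℂ :=
  open Classical in if Good v₀ m then away v₀ m x else 0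

theorem good_of_coeff {x : Space S} (h : coeff v₀ m x ≠ 0) : Good v₀ m := by
  by_contra h'
  exact h (if_neg h')

/-- The section to which `ν_b` and the coefficients of `φ_b` are proportional. -/
def sect (v₀ : S) (b : S → ℕ) (e : Bool) (x : Space S) (σ : ℂ) : Tens 3 b :=
  ∑ m : Idx 3 b, coeff v₀ m x • pureTensor 3 b (frameVec v₀ e m σ)

/-- The mixed second derivative of `sect`, up to multiples of `sect`. -/
def sectMixed (v₀ : S) (b : S → ℕ) (e : Bool) (x : Space S) (σ : ℂ) : Tens 3 b :=
  ∑ m : Idx 3 b, coeff v₀ m x •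
    replaceTwo (frameVec v₀ e m σ) (fun s => isoAt v₀ e σ s.1) (fun s => isoAtBar v₀ e σ s.1)

/-- Rotations of the plane fix `e_1`, so the connection is zero. Unlike in the unitary case, every
spot of `v₀` moves in both directions `(1,-1)` and `(-1,1)` and contributes to `K` as well as to
`K'`. -/
theorem movingFrame_sect (v₀ : S) (b : S → ℕ) (e : Bool) (x : Space S) :
    ∃ X Y, MovingFrame b (frame v₀ e) (wt v₀) (sect v₀ b e x) X Y (sectMixed v₀ b e x)
      (fun _ => 0) (fun _ => 0)
      (fun σ => b v₀ * (2 * rad σ ^ 2)) (fun σ => b v₀ * (2 * rad σ ^ 2)) := by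
  have h := movingFrame_pureTensor (b := b) (F := frame v₀ e) (wt := wt v₀)
    (ω := fun m => coeff v₀ m x) (c := frameVec v₀ e)
    (x := fun σ s => isoAt v₀ e σ s.1) (y := fun σ s => isoAtBar v₀ e σ s.1)
    (α := fun σ s => 0) (α' := fun σ s => 0)
    (κ := fun σ s => if s.1 = v₀ then 2 * rad σ ^ 2 else 0)
    (κ' := fun σ s => if s.1 = v₀ then 2 * rad σ ^ 2 else 0)
    (fun u σ hσ => frame_mul_inv hσ e u)
    (fun m hm σ hσ s => vecType_frameVec (good_of_coeff hm) hσ s)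
    (fun σ hσ s => vecType_isoAt hσ s.1) (fun σ hσ s => vecType_isoAtBar hσ s.1) ?_ ?_ ?_
  · have hs : ∀ a : ℂ, ∑ s : Spot b, (if s.1 = v₀ then a else 0) = b v₀ * a := fun a => by
      rw [sum_spot (b := b) fun v => if v = v₀ then a else 0]
      simp
    simp only [hs, Finset.sum_const_zero] at h
    exact ⟨_, _, h⟩
  · rintro m hm σ hσ ⟨v, k⟩
    have hg := good_of_coeff hm
    by_cases hv : v = v₀
    · subst hv
      simp only [frameVec_self hg, isoAt, isoAtBar, if_true, zero_smul, zero_add]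
      exact hasWirt_posVec hσ e
    · simp only [isoAt, isoAtBar, if_neg hv, frameVec_of_ne (s := ⟨v, k⟩) hv, zero_smul, add_zero]
      exact hasWirt_const _
  · rintro m hm σ hσ ⟨v, k⟩
    have hg := good_of_coeff hm
    by_cases hv : v = v₀
    · subst hv
      simp only [frameVec_self hg, isoAt, if_true, zero_smul, zero_add]
      exact hasWirt_isoVec hσ e
    · simp only [isoAt, if_neg hv, zero_smul, smul_zero, add_zero]
      exact ⟨_, hasWirt_const _⟩
  · rintro m hm σ hσ ⟨v, k⟩
    have hg := good_of_coeff hm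
    by_cases hv : v = v₀
    · subst hv
      simp only [frameVec_self hg, isoAtBar, if_true, zero_smul, zero_add]
      exact hasWirt_isoVecBar hσ e
    · simp only [isoAtBar, if_neg hv, zero_smul, smul_zero, add_zero]
      exact ⟨_, hasWirt_const _⟩

/-! ### The scalar factors -/

/-- The component at `v₀` of `ν_b`, translated to the base point. -/
def radial (e : Bool) (p : ℕ) (w : Fin 3 → ℝ) (σ : ℂ) : ℂ :=
  hermR p (axis e w σ) * hermC 0 0 (plane e w σ)

theorem conj_axis (e : Bool) (w : Fin 3 → ℝ) (σ : ℂ) : conj (axis e w σ) = axis e w σ := by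
  rw [← move_inv_axis, Complex.conj_ofReal]

theorem hasWirt_radial (e : Bool) (p : ℕ) (w : Fin 3 → ℝ) (hσ : ‖σ‖ < 1) : HasWirt (radial e p w)
    (4 * Real.pi * (rad σ * (conj (plane e w σ) * radial e (p + 1) w σ)))
    (4 * Real.pi * (rad σ * (plane e w σ * radial e (p + 1) w σ))) σ := by
  have h := (((hasWirt_hermR p (axis e w σ)).comp (hasWirt_axis hσ e w))).mul
    ((hasWirt_hermC' 0 0 (plane e w σ)).comp (hasWirt_plane hσ e w))
  have e3 : plane e w σ * hermC 0 0 (plane e w σ) = hermC 1 0 (plane e w σ) := by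
    simp [mul_hermC]
  have e4 : conj (plane e w σ) * hermC 0 0 (plane e w σ) = hermC 0 1 (plane e w σ) := by
    simp [conj_mul_hermC]
  refine h.congr ?_ ?_ <;>
    simp only [radial, smul_eq_mul, map_sub, map_mul, map_neg, conj_rad, conj_axis,
      Complex.conj_conj, map_ofNat, zero_add, ← e3, ← e4] <;> ring

theorem axis_mul_radial (e : Bool) (p : ℕ) (w : Fin 3 → ℝ) (σ : ℂ) :
    4 * Real.pi * (axis e w σ * radial e (p + 1) w σ)
      = 4 * Real.pi * radial e (p + 2) w σ + (p + 1) * radial e p w σ := by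
  rw [radial, ← mul_assoc (axis _ _ _), mul_hermR, radial, radial]
  field_simp [pi_ne_zero']
  simp
  ring

/-- In `8p + 4`, the part `4p` is `K + K'` and the part `4(p + 1)` comes from the recursion
`axis_mul_radial`. -/
theorem DDc_radial_smul (v₀ : S) (b : S → ℕ) (e : Bool) (x : Space S)
    {T : Tens 3 b →ₗ[ℂ] Tens 3 b} (hT : ∀ σ, ‖σ‖ < 1 → ∀ q,
      hodgeProj b (frame v₀ e) (wt v₀) q σ ∘ₗ T = T ∘ₗ hodgeProj b (frame v₀ e) (wt v₀) q σ)
    (hτ : ‖τ‖ < 1) :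
    DDc v₀ b e (fun σ => radial e (b v₀) (x v₀) σ • T (sect v₀ b e x σ)) τ
      = areaForm ((4 * Real.pi * Complex.I : ℂ)⁻¹ • (rad τ ^ 2 *
          ((8 * b v₀ + 4) * radial e (b v₀) (x v₀) τ
            + 16 * Real.pi * (1 - 2 * Real.pi * (plane e (x v₀) τ * conj (plane e (x v₀) τ)))
              * radial e (b v₀ + 2) (x v₀) τ)) • T (sect v₀ b e x τ)
        + (4 * Real.pi * Complex.I : ℂ)⁻¹ • (2 * radial e (b v₀) (x v₀) τ)
            • T (sectMixed v₀ b e x τ)) := by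
  obtain ⟨X, Y, h⟩ := movingFrame_sect v₀ b e x
  have hz := hasWirt_plane hτ e (x v₀)
  have hr := hasWirt_rad hτ
  have hP := (hr.mul (hz.star.mul (hasWirt_radial e (b v₀ + 1) (x v₀) hτ))).const_mul
    (4 * Real.pi)
  have hQ := (hr.mul (hz.mul (hasWirt_radial e (b v₀ + 1) (x v₀) hτ))).const_mul
    (4 * Real.pi)
  rw [DDc, (h.map hT).ddc_eq (fun σ hσ => (hasWirt_radial e (b v₀) (x v₀) hσ).congr
    (by simp) (by simp)) hτ hP hQ]
  generalize b v₀ = p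
  have e1 := axis_mul_radial e p (x v₀) τ
  congr 1
  rw [smul_add]
  congr 3
  simp only [map_sub, map_mul, map_neg, conj_rad, conj_axis, Complex.conj_conj, map_ofNat]
  linear_combination (4 * rad τ ^ 2) * e1

end Orthogonal

end FunkeMillson
end

noncomputable section

namespace FunkeMillson

open scoped ComplexConjugate

set_option linter.unusedSectionVars false

namespace Orthogonal

/-! ### The Schwartz functions of the orthogonal case -/

section Hermite

variable {S : Type*} [Fintype S]

/-- The product of Hermite functions with exponents `P`. -/
def hermite (P : S → Fin 3 → ℕ) (x : Space S) : ℂ :=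
  ∏ k : S × Fin 3, hermR (P k.1 k.2) (x k.1 k.2)

theorem gaussian_eq : gaussian (S := S) = hermite 0 := by
  ext x
  simp only [gaussian, hermite, Fintype.prod_prod_type, hermR, Fin.prod_univ_three,
    ← Complex.exp_add, mul_add]

theorem contDiff_hermR_ofReal (p : ℕ) : ContDiff ℝ 2 fun t : ℝ => hermR p t :=
  (contDiff_hermR p).comp Complex.ofRealCLM.contDiff

theorem contDiff_hermite (P : S → Fin 3 → ℕ) : ContDiff ℝ 2 (hermite P) :=
  contDiff_prod_coord (H := fun k : S × Fin 3 => fun t : ℝ => hermR (P k.1 k.2) t)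
    fun _ => contDiff_hermR_ofReal _

variable [DecidableEq S]

theorem raise_const_mul (v : S) (j : Fin 3) (c : ℂ) {f : Space S → ℂ}
    (hf : Differentiable ℝ f) : raise v j (fun y => c * f y) = fun y => c * raise v j f y := by
  ext x
  simp only [raise, fderiv_const_mul (hf x), smul_apply, smul_eq_mul]
  ring

theorem raise_hermite (v : S) (j : Fin 3) (P : S → Fin 3 → ℕ) :
    raise v j (hermite P) = hermite (P + Pi.single v (Pi.single j 1)) := by
  ext x
  let Δ : S → Fin 3 → ℕ := Pi.single v (Pi.single j 1)
  let H : S × Fin 3 → ℝ → ℂ := fun k t => hermR (P k.1 k.2) t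
  let C : ℂ := ∏ k ∈ Finset.univ.erase (v, j), H k (x k.1 k.2)
  have hd : fderiv ℝ (hermite P) x (Pi.single v (Pi.single j 1))
      = C * fderiv ℝ (H (v, j)) (x v j) 1 :=
    fderiv_prod_coord (H := H) (fun _ => contDiff_hermR_ofReal _) x v j 1
  have hw : HasDerivAt (H (v, j)) _ (x v j) := (hasDerivAt_hermR (P v j) (x v j)).comp_ofReal
  have hf : hermite P x = C * H (v, j) (x v j) :=
    (Finset.prod_erase_mul _ _ (Finset.mem_univ (v, j))).symm
  have hr : hermite (P + Δ) x = C * hermR (P v j + 1) (x v j) := by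
    rw [hermite, ← Finset.prod_erase_mul _ _ (Finset.mem_univ (v, j))]
    congr 1
    · refine Finset.prod_congr rfl fun k hk => ?_
      have hk' := Finset.ne_of_mem_erase hk
      have h0 : (P + Δ) k.1 k.2 = P k.1 k.2 := by
        by_cases h1 : k.1 = v
        · have h2 : k.2 ≠ j := fun h2 => hk' (Prod.ext h1 h2)
          rw [h1]
          simp [Δ, Pi.single_eq_of_ne h2]
        · simp [Δ, Pi.single_eq_of_ne h1]
      rw [h0]
    · simp [Δ]
  show _ = hermite (P + Δ) x
  rw [raise, hd, hf, hr, fderiv_apply_one_eq_deriv, hw.deriv]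
  have e1 := mul_hermR (P v j) (x v j)
  simp only [H]
  field_simp [pi_ne_zero'] at e1 ⊢
  linear_combination C * e1

open Classical in
theorem weighted_hermite (v₀ : S) (b : S → ℕ) (c : ℂ) (P : S → Fin 3 → ℕ)
    (x : Space S) (m : Idx 3 b) :
    weighted (raiseE v₀) b (fun y => c * hermite P y) x m
      = if Good v₀ m then c * hermite (P + multiplicity m) x else 0 := by
  have h := weighted_eq (R := raiseE v₀) (G := fun P y => c * hermite P y)
    (ok := fun v j => ¬ (v = v₀ ∧ j ≠ 0)) ?_ ?_ ?_ b P x m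
  · split_ifs with hm
    · exact h.1 hm
    · exact h.2 hm
  · intro v j P h
    ext y
    rw [raiseE, if_neg h, raise_const_mul _ _ _ ((contDiff_hermite P).differentiable (by norm_num)),
      raise_hermite]
  · intro v j f h
    ext y
    rw [raiseE, if_pos (not_not.1 h)]
  · intro v j
    ext y
    rw [raiseE]
    split_ifs
    · rfl
    · have h0 : fderiv ℝ (0 : Space S → ℂ) = 0 := fderiv_zero
      simp [raise, h0]

/-- Combines the two negative coordinates into one complex coordinate. -/
theorem hermR_zero_mul (s t : ℝ) :
    hermR 0 s * hermR 0 t = hermC 0 0 ((s : ℂ) + Complex.I * t) := by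
  simp only [hermR, hermC, pow_zero, one_mul, ← Complex.exp_add, map_add, map_mul, Complex.conj_I,
    Complex.conj_ofReal]
  congr 1
  ring_nf
  simp only [Complex.I_sq]
  ring

theorem hermite_update (v₀ : S) {b : S → ℕ} {m : Idx 3 b} (hm : Good v₀ m) (k : ℕ)
    (x : Space S) (w : Fin 3 → ℝ) :
    hermite (Pi.single v₀ (Pi.single 0 k) + multiplicity m) (Function.update x v₀ w)
      = hermR (b v₀ + k) (w 0) * hermC 0 0 ((w 1 : ℂ) + Complex.I * w 2) * away v₀ m x := by
  have h0 : multiplicity m v₀ 0 = b v₀ := by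
    rw [multiplicity_apply, Finset.sum_congr rfl fun k _ => if_pos (hm.eq_zero k)]
    simp
  have h1 : ∀ j ≠ 0, multiplicity m v₀ j = 0 := by
    intro j hj
    rw [multiplicity_apply, Finset.sum_congr rfl fun k _ => if_neg ?_]
    · simp
    · rw [hm.eq_zero k]
      exact hj.symm
  rw [hermite, prod_coord_split _ v₀, Fin.prod_univ_three, away, ← hermR_zero_mul]
  congr 1
  · simp [h0, h1, add_comm, mul_assoc]
  · refine Finset.prod_congr rfl fun v hv => Finset.prod_congr rfl fun j _ => ?_
    have hv' := Finset.ne_of_mem_erase hv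
    simp [hv']

end Hermite

variable {S : Type*} [Fintype S] [DecidableEq S] {v₀ : S} {b : S → ℕ} {e : Bool} {σ τ : ℂ}

/-! ### The section and the form over the disc in the orthogonal case. -/

theorem nu_eq (v₀ : S) (b : S → ℕ) (e : Bool) (x : Space S) :
    nu v₀ b e x = fun σ => radial e (b v₀) (x v₀) σ • sect v₀ b e x σ := by
  ext1 σ
  rw [nu, tensorMap_eq_sum, sect, Finset.smul_sum]
  refine Finset.sum_congr rfl fun m _ => ?_
  rw [smul_smul]
  congr 1
  have h := weighted_hermite v₀ b 1 0 (backSpace v₀ e σ x) m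
  simp only [one_mul] at h
  rw [nuBase, gaussian_eq, h, coeff]
  split_ifs with hm
  · have h2 := hermite_update v₀ hm 0 x ((move e σ)⁻¹.mulVec (x v₀))
    simp only [Pi.single_zero, zero_add, add_zero] at h2
    rw [zero_add, backSpace, h2, move_inv_axis, move_inv_plane, radial]
  · simp

/-- The Kudla–Millson polynomial is a Hermite polynomial: `hermR 2` is `(x² - 1/(4π)) e^{-πx²}`. -/
theorem kudlaMillson_eq (v₀ : S) (y : Space S) :
    (4 * Real.pi * (y v₀ 0 : ℂ) ^ 2 - 1) * gaussian y
      = 4 * Real.pi * hermite (Pi.single v₀ (Pi.single 0 2)) y := by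
  have h1 : hermite (0 : S → Fin 3 → ℕ) y
      = hermR 0 (y v₀ 0) * ∏ k ∈ Finset.univ.erase (v₀, (0 : Fin 3)), hermR 0 (y k.1 k.2) :=
    (Finset.mul_prod_erase _ _ (Finset.mem_univ (v₀, (0 : Fin 3)))).symm
  have h2 : hermite (Pi.single v₀ (Pi.single 0 2)) y
      = hermR 2 (y v₀ 0) * ∏ k ∈ Finset.univ.erase (v₀, (0 : Fin 3)), hermR 0 (y k.1 k.2) := by
    rw [hermite, ← Finset.mul_prod_erase _ _ (Finset.mem_univ (v₀, (0 : Fin 3)))]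
    congr 1
    · simp
    · refine Finset.prod_congr rfl fun k hk => ?_
      have hk' := Finset.ne_of_mem_erase hk
      congr 1
      by_cases h1 : k.1 = v₀
      · have h2 : k.2 ≠ 0 := fun h2 => hk' (Prod.ext h1 h2)
        rw [h1, Pi.single_eq_same, Pi.single_eq_of_ne h2]
      · rw [Pi.single_eq_of_ne h1, Pi.zero_apply]
  rw [gaussian_eq, h1, h2]
  simp only [hermR]
  field_simp [pi_ne_zero']
  push_cast
  ring

/-- From `dτ ∧ dτ̄ = -2i dx ∧ dy` one gets `(2π)⁻¹ · 4 dx ∧ dy = (i/π) dτ ∧ dτ̄`. -/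
theorem formTensor_wedge {T : Type*} [NormedAddCommGroup T] [NormedSpace ℝ T] [NormedSpace ℂ T]
    [IsScalarTower ℝ ℂ T] (t : T) :
    formTensor ((2 * Real.pi : ℂ)⁻¹ • wedge ((2 : ℝ) • Complex.ofRealCLM.comp Complex.reCLM)
      ((2 : ℝ) • Complex.ofRealCLM.comp Complex.imCLM)) t
      = areaForm ((Complex.I / Real.pi) • t) := by
  ext v
  rw [areaForm_apply]
  show ((2 * Real.pi : ℂ)⁻¹ * wedge _ _ v) • t = _
  rw [wedge_apply, smul_smul]
  congr 1
  field_simp [pi_ne_zero']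
  apply Complex.ext <;> simp <;> ring

theorem fderiv_moebius (hτ : ‖τ‖ < 1) (e : Bool) (v : ℂ) :
    fderiv ℝ (moebius e (move e τ)⁻¹) τ v = rad τ * v := by
  have h0 := rad_eq hτ
  have hd : 1 - τ * conj τ ≠ 0 := right_ne_zero_of_mul_eq_one h0
  have hr : rad τ ≠ 0 := left_ne_zero_of_mul_eq_one h0
  -- The isotropic vector is quadratic in `w`; numerator and denominator share the factor `1 - w
  -- τ̄`, which is left uncancelled.
  have hm : moebius e (move e τ)⁻¹ = fun w => (rad τ * (2 * (w - τ) * (1 - w * conj τ)))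
      / (rad τ * (2 * (1 - w * conj τ) ^ 2)) := by
    ext w
    rw [moebius, disc, move_inv, back, Matrix.smul_mul, rad]
    congr 1 <;> cases e <;> apply Complex.ext <;>
      simp [flip, line, sq, Matrix.mulVec, dotProduct, Fin.sum_univ_three] <;>
      ring
  have h1 : HasDerivAt (fun w => (rad τ * (2 * (w - τ) * (1 - w * conj τ)))
      / (rad τ * (2 * (1 - w * conj τ) ^ 2))) (rad τ) τ := by
    have h2 : HasDerivAt (fun w => (w - τ)) 1 τ := (hasDerivAt_id τ).sub_const τ
    have h3 : HasDerivAt (fun w => (1 - w * conj τ)) (-(1 * conj τ)) τ :=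
      (((hasDerivAt_id τ).mul_const (conj τ)).const_sub 1)
    have h4 := (((h2.const_mul 2).mul h3).const_mul (rad τ)).div
      (((h3.pow 2).const_mul 2).const_mul (rad τ))
      (mul_ne_zero hr (mul_ne_zero two_ne_zero (pow_ne_zero _ hd)))
    refine h4.congr_deriv ?_
    simp only [Pi.mul_apply, Pi.pow_apply]
    rw [div_eq_iff (pow_ne_zero 2
      (mul_ne_zero hr (mul_ne_zero two_ne_zero (pow_ne_zero 2 hd))))]
    linear_combination (-4 * rad τ ^ 2 * (1 - τ * conj τ) ^ 3) * h0
  rw [hm, (h1.hasFDerivAt.restrictScalars ℝ).fderiv]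
  simp [mul_comm]

/-- The constant is the product of `4π` from the Kudla–Millson function, `i/π` from `Ω` and `rad τ ^
2` from the pullback. -/
theorem phi_eq (v₀ : S) (b : S → ℕ) (e : Bool) (x : Space S) (hτ : ‖τ‖ < 1) :
    phi v₀ b e x τ = areaForm ((4 * Complex.I * rad τ ^ 2 * radial e (b v₀ + 2) (x v₀) τ) •
      sect v₀ b e x τ) := by
  rw [phi, phiBase, formTensor_wedge,
    Unitary.areaForm_compContinuousLinearMap _ (fderiv_moebius hτ e), Unitary.map_areaForm]
  congr 1
  rw [map_smul, map_smul, tensorMap_eq_sum, sect, Finset.smul_sum, Finset.smul_sum,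
    Finset.smul_sum]
  refine Finset.sum_congr rfl fun m _ => ?_
  rw [smul_smul, smul_smul, smul_smul]
  congr 1
  have h := weighted_hermite v₀ b (4 * Real.pi) (Pi.single v₀ (Pi.single 0 2))
    (backSpace v₀ e τ x) m
  simp only [kudlaMillson_eq]
  rw [h, coeff]
  split_ifs with hm
  · rw [backSpace, hermite_update v₀ hm 2, move_inv_axis, move_inv_plane, radial, conj_rad]
    field_simp [pi_ne_zero']
  · simp

/-! ### The lowering operator in the orthogonal case -/

/-- `axis`, as a linear map. -/
def axisCLM (e : Bool) (τ : ℂ) : (Fin 3 → ℝ) →L[ℝ] ℂ :=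
  LinearMap.toContinuousLinearMap
    { toFun := fun w => axis e w τ
      map_add' := fun w w' => by simp [axis]; ring
      map_smul' := fun c w => by simp [axis]; ring }

/-- `plane`, as a linear map. -/
def planeCLM (e : Bool) (τ : ℂ) : (Fin 3 → ℝ) →L[ℝ] ℂ :=
  LinearMap.toContinuousLinearMap
    { toFun := fun w => plane e w τ
      map_add' := fun w w' => by simp [plane]; ring
      map_smul' := fun c w => by simp [plane]; ring }

theorem axisCLM_apply (e : Bool) (τ : ℂ) (w : Fin 3 → ℝ) : axisCLM e τ w = axis e w τ := rfl

theorem planeCLM_apply (e : Bool) (τ : ℂ) (w : Fin 3 → ℝ) : planeCLM e τ w = plane e w τ := rfl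

theorem conj_plane (e : Bool) (w : Fin 3 → ℝ) (σ : ℂ) : conj (plane e w σ)
    = rad σ * (-2 * conj σ * (sgn e * w 0) + (w 1 - Complex.I * (sgn e * w 2))
    + conj σ ^ 2 * (w 1 + Complex.I * (sgn e * w 2))) := by
  simp only [plane, map_mul, map_add, map_sub, map_neg, map_pow, conj_rad, map_ofNat,
    conj_sgn, Complex.conj_I, Complex.conj_ofReal]
  ring

/-- The coordinates at `τ` and the complex conjugate of `plane`. -/
def zeta (e : Bool) (τ : ℂ) : Fin 3 → (Fin 3 → ℝ) →L[ℝ] ℂ :=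
  ![axisCLM e τ, planeCLM e τ, (Complex.conjCLE : ℂ →L[ℝ] ℂ).comp (planeCLM e τ)]

/-- Again a consequence of `move` being an isometry; `plane` is isotropic and pairs only with its
conjugate. -/
theorem sum_sign_zeta (v₀ : S) (hτ : ‖τ‖ < 1) (e : Bool) (a a' : Fin 3) :
    ∑ i : Fin 3, (sign v₀ v₀ i : ℂ) *
      (zeta e τ a (Pi.single i 1) * zeta e τ a' (Pi.single i 1))
      = (!![1, 0, 0; 0, 0, -2; 0, -2, 0] : Matrix (Fin 3) (Fin 3) ℂ) a a' := by
  have h := rad_eq hτ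
  have z0 : ∀ w, zeta e τ 0 w = axis e w τ := fun _ => rfl
  have z1 : ∀ w, zeta e τ 1 w = plane e w τ := fun _ => rfl
  have z2 : ∀ w, zeta e τ 2 w = conj (plane e w τ) := fun _ => rfl
  fin_cases a <;> fin_cases a' <;>
    simp only [Fin.zero_eta, Fin.mk_one, Fin.reduceFinMk, z0, z1, z2, conj_plane] <;> cases e <;>
    simp [Fin.sum_univ_three, sign, axis, plane, sgn] <;> ring_nf <;>
    (try simp only [Complex.I_sq]) <;>
    first
    | ring1
    | linear_combination (rad τ * (1 - τ * conj τ) + 1) * h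
    | linear_combination (-2 * (rad τ * (1 - τ * conj τ) + 1)) * h

theorem sum_zeta (e : Bool) (w : Fin 3 → ℝ) (a : Fin 3) :
    ∑ i : Fin 3, (w i : ℂ) * zeta e τ a (Pi.single i 1) = zeta e τ a w := by
  have h : w = ∑ i : Fin 3, w i • (Pi.single i 1 : Fin 3 → ℝ) := by
    ext j
    fin_cases j <;> simp [Fin.sum_univ_three]
  conv_rhs => rw [h, map_sum]
  refine Finset.sum_congr rfl fun i _ => ?_
  rw [map_smul, Complex.real_smul]

theorem sum_sign_sq (v₀ : S) (hτ : ‖τ‖ < 1) (e : Bool) (w : Fin 3 → ℝ) :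
    ∑ i : Fin 3, (sign v₀ v₀ i : ℂ) * (w i : ℂ) ^ 2
    = axis e w τ ^ 2 - plane e w τ * conj (plane e w τ) := by
  have h := rad_eq hτ
  rw [conj_plane]
  cases e <;> simp [Fin.sum_univ_three, sign, axis, plane, sgn] <;> ring_nf <;>
    simp only [Complex.I_sq] <;>
    linear_combination (-((w 0 : ℂ) ^ 2 - w 1 ^ 2 - w 2 ^ 2) * (rad τ * (1 - τ * conj τ) + 1)) * h

end Orthogonal

end FunkeMillson
end

noncomputable section

namespace FunkeMillson

open scoped ComplexConjugate

set_option linter.unusedSectionVars false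

namespace Orthogonal

variable {S : Type*} [Fintype S] [DecidableEq S] {v₀ : S} {b : S → ℕ} {e : Bool} {σ τ : ℂ}

theorem hasFDerivAt_mul_comp {X : Type*} [NormedAddCommGroup X] [NormedSpace ℝ X]
    (L₁ L₂ : X →L[ℝ] ℂ) {g₁ g₂ : ℂ → ℂ} {a d d' : ℂ} {w : X} (h₁ : HasWirt g₁ a 0 (L₁ w))
    (h₂ : HasWirt g₂ d d' (L₂ w)) :
    HasFDerivAt (fun w => g₁ (L₁ w) * g₂ (L₂ w))
      (∑ k, (![a * g₂ (L₂ w), g₁ (L₁ w) * d, g₁ (L₁ w) * d'] : Fin 3 → ℂ) k •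
        (![L₁, L₂, (Complex.conjCLE : ℂ →L[ℝ] ℂ).comp L₂] : Fin 3 → X →L[ℝ] ℂ) k) w := by
  refine (FunkeMillson.hasFDerivAt_mul_comp L₁ L₂ h₁ h₂).congr_fderiv ?_
  ext v
  simp [Fin.sum_univ_four, Fin.sum_univ_three]

/-- On the real positive coordinate the operator lowers the exponent by two; the Gaussian of the
plane gives the same factor as the negative coordinate in the unitary case. -/
theorem weil_radial {W : Type*} [NormedAddCommGroup W] [NormedSpace ℝ W] [NormedSpace ℂ W]
    [SMulCommClass ℝ ℂ W] [IsScalarTower ℝ ℂ W] (v₀ : S) (e : Bool) (p : ℕ) (w : Fin 3 → ℝ)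
    (hτ : ‖τ‖ < 1) (t : W) :
    weilAction (ι := Fin 3) (fun k => sign v₀ v₀ k) (fun k => Pi.single k 1)
      (fun k (x : Fin 3 → ℝ) => x k) lowering (fun w => radial e p w τ • t) w
    = ((1 - 2 * Real.pi * (plane e w τ * conj (plane e w τ))) * radial e p w τ
      + p * (p - 1 : ℕ) / (8 * Real.pi) * radial e (p - 2) w τ) • t := by
  let H : ℂ → ℂ := fun z => p * hermR (p - 1) z - 2 * Real.pi * z * hermR p z
  let G : ℂ → ℂ := fun z => -(Real.pi * conj z * hermC 0 0 z)
  let G' : ℂ → ℂ := fun z => -(Real.pi * z * hermC 0 0 z)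
  have dh : ∀ z, HasWirt (hermR p) (H z) 0 z := fun z =>
    hasWirt_of_hasDerivAt (hasDerivAt_hermR p z)
  have dg : ∀ z, HasWirt (hermC 0 0) (G z) (G' z) z := fun z =>
    (hasWirt_hermC 0 0 z).congr (by simp [G]) (by simp [G'])
  let HH : ℂ → ℂ := fun z => p * ((p - 1 : ℕ) * hermR (p - 2) z - 2 * Real.pi * z * hermR (p - 1) z)
    - (2 * Real.pi * hermR p z + 2 * Real.pi * z * H z)
  let GG : ℂ → ℂ := fun z => -(Real.pi * hermC 0 0 z + Real.pi * conj z * G' z)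
  have dH : ∀ z, HasWirt H (HH z) 0 z := fun z => by
    have h1 := hasWirt_of_hasDerivAt (hasDerivAt_hermR (p - 1) z)
    exact ((h1.const_mul p).sub ((hasWirt_id.const_mul (2 * Real.pi : ℂ)).mul (dh z))).congr
      (by simp [HH, Nat.sub_sub]; ring) (by simp)
  have dG : ∀ z, HasWirt G (-(Real.pi * conj z * G z)) (GG z) z := fun z => by
    simpa only [neg_one_mul, G] using
      ((((hasWirt_conj.const_mul (Real.pi : ℂ)).mul (dg z))).const_mul (-1)).congr
        (by simp [G]) (by simp [GG]; ring)
  have dG' : ∀ z, HasWirt G' (GG z) (-(Real.pi * z * G' z)) z := fun z => by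
    simpa only [neg_one_mul, G'] using
      ((((hasWirt_id.const_mul (Real.pi : ℂ)).mul (dg z))).const_mul (-1)).congr
        (by simp [GG, G, G']; ring) (by simp [G'])
  obtain ⟨B, hB⟩ : ∃ A : ℂ → ℂ, ∀ z, HasWirt G (A z) (GG z) z := ⟨_, dG⟩
  obtain ⟨B', hB'⟩ : ∃ A : ℂ → ℂ, ∀ z, HasWirt G' (GG z) (A z) z := ⟨_, dG'⟩
  have key := weilAction_lowering (ι := Fin 3) (A := Fin 3)
    (fun k => sign v₀ v₀ k)
    (fun k => (Pi.single k 1 : Fin 3 → ℝ))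
    (fun k (x : Fin 3 → ℝ) => x k)
    (zeta e τ)
    (Φ := fun w => hermR p (axisCLM e τ w) * hermC 0 0 (planeCLM e τ w))
    (Φ₁ := fun a w => ![H (axisCLM e τ w) * hermC 0 0 (planeCLM e τ w),
      hermR p (axisCLM e τ w) * G (planeCLM e τ w),
      hermR p (axisCLM e τ w) * G' (planeCLM e τ w)] a)
    (Φ₂ := ![![HH (axisCLM e τ w) * hermC 0 0 (planeCLM e τ w),
        H (axisCLM e τ w) * G (planeCLM e τ w), H (axisCLM e τ w) * G' (planeCLM e τ w)],
      ![H (axisCLM e τ w) * G (planeCLM e τ w),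
        hermR p (axisCLM e τ w) * B (planeCLM e τ w), hermR p (axisCLM e τ w) * GG (planeCLM e τ w)],
      ![H (axisCLM e τ w) * G' (planeCLM e τ w),
        hermR p (axisCLM e τ w) * GG (planeCLM e τ w),
        hermR p (axisCLM e τ w) * B' (planeCLM e τ w)]])
    (x := w) t (fun y => hasFDerivAt_mul_comp _ _ (dh _) (dg _)) (fun a => by
      fin_cases a
      · exact hasFDerivAt_mul_comp _ _ (dH _) (dg _)
      · exact hasFDerivAt_mul_comp _ _ (dh _) (hB _)
      · exact hasFDerivAt_mul_comp _ _ (dh _) (hB' _))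
  have hΦ : (fun w => radial e p w τ • t)
      = fun w => (hermR p (axisCLM e τ w) * hermC 0 0 (planeCLM e τ w)) • t := rfl
  rw [hΦ, key]
  congr 1
  simp only [sum_sign_zeta v₀ hτ, sum_zeta, sum_sign_sq v₀ hτ e]
  simp [Fin.sum_univ_three, zeta, axisCLM_apply, planeCLM_apply, radial, H, G, G', HH, GG]
  field_simp [pi_ne_zero']
  ring

theorem sect_slice (v₀ : S) (b : S → ℕ) (e : Bool) (x : Space S) (w : Fin 3 → ℝ) :
    sect v₀ b e (Function.update x v₀ w) = sect v₀ b e x := by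
  ext1 σ
  refine Finset.sum_congr rfl fun m _ => ?_
  congr 1
  rw [coeff, coeff]
  split_ifs
  swap
  · rfl
  refine Finset.prod_congr rfl fun v hv => ?_
  rw [Function.update_of_ne (Finset.ne_of_mem_erase hv)]

theorem contDiff_coeff (v₀ : S) (m : Idx 3 b) : ContDiff ℝ 2 (coeff v₀ m) := by
  by_cases hm : Good v₀ m
  · have h : coeff v₀ m = away v₀ m := funext fun x => if_pos hm
    rw [h]
    refine contDiff_prod fun v _ => contDiff_prod fun j _ => (contDiff_hermR_ofReal _).comp ?_
    fun_prop
  · have h : coeff v₀ m = 0 := funext fun x => if_neg hm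
    rw [h]
    exact contDiff_const

theorem weilL_radial_smul (v₀ : S) (b : S → ℕ) (e : Bool) (x : Space S) (hτ : ‖τ‖ < 1) (p : ℕ)
    (c : ℂ) (T : Tens 3 b →ₗ[ℂ] Tens 3 b) :
    weilL v₀ (fun y => areaForm ((c * radial e p (y v₀) τ) • T (sect v₀ b e y τ))) x
      = areaForm ((c * ((1 - 2 * Real.pi * (plane e (x v₀) τ * conj (plane e (x v₀) τ)))
          * radial e p (x v₀) τ + p * (p - 1 : ℕ) / (8 * Real.pi) * radial e (p - 2) (x v₀) τ))
        • T (sect v₀ b e x τ)) := by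
  have hsm : ContDiff ℝ 2 fun y : Space S =>
      areaForm ((c * radial e p (y v₀) τ) • T (sect v₀ b e y τ)) := by
    have h : (fun y : Space S => areaForm ((c * radial e p (y v₀) τ) • T (sect v₀ b e y τ)))
        = fun y => ∑ m : Idx 3 b, ((c * radial e p (y v₀) τ) * coeff v₀ m y) •
            areaForm (T (pureTensor 3 b (frameVec v₀ e m τ))) := by
      ext1 y
      simp only [sect, map_sum, map_smul, Finset.smul_sum, areaForm_sum, areaForm_smul, smul_smul]
    rw [h]
    refine ContDiff.sum fun m _ => ContDiff.smul (ContDiff.mul (contDiff_const.mul ?_)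
      (contDiff_coeff v₀ m)) contDiff_const
    exact ((contDiff_hermR p).comp ((axisCLM e τ).contDiff.comp (contDiff_apply ℝ _ v₀))).mul
      ((contDiff_hermC 0 0).comp ((planeCLM e τ).contDiff.comp (contDiff_apply ℝ _ v₀)))
  have hx : ∀ w, Function.update x v₀ 0 + ContinuousLinearMap.single ℝ (fun _ => Fin 3 → ℝ) v₀ w
      = Function.update x v₀ w := by
    intro w
    ext v : 1
    by_cases hv : v = v₀
    · subst hv; simp
    · simp [hv]
  have h := weilAction_slice (ι := Fin 3) (fun k => sign v₀ v₀ k)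
    (fun k => (Pi.single k 1 : Fin 3 → ℝ)) (fun k x => x v₀ k)
    (fun k (x : Fin 3 → ℝ) => x k) lowering
    (ContinuousLinearMap.single ℝ (fun _ => Fin 3 → ℝ) v₀) hsm (Function.update x v₀ 0) (x v₀)
    (fun k => by rw [hx]; simp)
  simp only [hx, Function.update_eq_self, Function.update_self, sect_slice] at h
  refine h.trans ?_
  have h2 : (fun w => areaForm ((c * radial e p w τ) • T (sect v₀ b e x τ)))
      = fun w => radial e p w τ • areaForm (c • T (sect v₀ b e x τ)) := by
    ext1 w
    rw [← areaForm_smul, smul_smul, mul_comm]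
  rw [h2, weil_radial v₀ e p (x v₀) hτ, ← areaForm_smul, smul_smul, mul_comm]

/-! ### Insertions in the orthogonal case -/

theorem other_ne {N : ℕ} (j : Fin N) (k : Fin (N - 1)) : other j k ≠ j := fun h =>
  skip_ne j k (Fin.val_eq_of_eq h)

theorem exists_other {N : ℕ} {j j' : Fin N} (h : j' ≠ j) : ∃ k, other j k = j' := by
  obtain ⟨k, hk, hk'⟩ := exists_skip j.2 j'.2 fun e => h (Fin.ext e)
  exact ⟨⟨k, hk⟩, Fin.ext hk'⟩

/-- For fixed `j` the second spot runs once through all spots different from `j`, so a sum over `(j,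
k)` is one over ordered pairs of distinct spots. -/
theorem sum_other {N : ℕ} {M : Type*} [AddCommMonoid M] (j : Fin N) (f : Fin N → M) :
    ∑ k, f (other j k) = ∑ j', if j' = j then 0 else f j' := by
  refine Finset.sum_bij_ne_zero (fun k _ _ => other j k) (fun _ _ _ => Finset.mem_univ _) ?_ ?_ ?_
  · intro k _ _ k' _ _ h
    exact Fin.ext (skip_injective _ (Fin.val_eq_of_eq h))
  · intro j' _ h
    have hj : j' ≠ j := fun e => h (if_pos e)
    obtain ⟨k, rfl⟩ := exists_other hj
    exact ⟨k, Finset.mem_univ _, by rwa [if_neg hj] at h, rfl⟩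
  · intro k _ _
    rw [if_neg (other_ne j k)]

/-- The embedding of the spots that remain after deleting the `j`-th and the `j'`-th spot of
label `v`. -/
def keep (b : S → ℕ) (v : S) (j j' : Fin (b v)) (s : Spot (lower b v)) : Spot b :=
  ⟨s.1, ⟨if s.1 = v then skip (max j.1 j'.1) (skip (min j.1 j'.1) s.2) else s.2, by
    obtain ⟨w, l⟩ := s
    have hl : l.1 < if w = v then b w - 2 else b w := l.2
    generalize l.1 = l' at hl ⊢
    by_cases h : w = v
    · subst h
      rw [if_pos rfl] at hl
      simp only [if_true]
      unfold skip
      split_ifs <;> omega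
    · rw [if_neg h] at hl
      simp only [if_neg h]
      exact hl⟩⟩

/-- The matrix of the quadratic form at `v`. -/
def gram (v₀ v : S) (k l : Fin 3) : ℝ := if k = l then sign v₀ v k else 0

theorem removes_keep (v : S) {j j' : Fin (b v)} (hj : j' ≠ j) :
    Removes (keep b v j j') ⟨v, j⟩ ⟨v, j'⟩ := by
  have hj' : j'.1 ≠ j.1 := fun e => hj (Fin.ext e)
  refine ⟨?_, fun h => hj (eq_of_heq (Sigma.mk.inj_iff.1 h).2).symm, ?_⟩
  · rintro ⟨w, k⟩ ⟨w', k'⟩ h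
    obtain rfl : w = w' := congrArg Sigma.fst h
    have h1 := Fin.val_eq_of_eq (eq_of_heq (Sigma.mk.inj_iff.1 h).2)
    simp only at h1
    congr 1
    ext
    split_ifs at h1
    · exact skip_injective _ (skip_injective _ h1)
    · exact h1
  · rintro ⟨w, k⟩
    by_cases hw : w = v
    · subst hw
      have e1 : ∀ i : Fin (b w), ((⟨w, k⟩ : Spot b) ≠ ⟨w, i⟩) ↔ k.1 ≠ i.1 := fun i => by
        simp [Fin.ext_iff]
      rw [e1, e1]
      constructor
      · rintro ⟨⟨w', l⟩, h⟩
        obtain rfl : w' = w := congrArg Sigma.fst h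
        have h1 := Fin.val_eq_of_eq (eq_of_heq (Sigma.mk.inj_iff.1 h).2)
        simp only [if_true] at h1
        rw [← h1]
        unfold skip
        constructor <;> split_ifs <;> omega
      · rintro ⟨h1, h2⟩
        have hk := k.2
        have := j.2
        have := j'.2
        -- The larger spot is removed first; the smaller one then keeps its position in the
        -- shortened range.
        obtain ⟨l', hl', hs'⟩ := exists_skip (N := b w) (i := max j.1 j'.1) (k := k.1)
          (by omega) hk (by omega)
        obtain ⟨l, hl, hs⟩ := exists_skip (N := b w - 1) (i := min j.1 j'.1) (k := l')
          (by omega) hl' (by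
            intro e
            rw [← hs', e] at h1 h2
            unfold skip at h1 h2
            split_ifs at h1 h2 <;> omega)
        refine ⟨⟨w, ⟨l, by simp only [lower, if_true]; omega⟩⟩, ?_⟩
        simp [keep, hs, hs']
    · have h1 : ∀ i, (⟨w, k⟩ : Spot b) ≠ ⟨v, i⟩ := fun i h => hw (congrArg Sigma.fst h)
      simp only [ne_eq, h1, not_false_eq_true, and_self, iff_true]
      refine ⟨⟨w, ⟨k, ?_⟩⟩, ?_⟩
      · simp [lower, hw]
      · simp [keep, hw]

end Orthogonal

end FunkeMillson
end

noncomputable section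

namespace FunkeMillson

open scoped ComplexConjugate

set_option linter.unusedSectionVars false

namespace Orthogonal

variable {S : Type*} [Fintype S] [DecidableEq S] {v₀ : S} {b : S → ℕ} {e : Bool} {σ τ : ℂ}

theorem coeff_restrictIdx {j j' : Fin (b v₀)} (hj : j' ≠ j) (m : Idx 3 b)
    (hm : m v₀ j = 0) (hm' : m v₀ j' = 0) (x : Space S) :
    coeff v₀ (restrictIdx (keep b v₀ j j') m) x = coeff v₀ m x := by
  have hr := removes_keep (b := b) v₀ hj
  have hgood : Good v₀ (restrictIdx (keep b v₀ j j') m) ↔ Good v₀ m := by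
    have h1 : ∀ {b : S → ℕ} (m : Idx 3 b), Good v₀ m ↔
        ∀ s : Spot b, ¬ (s.1 = v₀ ∧ m s.1 s.2 ≠ 0) := fun m =>
      ⟨fun h s => h s.1 s.2, fun h u k => h ⟨u, k⟩⟩
    rw [h1, h1, hr.forall (P := fun s => ¬ (s.1 = v₀ ∧ m s.1 s.2 ≠ 0))]
    · exact Iff.rfl
    · simp [hm]
    · simp [hm']
  have hmult : ∀ v ≠ v₀, multiplicity (restrictIdx (keep b v₀ j j') m) v = multiplicity m v := by
    intro v hv
    rw [multiplicity, multiplicity, hr.sum]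
    simp only [Pi.add_apply]
    rw [Pi.single_eq_of_ne hv, Pi.single_eq_of_ne hv, zero_add, zero_add]
    rfl
  rw [coeff, coeff]
  by_cases h : Good v₀ m
  · rw [if_pos h, if_pos (hgood.2 h), away, away]
    refine Finset.prod_congr rfl fun v hv => Finset.prod_congr rfl fun k _ => ?_
    rw [hmult v (Finset.ne_of_mem_erase hv)]
  · rw [if_neg h, if_neg fun h' => h (hgood.1 h')]

theorem move_gram (hσ : ‖σ‖ < 1) (e : Bool) (k l : Fin 3) : gram v₀ v₀ k l
    = move e σ k 0 * move e σ l 0 - move e σ k 1 * move e σ l 1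
      - move e σ k 2 * move e σ l 2 := by
  have h : ‖σ‖ ^ 2 = σ.re ^ 2 + σ.im ^ 2 := by rw [Complex.sq_norm, Complex.normSq_apply]; ring
  have h0 : 1 - ‖σ‖ ^ 2 ≠ 0 := by nlinarith [norm_nonneg σ]
  have h1 := inv_mul_cancel₀ h0
  rw [move_eq]
  generalize (1 - ‖σ‖ ^ 2)⁻¹ = r at h1
  rw [h] at h1
  cases e <;> fin_cases k <;> fin_cases l <;> simp [gram, sign] <;>
    first
    | ring1
    | linear_combination -(r * (1 - (σ.re ^ 2 + σ.im ^ 2)) + 1) * h1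
    | linear_combination (r * (1 - (σ.re ^ 2 + σ.im ^ 2)) + 1) * h1

/-- The translate of `e_2 + i e_3`. -/
def planeVec (e : Bool) (σ : ℂ) (i : Fin 3) : ℂ := move e σ i 1 + Complex.I * move e σ i 2

/-- The translate of `e_2 - i e_3`. -/
def planeVecBar (e : Bool) (σ : ℂ) (i : Fin 3) : ℂ := move e σ i 1 - Complex.I * move e σ i 2

/-- For `w = e_2 + i e_3` one has `e_2 ⊗ e_2 + e_3 ⊗ e_3 = ½ (w ⊗ w̄ + w̄ ⊗ w)`, and `move` is an
isometry. -/
theorem gram_eq (hσ : ‖σ‖ < 1) (e : Bool) (k l : Fin 3) : (gram v₀ v₀ k l : ℂ) = ∑ c : Fin 3,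
    (![1, -(1 / 2), -(1 / 2)] : Fin 3 → ℂ) c
      * (![posVec e σ, planeVec e σ, planeVecBar e σ] : Fin 3 → Fin 3 → ℂ) c k
      * (![posVec e σ, planeVecBar e σ, planeVec e σ] : Fin 3 → Fin 3 → ℂ) c l := by
  rw [move_gram hσ e, Fin.sum_univ_three]
  simp only [Matrix.cons_val_zero, Matrix.cons_val_one, Matrix.cons_val,
    ← move_col_zero, planeVec, planeVecBar]
  push_cast
  ring_nf
  simp only [Complex.I_sq]
  ring

/-- The pure tensor that arises from the moving frame by putting the translates of `e_2 ± i e_3`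
in the spots `j` and `j'` of `v₀`. -/
def twoPlane (v₀ : S) (e : Bool) (m : Idx 3 b) (σ : ℂ) (j j' : Fin (b v₀)) : Tens 3 b :=
  pureTensor 3 b (Function.update (Function.update (frameVec v₀ e m σ) ⟨v₀, j⟩ (planeVec e σ))
    ⟨v₀, j'⟩ (planeVecBar e σ))

theorem spot_ne {j j' : Fin (b v₀)} (hj : j' ≠ j) : (⟨v₀, j'⟩ : Spot b) ≠ ⟨v₀, j⟩ := fun h =>
  hj (eq_of_heq (Sigma.mk.inj_iff.1 h).2)

theorem expand_sect (x : Space S) (hσ : ‖σ‖ < 1) (e : Bool) {j j' : Fin (b v₀)} (hj : j' ≠ j) :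
    expand (restrictIdx (keep b v₀ j j')) (twoSpots (gram v₀ v₀) ⟨v₀, j⟩ ⟨v₀, j'⟩)
        (sect v₀ (lower b v₀) e x σ)
      = ∑ m : Idx 3 b, coeff v₀ m x • (pureTensor 3 b (frameVec v₀ e m σ)
        - (1 / 2 : ℂ) • twoPlane v₀ e m σ j j' - (1 / 2 : ℂ) • twoPlane v₀ e m σ j' j) := by
  have hr := removes_keep (b := b) v₀ hj
  rw [sect, map_sum]
  symm
  refine hr.sum_restrictIdx 0 (fun m hm => ?_) fun m hi hi' => ?_
  · have hg : Good v₀ m := good_of_coeff fun h => hm (by rw [h, zero_smul])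
    exact ⟨hg.eq_zero _, hg.eq_zero _⟩
  · have hc := coeff_restrictIdx hj m hi hi' x
    by_cases h0 : coeff v₀ m x = 0
    · rw [hc, h0, zero_smul, zero_smul, map_zero]
    · have hg := good_of_coeff h0
      have he := expand_pureTensor hr (gram_eq (v₀ := v₀) hσ e) (frameVec v₀ e m σ)
      rw [hc, map_smul]
      congr 1
      refine Eq.trans ?_ he.symm
      have e1 : Function.update (Function.update (frameVec v₀ e m σ) ⟨v₀, j⟩ (posVec e σ))
          ⟨v₀, j'⟩ (posVec e σ) = frameVec v₀ e m σ := by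
        conv_lhs => rw [← frameVec_self hg e σ j, Function.update_eq_self,
          frameVec_self hg e σ j, ← frameVec_self hg e σ j', Function.update_eq_self]
      rw [Fin.sum_univ_three]
      simp only [Matrix.cons_val_zero, Matrix.cons_val_one, Matrix.cons_val,
        one_smul, neg_smul]
      rw [e1, twoPlane, twoPlane, Function.update_comm (spot_ne hj), sub_eq_add_neg,
        sub_eq_add_neg]

/-- Exchanging the names of the two spots shows that both halves have the same sum; there are `N (N
- 1)` ordered pairs. -/
theorem sum_ite_ne {N : ℕ} {M : Type*} [AddCommGroup M] [Module ℂ M] (t : M)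
    (T : Fin N → Fin N → M) :
    ∑ j, ∑ j', (if j' = j then 0 else t - (1 / 2 : ℂ) • T j j' - (1 / 2 : ℂ) • T j' j)
      = ((N : ℂ) * (N - 1)) • t - ∑ j, ∑ j', if j' = j then 0 else T j j' := by
  have h1 : ∀ j j' : Fin N,
      (if j' = j then 0 else t - (1 / 2 : ℂ) • T j j' - (1 / 2 : ℂ) • T j' j)
        = t - (if j' = j then t else 0) - (1 / 2 : ℂ) • (if j' = j then 0 else T j j')
          - (1 / 2 : ℂ) • (if j = j' then 0 else T j' j) := by
    intro j j'
    by_cases h : j' = j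
    · simp [h]
    · simp [h, Ne.symm h]
  simp only [h1, Finset.sum_sub_distrib, ← Finset.smul_sum]
  rw [Finset.sum_comm (f := fun j j' => if j = j' then 0 else T j' j)]
  simp only [Finset.sum_const, Finset.card_univ, Fintype.card_fin, Finset.sum_ite_eq',
    Finset.mem_univ, if_true, ← Nat.cast_smul_eq_nsmul ℂ]
  module

theorem sum_insertion_sect (x : Space S) (hσ : ‖σ‖ < 1) (e : Bool) :
    ∑ j, ∑ k, insertion v₀ b v₀ j k (sect v₀ (lower b v₀) e x σ)
      = ∑ m : Idx 3 b, coeff v₀ m x • (((b v₀ : ℂ) * (b v₀ - 1)) •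
          pureTensor 3 b (frameVec v₀ e m σ)
        - ∑ j, ∑ j', if j' = j then 0 else twoPlane v₀ e m σ j j') := by
  have h1 : ∀ j : Fin (b v₀), ∑ k, insertion v₀ b v₀ j k (sect v₀ (lower b v₀) e x σ)
      = ∑ j', ∑ m : Idx 3 b, coeff v₀ m x • (if j' = j then 0 else
          pureTensor 3 b (frameVec v₀ e m σ) - (1 / 2 : ℂ) • twoPlane v₀ e m σ j j'
            - (1 / 2 : ℂ) • twoPlane v₀ e m σ j' j) := by
    intro j
    refine (sum_other j fun j' => expand (restrictIdx (keep b v₀ j j'))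
      (twoSpots (gram v₀ v₀) ⟨v₀, j⟩ ⟨v₀, j'⟩) (sect v₀ (lower b v₀) e x σ)).trans ?_
    refine Finset.sum_congr rfl fun j' _ => ?_
    split_ifs with h
    · simp
    · exact expand_sect x hσ e h
  simp only [h1]
  refine (Finset.sum_congr rfl fun i _ => Finset.sum_comm).trans ?_
  refine Finset.sum_comm.trans (Finset.sum_congr rfl fun m _ => ?_)
  simp only [← Finset.smul_sum]
  rw [sum_ite_ne]

/-- Only pairs of distinct spots of `v₀` contribute, and each of the two isotropic vectors carries a
factor `rad σ`. -/
theorem replaceTwo_eq (m : Idx 3 b) :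
    replaceTwo (frameVec v₀ e m σ) (fun s => isoAt v₀ e σ s.1) (fun s => isoAtBar v₀ e σ s.1)
      = rad σ ^ 2 • ∑ j, ∑ j', if j' = j then 0 else twoPlane v₀ e m σ j j' := by
  have e1 : isoVec e σ = rad σ • planeVec e σ := funext fun i => isoVec_eq e σ i
  have e2 : isoVecBar e σ = rad σ • planeVecBar e σ := funext fun i => isoVecBar_eq e σ i
  rw [replaceTwo, Fintype.sum_sigma, Finset.sum_eq_single v₀, Finset.smul_sum]
  · refine Finset.sum_congr rfl fun j _ => ?_
    rw [Fintype.sum_sigma, Finset.sum_eq_single v₀, Finset.smul_sum]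
    · refine Finset.sum_congr rfl fun j' _ => ?_
      by_cases hj : j' = j
      · rw [if_pos hj, if_pos (by rw [hj]), smul_zero]
      · have h3 := spot_ne hj
        rw [if_neg hj, if_neg h3, isoAt, isoAtBar, if_pos rfl, if_pos rfl, e1, e2,
          ContinuousMultilinearMap.map_update_smul, Function.update_comm h3.symm,
          ContinuousMultilinearMap.map_update_smul, Function.update_comm h3, smul_smul, ← sq,
          twoPlane]
    · intro v _ hv
      refine Finset.sum_eq_zero fun j' _ => ?_
      rw [isoAtBar, if_neg hv]
      split_ifs
      · rfl
      · exact ContinuousMultilinearMap.map_coord_zero _ ⟨v, j'⟩ (Function.update_self _ _ _)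
    · simp
  · intro v _ hv
    refine Finset.sum_eq_zero fun j _ => Finset.sum_eq_zero fun s' _ => ?_
    rw [isoAt, if_neg hv]
    split_ifs with h
    · rfl
    · refine ContinuousMultilinearMap.map_coord_zero _ ⟨v, j⟩ ?_
      rw [Function.update_of_ne (Ne.symm h), Function.update_self]
  · simp

theorem sectMixed_eq (x : Space S) (hσ : ‖σ‖ < 1) (e : Bool) :
    sectMixed v₀ b e x σ = rad σ ^ 2 • (((b v₀ : ℂ) * (b v₀ - 1)) • sect v₀ b e x σ
      - ∑ j, ∑ k, insertion v₀ b v₀ j k (sect v₀ (lower b v₀) e x σ)) := by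
  rw [sum_insertion_sect x hσ e, sectMixed, sect, Finset.smul_sum, ← Finset.sum_sub_distrib,
    Finset.smul_sum]
  refine Finset.sum_congr rfl fun m _ => ?_
  rw [replaceTwo_eq]
  module

/-! ### The harmonic projection in the orthogonal case -/

theorem harm_insertion (j : Fin (b v₀)) (k : Fin (b v₀ - 1))
    (t : Tens 3 (lower b v₀)) : harm v₀ b (insertion v₀ b v₀ j k t) = 0 :=
  harmonicProj_expand (J := Σ v : S, Fin (b v) × Fin (b v - 1))
    (drop := fun I => drop b I.1 I.2.1 I.2.2)
    (g := fun I => pairing v₀ b I.1 I.2.1 I.2.2) ⟨v₀, j, k⟩ t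

theorem harm_comp_permute (π : ∀ u, Equiv.Perm (Fin (b u))) :
    harm v₀ b ∘ₗ permute 3 π = permute 3 π ∘ₗ harm v₀ b := by
  have key : ∀ (π : ∀ u, Equiv.Perm (Fin (b u)))
      (I : Σ v : S, Fin (b v) × Fin (b v - 1)) s,
      permute 3 π (expand (drop b I.1 I.2.1 I.2.2) (pairing v₀ b I.1 I.2.1 I.2.2) s) ∈
      expansionSpace (ι := Σ v : S, Fin (b v) × Fin (b v - 1))
        (fun I => drop b I.1 I.2.1 I.2.2) (fun I => pairing v₀ b I.1 I.2.1 I.2.2) := by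
    rintro π ⟨v, j, k⟩ s
    have hne : π v (other j k) ≠ π v j := fun h => other_ne j k ((π v).injective h)
    have h := permute_expand_mem (removes_keep (b := b) v (other_ne j k)) (gram v₀ v) π
      (removes_keep (b := b) v hne) s
    -- The permuted pair is again of the form `(j, other j k')`, so it belongs to the given family
    -- of insertions.
    obtain ⟨k', hk'⟩ := exists_other hne
    rw [← hk'] at h
    exact Submodule.mem_iSup_of_mem (⟨v, π v j, k'⟩ : Σ v : S, Fin (b v) × Fin (b v - 1)) h
  exact harmonicProj_comm (permute_transpose π) (key π) (key fun u => (π u).symm)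

/-- The matrix of the quadratic form at `v`, with complex entries. -/
def gramC (v₀ v : S) : Matrix (Fin 3) (Fin 3) ℂ := (Matrix.of (gram v₀ v)).map Complex.ofReal

theorem gramC_mul_self (v : S) : gramC v₀ v * gramC v₀ v = 1 := by
  ext i j
  simp only [gramC, Matrix.mul_apply, Fin.sum_univ_three, Matrix.map_apply, Matrix.of_apply]
  by_cases hv : v = v₀ <;> fin_cases i <;> fin_cases j <;> simp [gram, sign, hv]

/-- At the base point the torus element scales `e_2 ± i e_3` by `2` and `1/2`; in real coordinates
this gives `5/4 = (2 + 1/2)/2` and `3/4 = (2 - 1/2)/2`. -/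
theorem hodgeTorus_self (hσ : ‖σ‖ < 1) (e : Bool) : hodgeTorus (frame v₀ e) (wt v₀) σ v₀
    = (move e σ).map Complex.ofReal * !![1, 0, 0; 0, 5 / 4, -(3 / 4) * Complex.I;
        0, 3 / 4 * Complex.I, 5 / 4] * (move e σ)⁻¹.map Complex.ofReal := by
  have h : (!![1, 0, 0; 0, 1, 1; 0, Complex.I, -Complex.I] : Matrix (Fin 3) (Fin 3) ℂ)
      * Matrix.diagonal (fun j => (2 : ℂ) ^ wt v₀ v₀ j)
      * !![1, 0, 0; 0, 1 / 2, -Complex.I / 2; 0, 1 / 2, Complex.I / 2]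
      = !![1, 0, 0; 0, 5 / 4, -(3 / 4) * Complex.I; 0, 3 / 4 * Complex.I, 5 / 4] := by
    ext i j
    simp only [Matrix.mul_apply, Fin.sum_univ_three, Matrix.diagonal_apply, wt_self]
    fin_cases i <;> fin_cases j <;> simp <;> ring_nf <;> (try simp only [Complex.I_sq]) <;> ring1
  rw [hodgeTorus, frame_inv hσ, if_pos rfl, frame, moveAt_self, ← h]
  simp only [Matrix.mul_assoc]

theorem hodgeTorus_of_ne (hσ : ‖σ‖ < 1) (e : Bool) {v : S} (hv : v ≠ v₀) :
    hodgeTorus (frame v₀ e) (wt v₀) σ v = 1 := by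
  rw [hodgeTorus]
  simp [wt_of_ne hv, frame_mul_inv hσ]

/-- The form pairs the two isotropic lines with each other, and the torus scales them by inverse
factors. This is checked at the base point (`hN`) and transported by isometries (`hB`, `hB'`). -/
theorem hodgeTorus_gram (hσ : ‖σ‖ < 1) (e : Bool) (v : S) :
    hodgeTorus (frame v₀ e) (wt v₀) σ v * gramC v₀ v
      * (hodgeTorus (frame v₀ e) (wt v₀) σ v).transpose = gramC v₀ v := by
  by_cases hv : v = v₀
  · subst hv
    have hB : (move e σ).map Complex.ofReal * gramC v v
        * ((move e σ).map Complex.ofReal).transpose = gramC v v := by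
      ext k l
      have h := congrArg Complex.ofReal (move_gram (v₀ := v) hσ e k l)
      simp only [gramC, Matrix.map_apply, Matrix.of_apply]
      rw [h]
      simp [Matrix.mul_apply, Fin.sum_univ_three, gram, sign]
      ring
    have hI : (move e σ)⁻¹.map Complex.ofReal * (move e σ).map Complex.ofReal = 1 := by
      have h := moveAt_mul (v₀ := v) hσ e v
      rw [if_pos rfl, moveAt_self] at h
      exact mul_eq_one_comm.1 h
    have hN : !![1, 0, 0; 0, 5 / 4, -(3 / 4) * Complex.I; 0, 3 / 4 * Complex.I, 5 / 4] * gramC v v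
        * (!![1, 0, 0; 0, 5 / 4, -(3 / 4) * Complex.I;
            0, 3 / 4 * Complex.I, 5 / 4] : Matrix (Fin 3) (Fin 3) ℂ).transpose = gramC v v := by
      ext i j
      simp only [gramC, Matrix.mul_apply, Fin.sum_univ_three, Matrix.transpose_apply,
        Matrix.map_apply, Matrix.of_apply]
      fin_cases i <;> fin_cases j <;> simp [gram, sign] <;> ring_nf <;>
        (try simp only [Complex.I_sq]) <;> ring
    rw [hodgeTorus_self hσ]
    generalize !![1, 0, 0; 0, 5 / 4, -(3 / 4) * Complex.I; 0, 3 / 4 * Complex.I, 5 / 4] = N at hN ⊢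
    generalize (move e σ)⁻¹.map Complex.ofReal = B' at hI ⊢
    generalize (move e σ).map Complex.ofReal = B at hB hI ⊢
    generalize gramC v v = g at hB hN ⊢
    have hB' : B' * g * B'.transpose = g := by
      conv_lhs => rw [← hB]
      calc B' * (B * g * B.transpose) * B'.transpose
          = (B' * B) * g * (B' * B).transpose := by
            simp only [Matrix.transpose_mul, Matrix.mul_assoc]
        _ = g := by rw [hI]; simp
    calc B * N * B' * g * (B * N * B').transpose
        = B * (N * (B' * g * B'.transpose) * N.transpose) * B.transpose := by
          simp only [Matrix.transpose_mul, Matrix.mul_assoc]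
      _ = g := by rw [hB', hN, hB]
  · rw [hodgeTorus_of_ne hσ e hv]
    simp

/-- Since `g² = 1`, invariance of `g` under `M` says that `g Mᵀ g` is a right inverse of `M`; being
also a left inverse, it gives invariance under `Mᵀ`. -/
theorem hodgeTorus_transpose_gram (hσ : ‖σ‖ < 1) (e : Bool) (v : S) :
    (hodgeTorus (frame v₀ e) (wt v₀) σ v).transpose * gramC v₀ v
      * (hodgeTorus (frame v₀ e) (wt v₀) σ v).transpose.transpose = gramC v₀ v := by
  have h := hodgeTorus_gram (v₀ := v₀) hσ e v
  have hg := gramC_mul_self (v₀ := v₀) v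
  rw [Matrix.transpose_transpose]
  generalize hodgeTorus (frame v₀ e) (wt v₀) σ v = M at h ⊢
  generalize gramC v₀ v = g at h hg ⊢
  have h1 : M * (g * M.transpose * g) = 1 := by
    rw [← Matrix.mul_assoc, ← Matrix.mul_assoc, h, hg]
  have h2 := mul_eq_one_comm.1 h1
  calc M.transpose * g * M = (g * g) * M.transpose * g * M := by rw [hg, Matrix.one_mul]
    _ = g * (g * M.transpose * g * M) := by simp only [Matrix.mul_assoc]
    _ = g := by rw [h2, Matrix.mul_one]

theorem hodgeProj_comp_harm (hσ : ‖σ‖ < 1) (e : Bool) (q : ℤ) :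
    hodgeProj b (frame v₀ e) (wt v₀) q σ ∘ₗ harm v₀ b
      = harm v₀ b ∘ₗ hodgeProj b (frame v₀ e) (wt v₀) q σ := by
  refine hodgeProj_comm (fun u => frame_mul_inv hσ e u) ?_ q
  refine harmonicProj_comm (tensorMap_transpose _) ?_ ?_
  · rintro I s
    have h := tensorMap_expand (removes_keep (b := b) I.1 (other_ne I.2.1 I.2.2))
      (hodgeTorus (frame v₀ e) (wt v₀) σ) (fun _ => rfl) (hodgeTorus_gram hσ e I.1)
    exact Submodule.mem_iSup_of_mem I ⟨_, (LinearMap.congr_fun h s).symm⟩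
  · rintro I s
    have h := tensorMap_expand (removes_keep (b := b) I.1 (other_ne I.2.1 I.2.2))
      (fun u => (hodgeTorus (frame v₀ e) (wt v₀) σ u).transpose) (fun _ => rfl)
      (hodgeTorus_transpose_gram hσ e I.1)
    exact Submodule.mem_iSup_of_mem I ⟨_, (LinearMap.congr_fun h s).symm⟩

theorem permute_sect (π : ∀ u, Equiv.Perm (Fin (b u))) (e : Bool) (x : Space S) :
    permute 3 π (sect v₀ b e x σ) = sect v₀ b e x σ := by
  have h : sect v₀ b e x σ
      = tensorMap b (fun u _ => moveAt v₀ e u σ) (fun m => coeff v₀ m x) := by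
    rw [tensorMap_eq_sum]
    rfl
  rw [h, permute_tensorMap]
  congr 1
  ext m
  rw [permute_apply, coeff, coeff]
  have hg : Good v₀ (fun u k => m u (π u k)) ↔ Good v₀ m :=
    ⟨fun h u k => by simpa using h u ((π u).symm k), fun h u k => h u (π u k)⟩
  have ha : away v₀ (fun u k => m u (π u k)) x = away v₀ m x := by
    simp only [away, multiplicity_permute]
  by_cases hm : Good v₀ m
  · rw [if_pos hm, if_pos (hg.2 hm), ha]
  · rw [if_neg hm, if_neg fun h => hm (hg.1 h)]

theorem symmetrizer_harm_sect (e : Bool) (x : Space S) :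
    symmetrizer 3 b (harm v₀ b (sect v₀ b e x σ)) = harm v₀ b (sect v₀ b e x σ) := by
  refine symmetrizer_eq_self fun π => ?_
  have h := LinearMap.congr_fun (harm_comp_permute (v₀ := v₀) π) (sect v₀ b e x σ)
  simp only [LinearMap.comp_apply, permute_sect] at h
  exact h.symm

/-! ### The main result in the orthogonal case -/

theorem weilL_phi (v₀ : S) (b : S → ℕ) (e : Bool) (x : Space S) (hτ : ‖τ‖ < 1) :
    weilL v₀ (fun y => phi v₀ b e y τ) x = -DDc v₀ b e (nu v₀ b e x) τ
      + (1 / (8 * Real.pi) : ℂ) •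
        ∑ j, ∑ k, (realCLM (insertion v₀ b v₀ j k)).compContinuousAlternatingMap
            (phi v₀ (lower b v₀) e x τ) := by
  have hins : ∑ j, ∑ k, (realCLM (insertion v₀ b v₀ j k)).compContinuousAlternatingMap
        (phi v₀ (lower b v₀) e x τ)
      = areaForm ((4 * Complex.I * rad τ ^ 2 * radial e (b v₀) (x v₀) τ) •
        ∑ j, ∑ k, insertion v₀ b v₀ j k (sect v₀ (lower b v₀) e x τ)) := by
    simp only [Finset.smul_sum, areaForm_sum]
    refine Finset.sum_congr rfl fun j _ => Finset.sum_congr rfl fun k _ => ?_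
    -- The index `k` exists only if `b v₀ ≥ 2`, so the truncated subtraction is exact.
    have hj : lower b v₀ v₀ + 2 = b v₀ := by
      have := k.2
      simp only [lower, if_true]
      omega
    rw [phi_eq v₀ (lower b v₀) e x hτ, hj, Unitary.map_areaForm, map_smul]
  have hphi : (fun y => phi v₀ b e y τ) = fun y => areaForm ((4 * Complex.I * rad τ ^ 2 *
      radial e (b v₀ + 2) (y v₀) τ) • LinearMap.id (R := ℂ) (sect v₀ b e y τ)) := by
    ext1 y
    exact phi_eq v₀ b e y hτ
  rw [hins, hphi, weilL_radial_smul v₀ b e x hτ, nu_eq]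
  have hD := DDc_radial_smul v₀ b e x (T := LinearMap.id) (fun σ _ q => rfl) hτ
  simp only [LinearMap.id_apply] at hD ⊢
  rw [hD, sectMixed_eq x hτ, ← areaForm_smul, ← areaForm_neg, ← areaForm_add]
  congr 1
  simp only [Nat.add_sub_cancel, show b v₀ + 2 - 1 = b v₀ + 1 from rfl]
  generalize ∑ j, ∑ k, insertion v₀ b v₀ j k (sect v₀ (lower b v₀) e x τ) = t
  -- The coefficients of `sect` agree by `8p + 4 + 2p(p - 1) = 2(p + 1)(p + 2)`; the insertions with
  -- factor `1/(8π)` cancel those in the mixed term.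
  match_scalars
  · field_simp [pi_ne_zero']
    ring_nf
    simp only [Complex.I_sq]
    ring
  · field_simp [pi_ne_zero']
    ring_nf
    simp only [Complex.I_sq]
    ring

theorem weilL_phiHarm (v₀ : S) (b : S → ℕ) (e : Bool) (x : Space S) (hτ : ‖τ‖ < 1) :
    weilL v₀ (fun y => phiHarm v₀ b e y τ) x = -DDc v₀ b e (nuHarm v₀ b e x) τ := by
  have h1 : (fun y => phiHarm v₀ b e y τ) = fun y => areaForm ((4 * Complex.I * rad τ ^ 2 *
      radial e (b v₀ + 2) (y v₀) τ) • harm v₀ b (sect v₀ b e y τ)) := by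
    ext1 y
    rw [phiHarm, phi_eq v₀ b e y hτ, Unitary.map_areaForm, map_smul, LinearMap.comp_apply,
      symmetrizer_harm_sect]
  have h2 : nuHarm v₀ b e x = fun σ =>
      radial e (b v₀) (x v₀) σ • harm v₀ b (sect v₀ b e x σ) := by
    ext1 σ
    rw [nuHarm, nu_eq, map_smul]
  have h3 : harm v₀ b (sectMixed v₀ b e x τ)
      = (rad τ ^ 2 * (b v₀ * (b v₀ - 1))) • harm v₀ b (sect v₀ b e x τ) := by
    have h : harm v₀ b (∑ j, ∑ k, insertion v₀ b v₀ j k (sect v₀ (lower b v₀) e x τ)) = 0 := by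
      simp only [map_sum]
      exact Finset.sum_eq_zero fun i _ => Finset.sum_eq_zero fun j _ => harm_insertion i j _
    rw [sectMixed_eq x hτ, map_smul, map_sub, map_smul, h, sub_zero, smul_smul]
  rw [h1, weilL_radial_smul v₀ b e x hτ, h2,
    DDc_radial_smul v₀ b e x (fun σ hσ q => hodgeProj_comp_harm hσ e q) hτ, h3, ← areaForm_neg]
  congr 1
  simp only [Nat.add_sub_cancel, show b v₀ + 2 - 1 = b v₀ + 1 from rfl, smul_smul, ← add_smul,
    ← neg_smul]
  congr 1
  push_cast
  field_simp [pi_ne_zero']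
  ring_nf
  simp only [Complex.I_sq]
  ring

end Orthogonal

end FunkeMillson
end

open FunkeMillson in
theorem mainTheorem9 {S : Type*} [Fintype S] [DecidableEq S] (v₀ : S) :
    (∀ (b : S × Bool → ℕ) (x : Unitary.Space S) (τ : ℂ), ‖τ‖ < 1 →
      Unitary.weilL v₀ (fun y => Unitary.phi v₀ b y τ) x
        = -Unitary.DDc v₀ b (Unitary.nu v₀ b x) τ
          + (1 / (4 * Real.pi) : ℂ) •
            ((∑ i, ∑ j, (realCLM (Unitary.insertion v₀ b (v₀, false) i j)).compContinuousAlternatingMap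
                (Unitary.phi v₀ (Unitary.lower b v₀) x τ))
            + ∑ i, ∑ j, (realCLM (Unitary.insertion v₀ b (v₀, true) i j)).compContinuousAlternatingMap
                (Unitary.phi v₀ (Unitary.lower b v₀) x τ))
      ∧ Unitary.weilL v₀ (fun y => Unitary.phiHarm v₀ b y τ) x
        = -Unitary.DDc v₀ b (Unitary.nuHarm v₀ b x) τ)
    ∧ (∀ (b : S → ℕ) (s : Bool) (x : Orthogonal.Space S) (τ : ℂ), ‖τ‖ < 1 →
      Orthogonal.weilL v₀ (fun y => Orthogonal.phi v₀ b s y τ) x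
        = -Orthogonal.DDc v₀ b s (Orthogonal.nu v₀ b s x) τ
          + (1 / (8 * Real.pi) : ℂ) •
            ∑ j, ∑ k, (realCLM (Orthogonal.insertion v₀ b v₀ j k)).compContinuousAlternatingMap
              (Orthogonal.phi v₀ (Orthogonal.lower b v₀) s x τ)
      ∧ Orthogonal.weilL v₀ (fun y => Orthogonal.phiHarm v₀ b s y τ) x
        = -Orthogonal.DDc v₀ b s (Orthogonal.nuHarm v₀ b s x) τ) := by
  refine ⟨fun b x τ hτ => ⟨Unitary.weilL_phi v₀ b x hτ, Unitary.weilL_phiHarm v₀ b x hτ⟩,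
    fun b s x τ hτ => ⟨Orthogonal.weilL_phi v₀ b s x hτ, Orthogonal.weilL_phiHarm v₀ b s x hτ⟩⟩
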